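/- **Setting.** Let $(Y_i,X_i,W_i)_{i\ge 1}$ be i.i.d. with $Y_i=h_0(X_i)+u_i$, $E[u_i\mid W_i]=0$, where $Y_i\in\mathbb R$, $X_i\in\mathcal X\subset\mathbb R^d$, $W_i\in\mathcal W\subset\mathbb R^{d_w}$. Write $Th(w)=E[h(X_i)\mid W_i=w]$ and $\|f\|_\infty=\sup_{x\in\mathcal X}|f(x)|$. Let $\mathbb N^*\subset\{1,2,\dots\}$ be the set of sieve dimensions, $K:\mathbb N\to\mathbb N$ a rule with $j\le K(j)\le C_Kj$ for a constant $C_K\ge1$, and for $J\in\mathbb N^*$, $K=K(J)$, let $\psi^J=(\psi_{J1},\dots,\psi_{JJ})'$ and $b^K=(b_{K1},\dots,b_{KK})'$ be vectors of bounded measurable functions on $\mathcal X$, $\mathcal W$ with spans $\Psi_J$, $B_K$. Put $G_{\psi,J}=E[\psi^J(X_i)\psi^J(X_i)']$, $G_{b,K}=E[b^K(W_i)b^K(W_i)']$ (both positive definite), $S_{JK}=E[b^K(W_i)\psi^J(X_i)']$ (of full column rank $J$); let $\kappa_\psi(J),\kappa_b(K)$ be the condition numbers of $G_{\psi,J},G_{b,K}$,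 and $$e_J=\lambda_{\min}(G_{\psi,J}),\quad \zeta_{\psi,J}=\sup_x\|G_{\psi,J}^{-1/2}\psi^J(x)\|_{\ell^2},\quad \zeta_{b,K}=\sup_w\|G_{b,K}^{-1/2}b^K(w)\|_{\ell^2},\quad \zeta(J)=\zeta_{b,K(J)}\vee\zeta_{\psi,J},$$ $$\xi_{\psi,J}=\sup_x\|\psi^J(x)\|_{\ell^1},\qquad \tau_J=\sup_{0\ne h\in\Psi_J}\frac{\|h\|_{L^2(X)}}{\|Th\|_{L^2(W)}},\qquad V_{\sup}(J)=\tau_J\,\xi_{\psi,J}\sqrt{(\log n)/(n e_J)}.$$ Let $\Pi_J$ be the $L^2(X)$-projection onto $\Psi_J$, $\Pi_K$ the $L^2(W)$-projection onto $B_K$, and $Q_Jh_0=(\psi^J)'[S'G_b^{-1}S]^{-1}S'G_b^{-1}E[b^K(W_i)h_0(X_i)]$. With $\Psi=(\psi^J(X_1),\dots,\psi^J(X_n))'$, $B=(b^K(W_1),\dots,b^K(W_n))'$, $Y=(Y_1,\dots,Y_n)'$, $K=K(J)$ and $A^-$ any generalized inverse ($AA^-A=A$), let $$\hat h_J(x)=\psi^J(x)'[\Psi'B(B'B)^-B'\Psi]^-\Psi'B(B'B)^-B'Y,\qquad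 \hat e_J=\lambda_{\min}(\Psi'\Psi/n),$$ $$\hat\tau_J=\sup_{0\neq h\in\Psi_J}\Big(\frac{\frac1n\sum_{i=1}^n h(X_i)^2}{\frac1n\sum_{i=1}^n\hat E[h(X_i)|W_i]^2}\Big)^{1/2},\qquad \hat E[h(X_i)|W_i=w]=b^K(w)'(B'B/n)^-\frac1n\sum_{i=1}^nb^K(W_i)h(X_i),$$ $$\hat V_{\sup}(J)=\hat\tau_J\,\xi_{\psi,J}\sqrt{(\log n)/(n\hat e_J)}.$$ Let $J_{\min}=\lfloor\log\log n\rfloor$, let $\underline J_{\max},\bar J_{\max}\in\mathbb N^*$ be increasing sequences in $n$ which for all large $n$ satisfy $J_{\min}<\underline J_{\max}\le\bar J_{\max}$, let $\hat J_{\max}$ be a possibly random integer, and let $\underline I,\bar I,\hat I$ be the sets of $j\in\mathbb N^*$ with $J_{\min}\le j$ and $j\le\underline J_{\max}$, $j\le\bar J_{\max}$, $j\le\hat J_{\max}$ respectively. For constants $\bar\sigma>0$, $C_0>0$ define $$\mathcal J_0=\{j\in\underline I:\|h_0-\Pi_jh_0\|_\infty\le C_0V_{\sup}(j)\},\qquad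 J_0=\min\mathcal J_0,$$ $$\hat{\mathcal J}=\{j\in\hat I:\|\hat h_j-\hat h_l\|_\infty\le\sqrt2\,\bar\sigma(\hat V_{\sup}(j)+\hat V_{\sup}(l))\text{ for all }l\in\hat I,\ l\ge j\},\qquad \hat J=\min\hat{\mathcal J}.$$ **Assumptions.** (Orders of magnitude in $J$ are for $J\to\infty$ in $\mathbb N^*$, with $K=K(J)$.) 1. $\mathcal X$ and $\mathcal W$ are compact rectangles with nonempty interior, on which $X_i$ and $W_i$ have densities bounded away from $0$ and $\infty$; $T:L^2(X)\to L^2(W)$ is injective; $h_0\in\mathcal H$ for a set $\mathcal H$ of bounded measurable functions; $\Psi_J\subset\Psi_{J'}$ for $J<J'$, and $\bigcup_J\Psi_J$ is dense in $(\mathcal H,\|\cdot\|_{L^2(X)})$. 2. $E[u_i^2\mid W_i]\le\bar\sigma^2$ a.s., and $E|u_i|^{2+\delta}<\infty$ for some $\delta>0$. 3. With $\bar\zeta=\zeta(\bar J_{\max})$: $\tau_{\bar J_{\max}}\bar\zeta^2\sqrt{(\log n)/n}=o(1)$; $\bar J_{\max}^{2+\epsilon}/n=O(1)$ for some $\epsilon>0$;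 $\bar\zeta^{(2+\delta)/\delta}\sqrt{(\log n)/n}=o(1)$; $\kappa_b(K)=O(\zeta_{b,K})$ and $\kappa_\psi(J)=O(\zeta_{\psi,J})$. 4. $\sup_{h\in\Psi_J,\|h\|_{L^2(X)}=1}\|(\Pi_KT-T)h\|_{L^2(W)}=o(\tau_J^{-1})$; $\tau_J\|T(h_0-\Pi_Jh_0)\|_{L^2(W)}=O(\|h_0-\Pi_Jh_0\|_{L^2(X)})$; $\|Q_Jh_0-\Pi_Jh_0\|_\infty=O(\|h_0-\Pi_Jh_0\|_\infty)$. 5. For all large $n$: $\zeta_{b,K(j)}$, $\zeta_{\psi,j}$, $\tau_j$, $e_j^{-1}$, $\kappa_b(K(j))$, $\kappa_\psi(j)$ and $V_{\sup}(j)$ are weakly increasing in $j\in\bar I$, and the bias is decreasing up to a constant: $\|h_0-\Pi_lh_0\|_\infty\le C\,\|h_0-\Pi_jh_0\|_\infty$ for $j\le l$ in $\bar I$, with $C$ independent of $n$. **Theorem.** Under these assumptions there is a constant $\bar C>0$, not depending on $\underline J_{\max}$ or $\hat J_{\max}$, such that the following holds for every $C_0\in(0,\bar C]$. If $\underline J_{\max}\le\hat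 J_{\max}\le\bar J_{\max}$ with probability approaching one and $\mathcal J_0\neq\emptyset$ for all large $n$, then $$\|\hat h_{\hat J}-h_0\|_\infty\le\|\hat h_{J_0}-h_0\|_\infty+3\bar\sigma V_{\sup}(J_0)$$ holds with probability approaching one, and $$\|\hat h_{\hat J}-h_0\|_\infty=O_p\Big(\|h_0-\Pi_{J_0}h_0\|_\infty+\tau_{J_0}\xi_{\psi,J_0}\sqrt{(\log n)/(n e_{J_0})}\Big).$$ -/

import Mathlib

open MeasureTheory ProbabilityTheory Filter Topology Asymptotics Matrix

noncomputable section

namespace NPIV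

/-- The raw objects of a nonparametric instrumental variables problem with sieves: the probability
space, the observations `(Y i, X i, W i)`, the structural function `h0`, the end points of the
rectangular supports of the regressor and of the instrument, the set `Js` of sieve dimensions,
the rule `K` for the dimension of the instrument space, and the bases
`psi J = (ψ_{J1}, …, ψ_{JJ})` and `b K = (b_{K1}, …, b_{KK})`. -/
structure Model (Ω : Type*) [MeasurableSpace Ω] (d dw : ℕ) where
  μ : Measure Ω
  Y : ℕ → Ω → ℝ
  X : ℕ → Ω → (Fin d → ℝ)
  W : ℕ → Ω → (Fin dw → ℝ)
  h0 : (Fin d → ℝ) → ℝ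
  xlo : Fin d → ℝ
  xhi : Fin d → ℝ
  wlo : Fin dw → ℝ
  whi : Fin dw → ℝ
  Js : Set ℕ
  K : ℕ → ℕ
  psi : (J : ℕ) → Fin J → (Fin d → ℝ) → ℝ
  b : (K : ℕ) → Fin K → (Fin dw → ℝ) → ℝ

/-- A choice of generalized inverses of square real matrices. -/
def IsGeneralizedInverse
    (ginv : (m : ℕ) → Matrix (Fin m) (Fin m) ℝ → Matrix (Fin m) (Fin m) ℝ) : Prop :=
  ∀ (m : ℕ) (A : Matrix (Fin m) (Fin m) ℝ), A * ginv m A * A = A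

/-- Smallest (real) eigenvalue of a matrix. -/
def lambdaMin {m : ℕ} (A : Matrix (Fin m) (Fin m) ℝ) : ℝ := sInf (spectrum ℝ A)

/-- Largest (real) eigenvalue of a matrix. -/
def lambdaMax {m : ℕ} (A : Matrix (Fin m) (Fin m) ℝ) : ℝ := sSup (spectrum ℝ A)

/-- Condition number of a positive definite matrix. -/
def condNumber {m : ℕ} (A : Matrix (Fin m) (Fin m) ℝ) : ℝ := lambdaMax A / lambdaMin A

/-- The law `P` is carried by the nondegenerate rectangle `[lo, hi]` and has there a Lebesgue
density that is bounded away from `0` and from `∞`. -/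
def HasBoundedDensityOn {m : ℕ} (P : Measure (Fin m → ℝ)) (lo hi : Fin m → ℝ) : Prop :=
  (∀ i, lo i < hi i) ∧
    ∃ (f : (Fin m → ℝ) → ℝ) (c C : ℝ), Measurable f ∧ 0 < c ∧
      (∀ x ∈ Set.Icc lo hi, c ≤ f x ∧ f x ≤ C) ∧
      P = (volume.restrict (Set.Icc lo hi)).withDensity (fun x => ENNReal.ofReal (f x))

section Probability

variable {Ω : Type*} [MeasurableSpace Ω]

/-- The events `A n` hold with probability approaching one. No measurability of `A n` is
presupposed: `μ` of the complement is the outer measure. -/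
def WPA1 (μ : Measure Ω) (A : ℕ → Set Ω) : Prop :=
  Tendsto (fun n => μ (A n)ᶜ) atTop (𝓝 0)

/-- `Z n = O_p (a n)`. -/
def IsBigOInProb (μ : Measure Ω) (Z : ℕ → Ω → ℝ) (a : ℕ → ℝ) : Prop :=
  ∀ ε : ℝ, 0 < ε → ∃ M : ℝ, 0 < M ∧
    ∀ᶠ n in atTop, μ {ω | M * |a n| < |Z n ω|} ≤ ENNReal.ofReal ε

end Probability

namespace Model

variable {Ω : Type*} [MeasurableSpace Ω] {d dw : ℕ} (M : Model Ω d dw)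

/-! ### Population quantities -/

/-- The support of the regressor. -/
def suppX : Set (Fin d → ℝ) := Set.Icc M.xlo M.xhi

/-- The support of the instrument. -/
def suppW : Set (Fin dw → ℝ) := Set.Icc M.wlo M.whi

/-- The residuals `u_i = Y_i - h_0(X_i)`. -/
def u (i : ℕ) (ω : Ω) : ℝ := M.Y i ω - M.h0 (M.X i ω)

/-- The σ-algebra generated by the instrument. -/
abbrev sigmaW : MeasurableSpace Ω := MeasurableSpace.comap (M.W 0) inferInstance

/-- Sup norm of a function over the support of the regressor. -/
def supNorm (f : (Fin d → ℝ) → ℝ) : ℝ := ⨆ x : M.suppX, |f x|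

/-- `‖h‖_{L²(X)}`. -/
def normX (h : (Fin d → ℝ) → ℝ) : ℝ := √(∫ ω, h (M.X 0 ω) ^ 2 ∂M.μ)

/-- `‖g‖_{L²(W)}`, for an element of `L²(W)` written as a random variable. -/
def normW (g : Ω → ℝ) : ℝ := √(∫ ω, g ω ^ 2 ∂M.μ)

/-- The conditional expectation operator: `T h (W) = E[h(X) | W]`, as a random variable. -/
def T (h : (Fin d → ℝ) → ℝ) : Ω → ℝ := M.μ[fun ω => h (M.X 0 ω) | M.sigmaW]

/-- The element `ψ^J(·)'c` of the sieve space `Ψ_J`. -/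
def sieveFun (J : ℕ) (c : Fin J → ℝ) (x : Fin d → ℝ) : ℝ := ∑ k, M.psi J k x * c k

/-- `G_{ψ,J} = E[ψ^J(X) ψ^J(X)']`. -/
def Gpsi (J : ℕ) : Matrix (Fin J) (Fin J) ℝ :=
  Matrix.of fun k l => ∫ ω, M.psi J k (M.X 0 ω) * M.psi J l (M.X 0 ω) ∂M.μ

/-- `G_{b,K} = E[b^K(W) b^K(W)']`. -/
def Gb (K : ℕ) : Matrix (Fin K) (Fin K) ℝ :=
  Matrix.of fun k l => ∫ ω, M.b K k (M.W 0 ω) * M.b K l (M.W 0 ω) ∂M.μ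

/-- `S_{J,K} = E[b^K(W) ψ^J(X)']` with `K = K(J)`. -/
def S (J : ℕ) : Matrix (Fin (M.K J)) (Fin J) ℝ :=
  Matrix.of fun k l => ∫ ω, M.b (M.K J) k (M.W 0 ω) * M.psi J l (M.X 0 ω) ∂M.μ

/-- `e_J = λ_min(G_{ψ,J})`. -/
def e (J : ℕ) : ℝ := lambdaMin (M.Gpsi J)

/-- `κ_ψ(J)`. -/
def kappaPsi (J : ℕ) : ℝ := condNumber (M.Gpsi J)

/-- `κ_b(K)`. -/
def kappaB (K : ℕ) : ℝ := condNumber (M.Gb K)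

/-- `ζ_{ψ,J} = sup_x ‖G_ψ^{-1/2} ψ^J(x)‖_{ℓ²}`, using `‖G^{-1/2} v‖² = v' G⁻¹ v`. -/
def zetaPsi (J : ℕ) : ℝ :=
  ⨆ x : M.suppX, √((fun k => M.psi J k x) ⬝ᵥ ((M.Gpsi J)⁻¹ *ᵥ fun k => M.psi J k x))

/-- `ζ_{b,K} = sup_w ‖G_b^{-1/2} b^K(w)‖_{ℓ²}`. -/
def zetaB (K : ℕ) : ℝ :=
  ⨆ w : M.suppW, √((fun k => M.b K k w) ⬝ᵥ ((M.Gb K)⁻¹ *ᵥ fun k => M.b K k w))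

/-- `ζ(J) = ζ_{b,K(J)} ∨ ζ_{ψ,J}`. -/
def zeta (J : ℕ) : ℝ := max (M.zetaB (M.K J)) (M.zetaPsi J)

/-- `ξ_{ψ,J} = sup_x ‖ψ^J(x)‖_{ℓ¹}`. -/
def xi (J : ℕ) : ℝ := ⨆ x : M.suppX, ∑ k, |M.psi J k x|

/-- The sieve measure of ill-posedness `τ_J = sup_{h ∈ Ψ_J, h ≠ 0} ‖h‖_{L²(X)} / ‖Th‖_{L²(W)}`. -/
def tau (J : ℕ) : ℝ :=
  ⨆ c : {c : Fin J → ℝ // c ≠ 0},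
    M.normX (M.sieveFun J c) / M.normW (M.T (M.sieveFun J c))

/-- The `L²(W)` orthogonal projection onto `B_K`, in coordinates:
`Π_K g = b^K(W)' G_b⁻¹ E[b^K(W) g]`. -/
def projB (K : ℕ) (g : Ω → ℝ) (ω : Ω) : ℝ :=
  ∑ k, M.b K k (M.W 0 ω) * ((M.Gb K)⁻¹ *ᵥ fun l => ∫ ω', M.b K l (M.W 0 ω') * g ω' ∂M.μ) k

/-- The `L²(X)` orthogonal projection onto `Ψ_J`, in coordinates:
`Π_J h = ψ^J(·)' G_ψ⁻¹ E[ψ^J(X) h(X)]`. -/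
def projPsi (J : ℕ) (h : (Fin d → ℝ) → ℝ) : (Fin d → ℝ) → ℝ :=
  M.sieveFun J ((M.Gpsi J)⁻¹ *ᵥ fun l => ∫ ω, M.psi J l (M.X 0 ω) * h (M.X 0 ω) ∂M.μ)

/-- The sieve 2SLS projection
`Q_J h = ψ^J(·)' [S' G_b⁻¹ S]⁻¹ S' G_b⁻¹ E[b^K(W) h(X)]` with `K = K(J)`. -/
def proj2SLS (J : ℕ) (h : (Fin d → ℝ) → ℝ) : (Fin d → ℝ) → ℝ :=
  M.sieveFun J
    (((M.S J)ᵀ * (M.Gb (M.K J))⁻¹ * M.S J)⁻¹ *ᵥ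
      (((M.S J)ᵀ * (M.Gb (M.K J))⁻¹) *ᵥ
        fun l => ∫ ω, M.b (M.K J) l (M.W 0 ω) * h (M.X 0 ω) ∂M.μ))

/-- `sup {‖(Π_K T - T) h‖_{L²(W)} : h ∈ Ψ_J, ‖h‖_{L²(X)} = 1}` with `K = K(J)`. -/
def instrumentError (J : ℕ) : ℝ :=
  ⨆ c : {c : Fin J → ℝ // M.normX (M.sieveFun J c) = 1},
    M.normW (fun ω =>
      M.projB (M.K J) (M.T (M.sieveFun J c)) ω - M.T (M.sieveFun J c) ω)

/-- The sup-norm bias `‖h_0 - Π_J h_0‖_∞`. -/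
def bias (J : ℕ) : ℝ := M.supNorm (fun x => M.h0 x - M.projPsi J M.h0 x)

/-- `V_sup(J) = τ_J ξ_{ψ,J} √(log n / (n e_J))`. -/
def Vsup (n J : ℕ) : ℝ := M.tau J * M.xi J * √(Real.log n / (n * M.e J))

/-! ### Estimators from the first `n` observations -/

variable (ginv : (m : ℕ) → Matrix (Fin m) (Fin m) ℝ → Matrix (Fin m) (Fin m) ℝ)

/-- The `n × J` matrix `Ψ` with rows `ψ^J(X_i)'`. -/
def Psi (n J : ℕ) (ω : Ω) : Matrix (Fin n) (Fin J) ℝ :=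
  Matrix.of fun i k => M.psi J k (M.X i ω)

/-- The `n × K` matrix `B` with rows `b^K(W_i)'`. -/
def B (n K : ℕ) (ω : Ω) : Matrix (Fin n) (Fin K) ℝ :=
  Matrix.of fun i k => M.b K k (M.W i ω)

/-- `ĉ = [Ψ'B(B'B)⁻B'Ψ]⁻ Ψ'B(B'B)⁻B'Y` with `K = K(J)`. -/
def cHat (n J : ℕ) (ω : Ω) : Fin J → ℝ :=
  let P := M.Psi n J ω
  let B := M.B n (M.K J) ω
  ginv J (Pᵀ * B * ginv (M.K J) (Bᵀ * B) * Bᵀ * P) *ᵥ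
    ((Pᵀ * B * ginv (M.K J) (Bᵀ * B) * Bᵀ) *ᵥ fun i : Fin n => M.Y i ω)

/-- The sieve NPIV estimator `ĥ_J`. -/
def hHat (n J : ℕ) (ω : Ω) : (Fin d → ℝ) → ℝ := M.sieveFun J (M.cHat ginv n J ω)

/-- `ê_J = λ_min(Ψ'Ψ/n)`. -/
def eHat (n J : ℕ) (ω : Ω) : ℝ := lambdaMin ((n : ℝ)⁻¹ • ((M.Psi n J ω)ᵀ * M.Psi n J ω))

/-- The series regression estimator
`Ê[h(X)|W = w] = b^K(w)' (B'B/n)⁻ (1/n) ∑_i b^K(W_i) h(X_i)`. -/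
def condExpHat (n K : ℕ) (ω : Ω) (h : (Fin d → ℝ) → ℝ) (w : Fin dw → ℝ) : ℝ :=
  ∑ k, M.b K k w *
    (ginv K ((n : ℝ)⁻¹ • ((M.B n K ω)ᵀ * M.B n K ω)) *ᵥ
      fun l => (n : ℝ)⁻¹ * ∑ i : Fin n, M.b K l (M.W i ω) * h (M.X i ω)) k

/-- The estimator `τ̂_J` of the measure of ill-posedness, with `K = K(J)`. -/
def tauHat (n J : ℕ) (ω : Ω) : ℝ :=
  ⨆ c : {c : Fin J → ℝ // c ≠ 0},
    √(((n : ℝ)⁻¹ * ∑ i : Fin n, M.sieveFun J c (M.X i ω) ^ 2) /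
      ((n : ℝ)⁻¹ * ∑ i : Fin n,
        M.condExpHat ginv n (M.K J) ω (M.sieveFun J c) (M.W i ω) ^ 2))

/-- `V̂_sup(J) = τ̂_J ξ_{ψ,J} √(log n / (n ê_J))`. -/
def VsupHat (n J : ℕ) (ω : Ω) : ℝ :=
  M.tauHat ginv n J ω * M.xi J * √(Real.log n / (n * M.eHat n J ω))

/-! ### Index sets, oracle and data-driven choice -/

/-- `J_min = ⌊log log n⌋`. -/
def Jmin (n : ℕ) : ℕ := ⌊Real.log (Real.log n)⌋₊

/-- The sieve dimensions between `J_min` and `top`. -/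
def indexSet (n top : ℕ) : Set ℕ := {j | j ∈ M.Js ∧ Jmin n ≤ j ∧ j ≤ top}

/-- The oracle index set. -/
def oracleSet (C0 : ℝ) (Jlow : ℕ → ℕ) (n : ℕ) : Set ℕ :=
  {j | j ∈ M.indexSet n (Jlow n) ∧ M.bias j ≤ C0 * M.Vsup n j}

/-- The oracle choice `J_0`. -/
def J0 (C0 : ℝ) (Jlow : ℕ → ℕ) (n : ℕ) : ℕ := sInf (M.oracleSet C0 Jlow n)

/-- The data-driven index set. -/
def lepskiSet (σ : ℝ) (JmaxHat : ℕ → Ω → ℕ) (n : ℕ) (ω : Ω) : Set ℕ :=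
  {j | j ∈ M.indexSet n (JmaxHat n ω) ∧
    ∀ l ∈ M.indexSet n (JmaxHat n ω), j ≤ l →
      M.supNorm (fun x => M.hHat ginv n j ω x - M.hHat ginv n l ω x) ≤
        √2 * σ * (M.VsupHat ginv n j ω + M.VsupHat ginv n l ω)}

/-- The data-driven choice `Ĵ`. -/
def Jhat (σ : ℝ) (JmaxHat : ℕ → Ω → ℕ) (n : ℕ) (ω : Ω) : ℕ :=
  sInf (M.lepskiSet ginv σ JmaxHat n ω)

/-- The sup-norm loss `‖ĥ_J - h_0‖_∞`. -/
def loss (n J : ℕ) (ω : Ω) : ℝ := M.supNorm (fun x => M.hHat ginv n J ω x - M.h0 x)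

/-! ### Assumptions -/

/-- The observations are a random sample from the model
`Y_i = h_0(X_i) + u_i`, `E[u_i | W_i] = 0`. -/
structure IsSample : Prop where
  prob : IsProbabilityMeasure M.μ
  measurable_Y : ∀ i, Measurable (M.Y i)
  measurable_X : ∀ i, Measurable (M.X i)
  measurable_W : ∀ i, Measurable (M.W i)
  measurable_h0 : Measurable M.h0
  indep : iIndepFun (fun i ω => (M.Y i ω, M.X i ω, M.W i ω)) M.μ
  ident : ∀ i, IdentDistrib (fun ω => (M.Y i ω, M.X i ω, M.W i ω))
    (fun ω => (M.Y 0 ω, M.X 0 ω, M.W 0 ω)) M.μ M.μ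
  integrable_u : Integrable (M.u 0) M.μ
  condExp_u : M.μ[M.u 0 | M.sigmaW] =ᵐ[M.μ] 0

/-- Standing conditions on the sieves: measurable basis functions, bounded on the supports;
`G_ψ`, `G_b` positive definite and `S` of full column rank; `j ≤ K(j) ≤ C_K j`. -/
structure IsSieve : Prop where
  pos : ∀ J ∈ M.Js, 1 ≤ J
  measurable_psi : ∀ J ∈ M.Js, ∀ k, Measurable (M.psi J k)
  measurable_b : ∀ J ∈ M.Js, ∀ k, Measurable (M.b (M.K J) k)
  bounded_psi : ∀ J ∈ M.Js, ∀ k, ∃ C : ℝ, ∀ x ∈ M.suppX, |M.psi J k x| ≤ C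
  bounded_b : ∀ J ∈ M.Js, ∀ k, ∃ C : ℝ, ∀ w ∈ M.suppW, |M.b (M.K J) k w| ≤ C
  posDef_psi : ∀ J ∈ M.Js, (M.Gpsi J).PosDef
  posDef_b : ∀ J ∈ M.Js, (M.Gb (M.K J)).PosDef
  rank_S : ∀ J ∈ M.Js, (M.S J).rank = J
  rule : ∃ CK : ℝ, 1 ≤ CK ∧ ∀ j : ℕ, j ≤ M.K j ∧ (M.K j : ℝ) ≤ CK * j

/-- Supports and densities, injectivity of `T`, parameter space `H`, nested and dense sieves. -/
structure DataAssumption (H : Set ((Fin d → ℝ) → ℝ)) : Prop where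
  density_X : HasBoundedDensityOn (M.μ.map (M.X 0)) M.xlo M.xhi
  density_W : HasBoundedDensityOn (M.μ.map (M.W 0)) M.wlo M.whi
  injective : ∀ h : (Fin d → ℝ) → ℝ, MemLp h 2 (M.μ.map (M.X 0)) →
    M.T h =ᵐ[M.μ] 0 → h =ᵐ[M.μ.map (M.X 0)] 0
  h0_mem : M.h0 ∈ H
  bounded : ∀ h ∈ H, Measurable h ∧ ∃ C : ℝ, ∀ x ∈ M.suppX, |h x| ≤ C
  nested : ∀ J ∈ M.Js, ∀ J' ∈ M.Js, J < J' → ∀ c : Fin J → ℝ, ∃ c' : Fin J' → ℝ,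
    M.sieveFun J c =ᵐ[M.μ.map (M.X 0)] M.sieveFun J' c'
  dense : ∀ h ∈ H, ∀ ε : ℝ, 0 < ε → ∃ J ∈ M.Js, ∃ c : Fin J → ℝ,
    M.normX (fun x => h x - M.sieveFun J c x) < ε

/-- Conditional variance bounded by `σ²` and a finite moment of order `2 + δ`. -/
structure ResidualAssumption (σ δ : ℝ) : Prop where
  condVar : M.μ[fun ω => M.u 0 ω ^ 2 | M.sigmaW] ≤ᵐ[M.μ] fun _ => σ ^ 2
  moment : Integrable (fun ω => |M.u 0 ω| ^ (2 + δ)) M.μ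

/-- Growth conditions on the largest sieve dimension and on the condition numbers. Orders of
magnitude in `J` are for `J → ∞` along the set of sieve dimensions, with `K = K(J)`. -/
structure SieveAssumption (δ : ℝ) (Jbar : ℕ → ℕ) : Prop where
  tau_zeta : Tendsto (fun n : ℕ => M.tau (Jbar n) * M.zeta (Jbar n) ^ 2 * √(Real.log n / n))
    atTop (𝓝 0)
  dim : ∃ ε : ℝ, 0 < ε ∧
    (fun n : ℕ => (Jbar n : ℝ) ^ (2 + ε) / n) =O[atTop] (fun _ => (1 : ℝ))
  moment : Tendsto (fun n : ℕ => M.zeta (Jbar n) ^ ((2 + δ) / δ) * √(Real.log n / n))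
    atTop (𝓝 0)
  cond_b : (fun J => M.kappaB (M.K J)) =O[atTop ⊓ 𝓟 M.Js] (fun J => M.zetaB (M.K J))
  cond_psi : M.kappaPsi =O[atTop ⊓ 𝓟 M.Js] M.zetaPsi

/-- Approximation and stability conditions, for `J → ∞` along the set of sieve dimensions. -/
structure ApproxAssumption : Prop where
  instrument : M.instrumentError =o[atTop ⊓ 𝓟 M.Js] (fun J => (M.tau J)⁻¹)
  stable_L2 :
    (fun J => M.tau J * M.normW (M.T (fun x => M.h0 x - M.projPsi J M.h0 x)))
      =O[atTop ⊓ 𝓟 M.Js] (fun J => M.normX (fun x => M.h0 x - M.projPsi J M.h0 x))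
  stable_sup :
    (fun J => M.supNorm (fun x => M.proj2SLS J M.h0 x - M.projPsi J M.h0 x))
      =O[atTop ⊓ 𝓟 M.Js] M.bias

/-- Weak monotonicity of the sieve quantities on the index set up to `Jbar`, for large `n`; and
the bias decreases there up to a constant factor. -/
structure MonotoneAssumption (Jbar : ℕ → ℕ) : Prop where
  zetaB : ∀ᶠ n in atTop, MonotoneOn (fun j => M.zetaB (M.K j)) (M.indexSet n (Jbar n))
  zetaPsi : ∀ᶠ n in atTop, MonotoneOn M.zetaPsi (M.indexSet n (Jbar n))
  tau : ∀ᶠ n in atTop, MonotoneOn M.tau (M.indexSet n (Jbar n))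
  inv_e : ∀ᶠ n in atTop, MonotoneOn (fun j => (M.e j)⁻¹) (M.indexSet n (Jbar n))
  kappaB : ∀ᶠ n in atTop, MonotoneOn (fun j => M.kappaB (M.K j)) (M.indexSet n (Jbar n))
  kappaPsi : ∀ᶠ n in atTop, MonotoneOn M.kappaPsi (M.indexSet n (Jbar n))
  Vsup : ∀ᶠ n in atTop, MonotoneOn (M.Vsup n) (M.indexSet n (Jbar n))
  bias : ∃ C : ℝ, ∀ᶠ n in atTop, ∀ j ∈ M.indexSet n (Jbar n), ∀ l ∈ M.indexSet n (Jbar n),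
    j ≤ l → M.bias l ≤ C * M.bias j

/-- `Jlow` and `Jbar` are increasing sequences of sieve dimensions with
`J_min < Jlow ≤ Jbar`. -/
structure IndexBounds (Jlow Jbar : ℕ → ℕ) : Prop where
  mono_low : Monotone Jlow
  mono_bar : Monotone Jbar
  mem_low : ∀ n, Jlow n ∈ M.Js
  mem_bar : ∀ n, Jbar n ∈ M.Js
  min_lt_low : ∀ᶠ n in atTop, Jmin n < Jlow n
  low_le_bar : ∀ᶠ n in atTop, Jlow n ≤ Jbar n

end Model

end NPIV

end

/-! Everything reduces to one event, `UniformBounds`, on which for all sieve dimensions j up to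
`Jbar` at once the loss of ĥ_j is at most C·bias(j) + √2(1 − 2η)σV(j), and V̂(j) lies within (1 ±
η)V(j). Here η > 0 is a small fixed constant.

On that event the argument is deterministic (`UniformBounds.loss_Jhat_le`). For l ≥ J_0 the biases
at J_0 and l are bounded by a multiple of C_0 V(J_0), so for small C_0 they cost at most √2ησV(J_0).
The stochastic parts cost √2(1 − 2η)σ(V(J_0) + V(l)). Together this is below the Lepski threshold,
which is at least √2(1 − η)σ(V(J_0) + V(l)). Hence J_0 passes every comparison and Ĵ ≤ J_0. The
comparison that Ĵ itself passed against J_0, with V(Ĵ) ≤ V(J_0), then gives ‖ĥ_Ĵ − ĥ_{J_0}‖_∞ ≤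
2√2(1 + η)σV(J_0) ≤ 3σV(J_0).

The event has probability tending to one because ĥ_j − h_0 is the sum of four terms: the effect of
replacing population by sample moments, the difference Q_j h_0 − Π_j h_0, the population two-stage
least squares map applied to the sample moment of the residuals, and minus the approximation error
h_0 − Π_j h_0. The second and fourth are of the order of the bias.

The third term fixes the constant √2. In sup norm it is at most ξ_j times its largest coefficient,
and each coefficient is a sample mean of q(W_i)u_i with ‖q‖_{L²(W)} at most about τ_j/√e_j. There
are O(Jbar²) = O(n^{1−κ}) such means over all j, since Jbar^{2+ε} = O(n). Truncation and a Chernoff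
bound with nearly Gaussian constant bound all of them after normalization by √2(1 − 4η)σ√(log n/n);
the power κ to spare pays for the margin η (`tendsto_measure_exists_weighted_sum_gt`).

The first term needs only that the Gram matrices concentrate in the norms of their population
versions at a rate t with τζt → 0. This is a matrix Chernoff bound (`measure_gram_bilin_gt_le`),
resting on Golden–Thompson. Two-stage least squares is treated as a saddle point system, whose
solution is compared with that of the population system by testing against suitable vectors
(`saddle_perturbation`). The resulting remainder is a small multiple of V(j) plus a multiple of the
bias, because ζ_ψ ≤ ξ/√e. The same closeness of moments compares τ̂ with τ and ê with e, hence V̂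
with V. -/

noncomputable section

/-! ### The Golden–Thompson inequality for real symmetric matrices -/

section TraceInequalities

variable {n : Type*} [Fintype n]

theorem Matrix.trace_transpose_mul_self_nonneg (M : Matrix n n ℝ) : 0 ≤ (Mᵀ * M).trace := by
  simp only [trace, diag, mul_apply, transpose_apply]
  exact Finset.sum_nonneg fun i _ => Finset.sum_nonneg fun j _ => mul_self_nonneg _

/-- Cauchy–Schwarz for the trace form. -/
theorem Matrix.trace_mul_le_sqrt_mul_sqrt (P Q : Matrix n n ℝ) :
    (P * Q).trace ≤ √((Pᵀ * P).trace) * √((Qᵀ * Q).trace) := by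
  have h := Finset.sum_mul_sq_le_sq_mul_sq (Finset.univ : Finset (n × n))
    (fun p => P p.1 p.2) (fun p => Q p.2 p.1)
  have e1 : (P * Q).trace = ∑ p : n × n, P p.1 p.2 * Q p.2 p.1 := by
    simp [trace, mul_apply, Fintype.sum_prod_type]
  have e2 : (Pᵀ * P).trace = ∑ p : n × n, P p.1 p.2 ^ 2 := by
    simp [trace, mul_apply, Fintype.sum_prod_type_right, sq]
  have e3 : (Qᵀ * Q).trace = ∑ p : n × n, Q p.2 p.1 ^ 2 := by
    simp [trace, mul_apply, Fintype.sum_prod_type, sq]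
  rw [e1, e2, e3, ← Real.sqrt_mul (Finset.sum_nonneg fun _ _ => sq_nonneg _)]
  exact Real.le_sqrt_of_sq_le h

variable [DecidableEq n]

theorem Matrix.trace_mul_pow_comm (A B : Matrix n n ℝ) (m : ℕ) :
    ((A * B) ^ m).trace = ((B * A) ^ m).trace := by
  cases m with
  | zero => simp
  | succ m =>
    rw [pow_succ, ← Matrix.mul_assoc, mul_pow_mul, Matrix.trace_mul_comm, ← Matrix.mul_assoc,
      ← pow_succ']

/-- The two families of inequalities feed each other in the induction. The first at `k + 1` is the
first at `k` for M², rearranged cyclically, then the second at `k` for MM' and M'M, then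
Cauchy–Schwarz; both factors of the latter agree since MM' and M'M have powers of equal trace. The
second at `k + 1` is the first at `k` for PQ, whose Gram matrix is QP²Q, followed by the second at
`k` for P² and Q². -/
theorem Matrix.trace_pow_two_pow_le (k : ℕ) :
    (∀ M : Matrix n n ℝ, (M ^ 2 ^ (k + 1)).trace ≤ ((Mᵀ * M) ^ 2 ^ k).trace) ∧
    (∀ P Q : Matrix n n ℝ, Pᵀ = P → Qᵀ = Q →
      ((P * Q) ^ 2 ^ k).trace ≤ (P ^ 2 ^ k * Q ^ 2 ^ k).trace) := by
  induction k with
  | zero =>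
    refine ⟨fun M => ?_, fun P Q _ _ => by simp⟩
    have h := trace_mul_le_sqrt_mul_sqrt M M
    rw [Real.mul_self_sqrt (Matrix.trace_transpose_mul_self_nonneg M)] at h
    simpa [sq] using h
  | succ k ih =>
    obtain ⟨ih1, ih2⟩ := ih
    refine ⟨fun M => ?_, fun P Q hP hQ => ?_⟩
    · have h1 := ih1 (M ^ 2)
      have e1 : ((M ^ 2)ᵀ * M ^ 2) = Mᵀ * (Mᵀ * M * M) := by
        simp [sq, transpose_mul, Matrix.mul_assoc]
      have e2 : (Mᵀ * M * M) * Mᵀ = (Mᵀ * M) * (M * Mᵀ) := by simp only [Matrix.mul_assoc]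
      rw [e1, trace_mul_pow_comm, e2, trace_mul_pow_comm, ← pow_mul, ← pow_succ'] at h1
      have h2 := ih2 (M * Mᵀ) (Mᵀ * M) (by simp [transpose_mul]) (by simp [transpose_mul])
      have h3 := trace_mul_le_sqrt_mul_sqrt ((M * Mᵀ) ^ 2 ^ k) ((Mᵀ * M) ^ 2 ^ k)
      have hnn := Matrix.trace_transpose_mul_self_nonneg ((Mᵀ * M) ^ 2 ^ k)
      simp only [transpose_pow, transpose_mul, transpose_transpose, ← pow_add, ← two_mul,
        ← pow_succ', trace_mul_pow_comm M Mᵀ] at h3 hnn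
      rw [Real.mul_self_sqrt hnn] at h3
      exact h1.trans (h2.trans h3)
    · have h1 := ih1 (P * Q)
      have h2 := ih2 (P ^ 2) (Q ^ 2) (by rw [transpose_pow, hP]) (by rw [transpose_pow, hQ])
      have e : (Q * P) * (P * Q) = Q * (P ^ 2 * Q) := by simp only [sq, Matrix.mul_assoc]
      have e' : P ^ 2 * Q * Q = P ^ 2 * Q ^ 2 := by simp only [sq, Matrix.mul_assoc]
      rw [transpose_mul, hP, hQ, e, trace_mul_pow_comm Q, e'] at h1
      simpa [← pow_mul, ← pow_succ'] using h1.trans h2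

end TraceInequalities

/-! ### The Lie–Trotter product formula -/

section LieTrotter

variable {𝔸 : Type*} [NormedRing 𝔸] [NormOneClass 𝔸]

/-- Telescoping, one factor at a time. The exponent `N + 1` keeps truncated subtraction out of `C ^
N`. -/
theorem norm_pow_sub_pow_le (x y : 𝔸) (C : ℝ) (hx : ‖x‖ ≤ C) (hy : ‖y‖ ≤ C) (N : ℕ) :
    ‖x ^ (N + 1) - y ^ (N + 1)‖ ≤ (N + 1) * C ^ N * ‖x - y‖ := by
  have hC : 0 ≤ C := (norm_nonneg _).trans hx
  induction N with
  | zero => simp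
  | succ N ih =>
    have e : x ^ (N + 1 + 1) - y ^ (N + 1 + 1) = x * (x ^ (N + 1) - y ^ (N + 1)) +
        (x - y) * y ^ (N + 1) := by rw [pow_succ' x, pow_succ' y]; noncomm_ring
    rw [e]
    have hyp : ‖y ^ (N + 1)‖ ≤ C ^ (N + 1) :=
      (norm_pow_le _ _).trans (pow_le_pow_left₀ (norm_nonneg _) hy _)
    calc _ ≤ ‖x‖ * ‖x ^ (N + 1) - y ^ (N + 1)‖ + ‖x - y‖ * ‖y ^ (N + 1)‖ :=
          (norm_add_le _ _).trans (add_le_add (norm_mul_le _ _) (norm_mul_le _ _))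
      _ ≤ C * ((N + 1) * C ^ N * ‖x - y‖) + ‖x - y‖ * C ^ (N + 1) := by gcongr
      _ = _ := by push_cast; ring

variable [NormedAlgebra ℝ 𝔸]

theorem norm_exp_le_exp_norm (x : 𝔸) : ‖NormedSpace.exp x‖ ≤ Real.exp ‖x‖ := by
  rw [NormedSpace.exp_eq_tsum ℝ, Real.exp_eq_exp_ℝ, NormedSpace.exp_eq_tsum ℝ]
  have hs := NormedSpace.expSeries_summable' (𝕂 := ℝ) ‖x‖
  refine tsum_of_norm_bounded hs.hasSum fun n => ?_
  rw [norm_smul, norm_inv, Real.norm_natCast, smul_eq_mul]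
  gcongr
  exact norm_pow_le _ _

variable [CompleteSpace 𝔸]

/-- The Lie–Trotter product formula, along powers of two. -/
theorem tendsto_exp_mul_exp_pow (A B : 𝔸) :
    Tendsto (fun k : ℕ => (NormedSpace.exp ((2 ^ k : ℝ)⁻¹ • A) *
      NormedSpace.exp ((2 ^ k : ℝ)⁻¹ • B)) ^ 2 ^ k) atTop (𝓝 (NormedSpace.exp (A + B))) := by
  set f : ℝ → 𝔸 := fun t => NormedSpace.exp (t • A) * NormedSpace.exp (t • B)
  set g : ℝ → 𝔸 := fun t => NormedSpace.exp (t • (A + B))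
  -- Both curves start at 1 with derivative A + B, so they differ by o(t). Over 2^k factors with t =
  -- 2^{-k} the telescoped error is then 2^k·o(2^{-k}).
  have hd : HasDerivAt (fun t => f t - g t) 0 0 := by
    have h1 := (hasDerivAt_exp_smul_const (𝕂 := ℝ) A (0 : ℝ)).mul
      (hasDerivAt_exp_smul_const (𝕂 := ℝ) B (0 : ℝ))
    have h2 := hasDerivAt_exp_smul_const (𝕂 := ℝ) (A + B) (0 : ℝ)
    have h := h1.sub h2
    simp only [zero_smul, NormedSpace.exp_zero, one_mul, mul_one, sub_self] at h
    exact h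
  set t : ℕ → ℝ := fun k => (2 ^ k : ℝ)⁻¹
  have ht : Tendsto t atTop (𝓝[≠] 0) := by
    refine tendsto_nhdsWithin_iff.2 ⟨?_, Eventually.of_forall fun k => by simp [t]⟩
    exact tendsto_inv_atTop_zero.comp (tendsto_pow_atTop_atTop_of_one_lt one_lt_two)
  have h0 : f 0 - g 0 = 0 := by simp [f, g]
  have hs : Tendsto (fun k => (t k)⁻¹ • (f (t k) - g (t k))) atTop (𝓝 0) := by
    have := (hasDerivAt_iff_tendsto_slope.1 hd).comp ht
    simpa [slope_def_module, h0, Function.comp_def] using this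
  set c := ‖A‖ + ‖B‖
  have hdiff : Tendsto (fun k => f (t k) ^ 2 ^ k - g (t k) ^ 2 ^ k) atTop (𝓝 0) := by
    have hb : Tendsto (fun k => Real.exp c * ‖(t k)⁻¹ • (f (t k) - g (t k))‖) atTop (𝓝 0) := by
      simpa using (hs.norm.const_mul (Real.exp c))
    refine squeeze_zero_norm (fun k => ?_) hb
    have htk : 0 < t k := by positivity
    have hf : ‖f (t k)‖ ≤ Real.exp (t k * c) := by
      calc ‖f (t k)‖ ≤ ‖NormedSpace.exp (t k • A)‖ * ‖NormedSpace.exp (t k • B)‖ :=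
            norm_mul_le _ _
        _ ≤ Real.exp ‖t k • A‖ * Real.exp ‖t k • B‖ := by
            gcongr <;> exact norm_exp_le_exp_norm _
        _ = _ := by
            rw [← Real.exp_add, norm_smul, norm_smul, Real.norm_of_nonneg htk.le]; congr 1; ring
    have hg : ‖g (t k)‖ ≤ Real.exp (t k * c) := by
      refine (norm_exp_le_exp_norm _).trans (Real.exp_le_exp.2 ?_)
      rw [norm_smul, Real.norm_of_nonneg htk.le]
      exact mul_le_mul_of_nonneg_left (norm_add_le _ _) htk.le
    have hN : 2 ^ k = (2 ^ k - 1) + 1 := by have := Nat.one_le_two_pow (n := k); omega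
    have hN' : ((2 ^ k - 1 : ℕ) : ℝ) + 1 = (t k)⁻¹ := by
      simp only [t, inv_inv]; exact_mod_cast hN.symm
    have hp := norm_pow_sub_pow_le _ _ _ hf hg (2 ^ k - 1)
    rw [← hN, hN'] at hp
    refine hp.trans ?_
    rw [norm_smul, norm_inv, Real.norm_of_nonneg htk.le]
    have hle : Real.exp (t k * c) ^ (2 ^ k - 1) ≤ Real.exp c := by
      rw [← Real.exp_nat_mul]
      refine Real.exp_le_exp.2 ?_
      have hc : 0 ≤ c := by positivity
      have : ((2 ^ k - 1 : ℕ) : ℝ) * t k ≤ 1 := by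
        rw [← le_div_iff₀ htk, one_div, ← hN']; linarith
      nlinarith
    have := norm_nonneg (f (t k) - g (t k))
    calc _ ≤ (t k)⁻¹ * Real.exp c * ‖f (t k) - g (t k)‖ := by gcongr
      _ = _ := by ring
  have hg : ∀ k, g (t k) ^ 2 ^ k = NormedSpace.exp (A + B) := by
    intro k
    have : NormedAlgebra ℚ 𝔸 := NormedAlgebra.restrictScalars ℚ ℝ 𝔸
    rw [← NormedSpace.exp_nsmul, ← Nat.cast_smul_eq_nsmul ℝ, smul_smul]
    simp [t]
  have := hdiff.add (tendsto_const_nhds (x := NormedSpace.exp (A + B)))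
  refine (by simpa using this : Tendsto _ _ _).congr fun k => ?_
  rw [hg]; simp [f, t]

end LieTrotter

section GoldenThompson

variable {n : Type*} [Fintype n] [DecidableEq n]

/-- The Golden–Thompson inequality. -/
theorem Matrix.trace_exp_add_le (A B : Matrix n n ℝ) (hA : Aᵀ = A) (hB : Bᵀ = B) :
    (NormedSpace.exp (A + B)).trace ≤ (NormedSpace.exp A * NormedSpace.exp B).trace := by
  -- The operator norm satisfies ‖1‖ = 1, as the product formula requires, only on a nonempty index
  -- type.
  rcases isEmpty_or_nonempty n with h | h
  · simp [trace]
  have h1 : Tendsto (fun k : ℕ => (NormedSpace.exp ((2 ^ k : ℝ)⁻¹ • A) *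
      NormedSpace.exp ((2 ^ k : ℝ)⁻¹ • B)) ^ 2 ^ k) atTop (𝓝 (NormedSpace.exp (A + B))) := by
    open scoped Norms.Operator in exact tendsto_exp_mul_exp_pow A B
  have h2 := (Continuous.matrix_trace continuous_id).continuousAt.tendsto.comp h1
  -- Along the product formula the trace inequality for 2^k-th powers has the same right-hand side
  -- for every k, namely tr(e^A e^B).
  refine le_of_tendsto h2 (Eventually.of_forall fun k => ?_)
  have hs : ∀ C : Matrix n n ℝ, Cᵀ = C → (NormedSpace.exp ((2 ^ k : ℝ)⁻¹ • C))ᵀ =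
      NormedSpace.exp ((2 ^ k : ℝ)⁻¹ • C) := fun C hC => by
    rw [← exp_transpose, transpose_smul, hC]
  have hp : ∀ C : Matrix n n ℝ, NormedSpace.exp ((2 ^ k : ℝ)⁻¹ • C) ^ 2 ^ k =
      NormedSpace.exp C := fun C => by
    rw [← exp_nsmul, ← Nat.cast_smul_eq_nsmul ℝ, smul_smul]; simp
  have := (trace_pow_two_pow_le k).2 _ _ (hs A hA) (hs B hB)
  rw [hp, hp] at this
  exact this

end GoldenThompson

/-! ### A matrix Chernoff bound for sums of independent random matrices -/

section ExpSymm

variable {ι : Type*} [Fintype ι]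

/-- Polarization: four times the bilinear form is the difference of the quadratic form at x + y and
x − y. -/
theorem Matrix.abs_apply_le_of_form {A : Matrix ι ι ℝ} (hA : Aᵀ = A)
    (h : ∀ x : ι → ℝ, |x ⬝ᵥ (A *ᵥ x)| ≤ x ⬝ᵥ x) (x y : ι → ℝ) :
    |x ⬝ᵥ (A *ᵥ y)| ≤ (x ⬝ᵥ x + y ⬝ᵥ y) / 2 := by
  have hs : y ⬝ᵥ (A *ᵥ x) = x ⬝ᵥ (A *ᵥ y) := by
    rw [dotProduct_mulVec, ← mulVec_transpose, hA, dotProduct_comm]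
  have h1 := h (x + y)
  have h2 := h (x - y)
  simp only [mulVec_add, mulVec_sub, dotProduct_add, dotProduct_sub, add_dotProduct,
    sub_dotProduct, hs, dotProduct_comm y x] at h1 h2
  rw [abs_le] at *
  constructor <;> linarith

variable [DecidableEq ι]

theorem Matrix.IsHermitian.eq_conj_diagonal {A : Matrix ι ι ℝ} (hA : A.IsHermitian) :
    A = (hA.eigenvectorUnitary : Matrix ι ι ℝ) * diagonal hA.eigenvalues *
      (hA.eigenvectorUnitary : Matrix ι ι ℝ)ᴴ := by
  conv_lhs => rw [hA.spectral_theorem, Unitary.conjStarAlgAut_apply]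
  rfl

theorem Matrix.IsHermitian.exp_eq {A : Matrix ι ι ℝ} (hA : A.IsHermitian) :
    NormedSpace.exp A = (hA.eigenvectorUnitary : Matrix ι ι ℝ) *
      diagonal (fun i => Real.exp (hA.eigenvalues i)) *
      (hA.eigenvectorUnitary : Matrix ι ι ℝ)ᴴ := by
  have hU : (hA.eigenvectorUnitary : Matrix ι ι ℝ) * (hA.eigenvectorUnitary : Matrix ι ι ℝ)ᴴ = 1 :=
    Unitary.coe_mul_star_self _
  have hinv := inv_eq_right_inv hU
  have hu : IsUnit (hA.eigenvectorUnitary : Matrix ι ι ℝ) := IsUnit.of_mul_eq_one _ hU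
  conv_lhs => rw [hA.eq_conj_diagonal, ← hinv, exp_conj _ _ hu, hinv, exp_diagonal]
  congr 3
  ext i
  rw [Pi.coe_exp, Real.exp_eq_exp_ℝ]

theorem Matrix.IsHermitian.trace_exp {A : Matrix ι ι ℝ} (hA : A.IsHermitian) :
    (NormedSpace.exp A).trace = ∑ i, Real.exp (hA.eigenvalues i) := by
  have hU : (hA.eigenvectorUnitary : Matrix ι ι ℝ)ᴴ * (hA.eigenvectorUnitary : Matrix ι ι ℝ) = 1 :=
    Unitary.coe_star_mul_self hA.eigenvectorUnitary
  rw [hA.exp_eq, Matrix.trace_mul_comm, ← Matrix.mul_assoc, hU, Matrix.one_mul]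
  simp [trace]

theorem Matrix.IsHermitian.posSemidef_exp {A : Matrix ι ι ℝ} (hA : A.IsHermitian) :
    (NormedSpace.exp A).PosSemidef := by
  rw [hA.exp_eq]
  exact (PosSemidef.diagonal fun i => (Real.exp_pos _).le).mul_mul_conjTranspose_same _

theorem Matrix.IsHermitian.exists_eigenvalue_form {A : Matrix ι ι ℝ} (hA : A.IsHermitian) (i : ι) :
    ∃ x : ι → ℝ, x ⬝ᵥ x = 1 ∧ hA.eigenvalues i = x ⬝ᵥ (A *ᵥ x) := by
  refine ⟨hA.eigenvectorBasis i, ?_, ?_⟩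
  · have h1 := hA.eigenvectorBasis.orthonormal.1 i
    have h2 := EuclideanSpace.real_norm_sq_eq (hA.eigenvectorBasis i)
    rw [h1] at h2
    simp only [dotProduct, ← sq]
    rw [← h2]; norm_num
  · have := hA.eigenvalues_eq i
    simpa using this

/-- In an eigenbasis this is the scalar inequality e^λ ≤ 1 + λ + λ² for |λ| ≤ 1. The quadratic
majorant has a computable expectation. -/
theorem Matrix.IsHermitian.exp_le_quadratic {A : Matrix ι ι ℝ} (hA : A.IsHermitian)
    (h : ∀ x : ι → ℝ, |x ⬝ᵥ (A *ᵥ x)| ≤ x ⬝ᵥ x) :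
    (1 + A + A * A - NormedSpace.exp A).PosSemidef := by
  set U := (hA.eigenvectorUnitary : Matrix ι ι ℝ)
  have hU : U * Uᴴ = 1 := Unitary.coe_mul_star_self _
  have hU' : Uᴴ * U = 1 := Unitary.coe_star_mul_self hA.eigenvectorUnitary
  have h1 : A * A = U * diagonal (fun i => hA.eigenvalues i * hA.eigenvalues i) * Uᴴ := by
    conv_lhs => rw [hA.eq_conj_diagonal]
    calc _ = U * diagonal hA.eigenvalues * (Uᴴ * U) * diagonal hA.eigenvalues * Uᴴ := by
          simp only [Matrix.mul_assoc]; rfl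
      _ = _ := by rw [hU', Matrix.mul_one, Matrix.mul_assoc U, diagonal_mul_diagonal]
  have h2 : 1 + A + A * A - NormedSpace.exp A = U * diagonal (fun i => 1 + hA.eigenvalues i +
      hA.eigenvalues i * hA.eigenvalues i - Real.exp (hA.eigenvalues i)) * Uᴴ := by
    rw [h1, hA.exp_eq]
    conv_lhs => enter [1, 1, 2]; rw [hA.eq_conj_diagonal]
    rw [← hU, ← Matrix.mul_one U, ← diagonal_one]
    conv_lhs => enter [1, 1, 1, 1]; rw [diagonal_one, Matrix.mul_one]
    rw [diagonal_one, Matrix.mul_one]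
    change U * Uᴴ + U * diagonal _ * Uᴴ + _ - U * _ * Uᴴ = _
    nth_rw 1 [← Matrix.mul_one U]
    rw [← diagonal_one, ← Matrix.add_mul, ← Matrix.mul_add, ← Matrix.add_mul, ← Matrix.mul_add,
      ← Matrix.sub_mul, ← Matrix.mul_sub, diagonal_add, diagonal_add, diagonal_sub]
  rw [h2]
  refine (PosSemidef.diagonal fun i => ?_).mul_mul_conjTranspose_same _
  obtain ⟨x, hx1, hx2⟩ := hA.exists_eigenvalue_form i
  have hl : |hA.eigenvalues i| ≤ 1 := by rw [hx2, ← hx1]; exact h x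
  have := (abs_le.1 (Real.abs_exp_sub_one_sub_id_le hl)).2
  simp only [Pi.zero_apply]
  nlinarith

/-- If the trace were below e^T, every eigenvalue would be at most T. This places the event that
some direction x has a large quadratic form inside a scalar event, to which Markov's inequality
applies with no union over x. -/
theorem Matrix.IsHermitian.exp_le_trace_exp {A : Matrix ι ι ℝ} (hA : A.IsHermitian) {x : ι → ℝ}
    {T : ℝ} (h : T * (x ⬝ᵥ x) < x ⬝ᵥ (A *ᵥ x)) : Real.exp T ≤ (NormedSpace.exp A).trace := by
  by_contra! hlt
  rw [hA.trace_exp] at hlt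
  have hl : ∀ i, hA.eigenvalues i ≤ T := fun i => by
    rw [← Real.exp_le_exp]
    exact (Finset.single_le_sum (f := fun i => Real.exp (hA.eigenvalues i))
      (fun j _ => (Real.exp_pos _).le) (Finset.mem_univ i)).trans hlt.le
  set U := (hA.eigenvectorUnitary : Matrix ι ι ℝ)
  have hU : U * Uᴴ = 1 := Unitary.coe_mul_star_self _
  have hp : (T • (1 : Matrix ι ι ℝ) - A).PosSemidef := by
    have : T • (1 : Matrix ι ι ℝ) - A = U * diagonal (fun i => T - hA.eigenvalues i) * Uᴴ := by
      conv_lhs => enter [2]; rw [hA.eq_conj_diagonal]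
      rw [← diagonal_sub, Matrix.mul_sub, Matrix.sub_mul]
      congr 1
      rw [← smul_one_eq_diagonal, Matrix.mul_smul, Matrix.mul_one, Matrix.smul_mul, hU]
    rw [this]
    exact (PosSemidef.diagonal fun i => sub_nonneg.2 (hl i)).mul_mul_conjTranspose_same _
  have := hp.dotProduct_mulVec_nonneg x
  simp [Matrix.sub_mulVec, Matrix.smul_mulVec] at this
  linarith

/-- Diagonalizing B turns the trace into a sum of eigenvalues of B times diagonal entries of a
conjugate of A, all nonnegative. It makes B ↦ tr(AB) monotone in the Loewner order. -/
theorem Matrix.PosSemidef.trace_mul_nonneg {A B : Matrix ι ι ℝ} (hA : A.PosSemidef)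
    (hB : B.PosSemidef) : 0 ≤ (A * B).trace := by
  rw [hB.1.eq_conj_diagonal, ← Matrix.mul_assoc, ← Matrix.mul_assoc, Matrix.trace_mul_comm,
    ← Matrix.mul_assoc, ← Matrix.mul_assoc]
  simp only [trace, diag, mul_diagonal]
  exact Finset.sum_nonneg fun i _ => mul_nonneg
    (hA.conjTranspose_mul_mul_same _).diag_nonneg (hB.eigenvalues_nonneg i)

/-- Needed only for integrability, so a crude bound suffices. -/
theorem Matrix.abs_exp_apply_le {A : Matrix ι ι ℝ} {c : ℝ} (hc : ∀ i j, |A i j| ≤ c) (k l : ι) :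
    |NormedSpace.exp A k l| ≤ Real.exp (Fintype.card ι * c) := by
  have : Nonempty ι := ⟨k⟩
  open scoped Norms.Operator in
  have h1 : ∀ B : Matrix ι ι ℝ, |B k l| ≤ ‖B‖ := fun B => by
    have h2 := linfty_opNorm_mulVec B (Pi.single l 1)
    rw [mulVec_single_one] at h2
    have h3 : ‖(Pi.single l 1 : ι → ℝ)‖ = 1 := by simp [Pi.norm_single]
    rw [h3, mul_one] at h2
    exact (norm_le_pi_norm (B.col l) k).trans h2
  open scoped Norms.Operator in
  have h2 : ‖A‖ ≤ Fintype.card ι * c := by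
    have hc0 : 0 ≤ c := (abs_nonneg _).trans (hc k l)
    rw [linfty_opNorm_def]
    have : (0 : ℝ) ≤ Fintype.card ι * c := by positivity
    lift (Fintype.card ι * c : ℝ) to NNReal using this with C hC
    rw [NNReal.coe_le_coe]
    refine Finset.sup_le fun i _ => ?_
    rw [← NNReal.coe_le_coe, hC]
    push_cast
    refine (Finset.sum_le_card_nsmul _ _ c fun j _ => hc i j).trans ?_
    simp
  open scoped Norms.Operator in
  exact (h1 _).trans ((norm_exp_le_exp_norm A).trans (Real.exp_le_exp.2 h2))

end ExpSymm

section MatrixMGF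

variable {ι : Type*} [Fintype ι] [DecidableEq ι]

theorem continuous_exp_of_apply (k l : ι) :
    Continuous fun S : ι → ι → ℝ => NormedSpace.exp (Matrix.of S) k l := by
  have h : Continuous fun A : Matrix ι ι ℝ => NormedSpace.exp A := by
    open scoped Norms.Operator in
    have : NormedAlgebra ℚ (Matrix ι ι ℝ) := NormedAlgebra.restrictScalars ℚ ℝ _
    exact NormedSpace.exp_continuous
  have h2 : Continuous fun A : Matrix ι ι ℝ => A k l := continuous_id.matrix_elem k l
  exact h2.comp (h.comp (continuous_id : Continuous fun S : ι → ι → ℝ => S))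

variable {Ω : Type*} [MeasurableSpace Ω] {μ : Measure Ω} [IsProbabilityMeasure μ]

theorem integrable_of_measurable_of_abs_le {f : Ω → ℝ} (hf : Measurable f) {C : ℝ}
    (h : ∀ᵐ ω ∂μ, |f ω| ≤ C) : Integrable f μ :=
  Integrable.of_bound hf.aestronglyMeasurable C (by simpa using h)

/-- The Ahlswede–Winter bound on the trace of the matrix exponential of a sum of independent
centred random matrices whose quadratic forms are bounded by one. -/
theorem integral_trace_exp_sum_le {X : ℕ → Ω → ι → ι → ℝ} (hm : ∀ i, Measurable (X i))
    (hind : iIndepFun X μ) (hsymm : ∀ i ω, (Matrix.of (X i ω))ᵀ = Matrix.of (X i ω))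
    (hb : ∀ i, ∀ᵐ ω ∂μ, ∀ x : ι → ℝ, |x ⬝ᵥ (Matrix.of (X i ω) *ᵥ x)| ≤ x ⬝ᵥ x)
    (hE : ∀ i k l, ∫ ω, X i ω k l ∂μ = 0) {v : ℝ} (hv0 : 0 ≤ v)
    (hv : ∀ i (x : ι → ℝ),
      ∫ ω, x ⬝ᵥ ((Matrix.of (X i ω) * Matrix.of (X i ω)) *ᵥ x) ∂μ ≤ v * (x ⬝ᵥ x)) (n : ℕ) :
    Integrable (fun ω => (NormedSpace.exp (Matrix.of ((∑ i ∈ Finset.range n, X i) ω))).trace) μ ∧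
    ∫ ω, (NormedSpace.exp (Matrix.of ((∑ i ∈ Finset.range n, X i) ω))).trace ∂μ ≤
      Fintype.card ι * (1 + v) ^ n := by
  have hentry : ∀ i, ∀ᵐ ω ∂μ, ∀ k l, |X i ω k l| ≤ 1 := fun i => by
    filter_upwards [hb i] with ω h k l
    have := abs_apply_le_of_form (hsymm i ω) h (Pi.single k 1) (Pi.single l 1)
    simpa using this
  have hsm : ∀ n, Measurable (∑ i ∈ Finset.range n, X i) := fun n => by
    rw [Finset.sum_fn]
    exact Finset.measurable_sum _ fun i _ => hm i
  have hSentry : ∀ n, ∀ᵐ ω ∂μ, ∀ k l, |(∑ i ∈ Finset.range n, X i) ω k l| ≤ n := fun n => by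
    filter_upwards [ae_all_iff.2 hentry] with ω h k l
    simp only [Finset.sum_apply]
    refine (Finset.abs_sum_le_sum_abs _ _).trans ?_
    exact (Finset.sum_le_card_nsmul _ _ 1 fun i _ => h i k l).trans (by simp)
  have hPm : ∀ n k l, Measurable fun ω =>
      NormedSpace.exp (Matrix.of ((∑ i ∈ Finset.range n, X i) ω)) k l := fun n k l =>
    (continuous_exp_of_apply k l).measurable.comp (hsm n)
  have hPi : ∀ n k l, Integrable (fun ω =>
      NormedSpace.exp (Matrix.of ((∑ i ∈ Finset.range n, X i) ω)) k l) μ := fun n k l => by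
    refine integrable_of_measurable_of_abs_le (hPm n k l) (C := Real.exp (Fintype.card ι * n)) ?_
    filter_upwards [hSentry n] with ω h
    exact abs_exp_apply_le (A := Matrix.of _) (fun i j => h i j) k l
  have htr : ∀ n, Integrable
      (fun ω => (NormedSpace.exp (Matrix.of ((∑ i ∈ Finset.range n, X i) ω))).trace) μ :=
    fun n => integrable_finsetSum _ fun k _ => hPi n k k
  refine ⟨htr n, ?_⟩
  induction n with
  | zero =>
    simp only [Finset.range_zero, Finset.sum_empty, Pi.zero_apply, pow_zero, mul_one]
    simp
  | succ n ih =>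
    have hXe : ∀ k l, Measurable fun ω => X n ω k l := fun k l =>
      (measurable_pi_apply l).comp ((measurable_pi_apply k).comp (hm n))
    have hXi : ∀ k l, Integrable (fun ω => X n ω k l) μ := fun k l =>
      integrable_of_measurable_of_abs_le (hXe k l)
        (by filter_upwards [hentry n] with ω h using h k l)
    have hXX : ∀ k l, Integrable (fun ω => (Matrix.of (X n ω) * Matrix.of (X n ω)) k l) μ :=
      fun k l => by
        simp only [mul_apply, of_apply]
        refine integrable_finsetSum _ fun j _ => ?_
        refine integrable_of_measurable_of_abs_le ((hXe k j).mul (hXe j l)) (C := 1) ?_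
        filter_upwards [hentry n] with ω h
        rw [abs_mul]
        exact mul_le_one₀ (h k j) (abs_nonneg _) (h j l)
    -- Q is the quadratic majorant of the exponential of the last summand. Its entries are
    -- independent of those of the exponential of the earlier sum, so expectations of products
    -- factor entrywise.
    set Q : (ι → ι → ℝ) → Matrix ι ι ℝ := fun S => 1 + Matrix.of S + Matrix.of S * Matrix.of S
    have hQe : ∀ k l, (fun ω => Q (X n ω) k l) = fun ω => (1 : Matrix ι ι ℝ) k l + X n ω k l +
        (Matrix.of (X n ω) * Matrix.of (X n ω)) k l := fun k l => by
      ext ω; simp [Q, Matrix.add_apply]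
    have hQi : ∀ k l, Integrable (fun ω => Q (X n ω) k l) μ := fun k l => by
      rw [hQe]
      exact ((integrable_const _).add (hXi k l)).add (hXX k l)
    have hQm : ∀ k l, Measurable fun S : ι → ι → ℝ => Q S k l := fun k l => by
      have : Continuous fun S : ι → ι → ℝ => Q S k l := by
        simp only [Q, Matrix.add_apply, of_apply, mul_apply]
        fun_prop
      exact this.measurable
    set R : Matrix ι ι ℝ := Matrix.of fun k l => ∫ ω, Q (X n ω) k l ∂μ
    have hR : R = 1 + Matrix.of fun k l =>
        ∫ ω, (Matrix.of (X n ω) * Matrix.of (X n ω)) k l ∂μ := by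
      ext k l
      simp only [R, of_apply, Matrix.add_apply]
      have h1 := integral_add ((integrable_const (μ := μ) ((1 : Matrix ι ι ℝ) k l)).add (hXi k l))
        (hXX k l)
      have h2 := integral_add (integrable_const (μ := μ) ((1 : Matrix ι ι ℝ) k l)) (hXi k l)
      simp only [Pi.add_apply, hE, integral_const, probReal_univ, one_smul, add_zero] at h1 h2
      rw [h2] at h1
      rw [hQe]
      exact h1
    have hform : ∀ x : ι → ℝ, x ⬝ᵥ ((Matrix.of fun k l =>
        ∫ ω, (Matrix.of (X n ω) * Matrix.of (X n ω)) k l ∂μ) *ᵥ x) =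
        ∫ ω, x ⬝ᵥ ((Matrix.of (X n ω) * Matrix.of (X n ω)) *ᵥ x) ∂μ := fun x => by
      simp only [dotProduct, mulVec, of_apply]
      rw [integral_finsetSum _ fun k _ => Integrable.const_mul
        (integrable_finsetSum _ fun l _ => (hXX k l).mul_const _) _]
      refine Finset.sum_congr rfl fun k _ => ?_
      rw [integral_const_mul, integral_finsetSum _ fun l _ => (hXX k l).mul_const _]
      congr 1
      refine Finset.sum_congr rfl fun l _ => ?_
      rw [integral_mul_const]
    -- Centring removes the linear term, so R = 1 + E X², which is at most 1 + v in the Loewner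
    -- order.
    have hps : ((1 + v) • (1 : Matrix ι ι ℝ) - R).PosSemidef := by
      have hsR : (Matrix.of fun k l => ∫ ω, (Matrix.of (X n ω) * Matrix.of (X n ω)) k l ∂μ)ᵀ =
          Matrix.of fun k l => ∫ ω, (Matrix.of (X n ω) * Matrix.of (X n ω)) k l ∂μ := by
        ext k l
        simp only [transpose_apply, of_apply]
        congr 1; ext ω
        rw [← transpose_apply (_ * _), transpose_mul, hsymm]
      refine PosSemidef.of_dotProduct_mulVec_nonneg ?_ fun x => ?_
      · rw [IsHermitian, conjTranspose_eq_transpose_of_trivial, transpose_sub, hR, transpose_add,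
          hsR]
        simp
      · have := hv n x
        rw [hR, ← sub_sub]
        simp only [Matrix.sub_mulVec, Matrix.smul_mulVec, one_mulVec, dotProduct_sub,
          dotProduct_smul, hform, star_trivial, smul_eq_mul]
        linarith
    have hindep : IndepFun (∑ i ∈ Finset.range n, X i) (X n) μ :=
      hind.indepFun_finsetSum_of_notMem hm Finset.notMem_range_self
    have hsymS : ∀ n ω, (Matrix.of ((∑ i ∈ Finset.range n, X i) ω)).IsHermitian := fun n ω => by
      ext k l
      simp only [conjTranspose_apply, of_apply, Finset.sum_apply, star_trivial]
      refine Finset.sum_congr rfl fun i _ => ?_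
      have := congrFun (congrFun (hsymm i ω) k) l
      simpa using this
    set P : Ω → Matrix ι ι ℝ := fun ω =>
      NormedSpace.exp (Matrix.of ((∑ i ∈ Finset.range n, X i) ω))
    have hprod : ∀ k l, Integrable (fun ω => P ω k l * Q (X n ω) l k) μ ∧
        ∫ ω, P ω k l * Q (X n ω) l k ∂μ = (∫ ω, P ω k l ∂μ) * R l k := fun k l => by
      have hi : IndepFun (fun ω => P ω k l) (fun ω => Q (X n ω) l k) μ :=
        hindep.comp (continuous_exp_of_apply k l).measurable (hQm l k)
      exact ⟨hi.integrable_mul (hPi n k l) (hQi l k),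
        hi.integral_fun_mul_eq_mul_integral (hPi n k l).1 (hQi l k).1⟩
    have hPQi : Integrable (fun ω => (P ω * Q (X n ω)).trace) μ := by
      simp only [trace, diag, mul_apply]
      exact integrable_finsetSum _ fun k _ => integrable_finsetSum _ fun l _ => (hprod k l).1
    have hPRi : Integrable (fun ω => (P ω * R).trace) μ := by
      simp only [trace, diag, mul_apply]
      exact integrable_finsetSum _ fun k _ => integrable_finsetSum _ fun l _ =>
        (hPi n k l).mul_const _
    have hPQ : ∫ ω, (P ω * Q (X n ω)).trace ∂μ = ∫ ω, (P ω * R).trace ∂μ := by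
      simp only [trace, diag, mul_apply]
      rw [integral_finsetSum _ fun k _ => integrable_finsetSum _ fun l _ => (hprod k l).1,
        integral_finsetSum _ fun k _ => integrable_finsetSum _ fun l _ =>
          (hPi n k l).mul_const _]
      refine Finset.sum_congr rfl fun k _ => ?_
      rw [integral_finsetSum _ fun l _ => (hprod k l).1,
        integral_finsetSum _ fun l _ => (hPi n k l).mul_const _]
      refine Finset.sum_congr rfl fun l _ => ?_
      rw [(hprod k l).2, integral_mul_const]
    -- Golden–Thompson splits off the last summand, and positivity of P allows its exponential to be
    -- replaced by Q inside the trace. Averaging over the last summand then costs one factor 1 + v.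
    calc _ ≤ ∫ ω, (P ω * Q (X n ω)).trace ∂μ := by
          refine integral_mono_ae (htr (n + 1)) hPQi ?_
          filter_upwards [hb n] with ω hω
          have hadd : Matrix.of ((∑ i ∈ Finset.range (n + 1), X i) ω) =
              Matrix.of ((∑ i ∈ Finset.range n, X i) ω) + Matrix.of (X n ω) := by
            rw [Finset.sum_range_succ]; rfl
          have hXh : (Matrix.of (X n ω)).IsHermitian := by
            rw [IsHermitian, conjTranspose_eq_transpose_of_trivial, hsymm]
          rw [hadd]
          refine (trace_exp_add_le _ _ ?_ (hsymm n ω)).trans ?_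
          · rw [← conjTranspose_eq_transpose_of_trivial]; exact hsymS n ω
          · have := (hsymS n ω).posSemidef_exp.trace_mul_nonneg (hXh.exp_le_quadratic hω)
            rw [Matrix.mul_sub, trace_sub] at this
            exact sub_nonneg.1 this
      _ = ∫ ω, (P ω * R).trace ∂μ := hPQ
      _ ≤ ∫ ω, (1 + v) * (P ω).trace ∂μ := by
          refine integral_mono hPRi ((htr n).const_mul _) fun ω => ?_
          have := (hsymS n ω).posSemidef_exp.trace_mul_nonneg hps
          rw [Matrix.mul_sub, trace_sub, Matrix.mul_smul, Matrix.mul_one, trace_smul,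
            smul_eq_mul] at this
          exact sub_nonneg.1 this
      _ = (1 + v) * ∫ ω, (P ω).trace ∂μ := integral_const_mul _ _
      _ ≤ (1 + v) * (Fintype.card ι * (1 + v) ^ n) :=
          mul_le_mul_of_nonneg_left ih (by linarith)
      _ = _ := by ring

end MatrixMGF

/-! ### Concentration of empirical second moments -/

section Gram

variable {ι : Type*} [Fintype ι]

theorem dotProduct_self_nonneg' (x : ι → ℝ) : 0 ≤ x ⬝ᵥ x :=
  Finset.sum_nonneg fun _ _ => mul_self_nonneg _

theorem dotProduct_sq_le (x y : ι → ℝ) : (x ⬝ᵥ y) ^ 2 ≤ (x ⬝ᵥ x) * (y ⬝ᵥ y) := by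
  simpa [dotProduct, sq] using Finset.sum_mul_sq_le_sq_mul_sq Finset.univ x y

variable {Ω : Type*} [MeasurableSpace Ω] {μ : Measure Ω} [IsProbabilityMeasure μ]

theorem integrable_dotProduct_mul_dotProduct {v : Ω → ι → ℝ} (hm : Measurable v) {L : ℝ}
    (hL : ∀ᵐ ω ∂μ, v ω ⬝ᵥ v ω ≤ L) (x y : ι → ℝ) :
    Integrable (fun ω => (v ω ⬝ᵥ x) * (v ω ⬝ᵥ y)) μ := by
  have hdm : ∀ x : ι → ℝ, Measurable fun ω => v ω ⬝ᵥ x := fun x => by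
    have : Measurable fun v : ι → ℝ => v ⬝ᵥ x := by simp only [dotProduct]; fun_prop
    exact this.comp hm
  refine integrable_of_measurable_of_abs_le ((hdm x).mul (hdm y))
    (C := (L * (x ⬝ᵥ x) + L * (y ⬝ᵥ y)) / 2) ?_
  filter_upwards [hL] with ω h
  have h1 := (dotProduct_sq_le (v ω) x).trans
    (mul_le_mul_of_nonneg_right h (dotProduct_self_nonneg' x))
  have h2 := (dotProduct_sq_le (v ω) y).trans
    (mul_le_mul_of_nonneg_right h (dotProduct_self_nonneg' y))
  rw [abs_le]
  constructor <;> nlinarith [sq_nonneg (v ω ⬝ᵥ x + v ω ⬝ᵥ y), sq_nonneg (v ω ⬝ᵥ x - v ω ⬝ᵥ y)]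

variable [DecidableEq ι]

/-- The trace exponential bound is applied to the centred summands sθ(zz' − G), whose quadratic
forms are at most one when θL ≤ 1 and whose squares have mean at most θ²Lm. The sign s gives the
upper and the lower tail by the same argument. -/
theorem measure_gram_quadratic_gt_le {z : ℕ → Ω → ι → ℝ} (hm : ∀ i, Measurable (z i)) (hind : iIndepFun z μ)
  (hid : ∀ i, IdentDistrib (z i) (z 0) μ μ) {L m : ℝ}
  (hL : ∀ᵐ ω ∂μ, z 0 ω ⬝ᵥ z 0 ω ≤ L) (hL0 : 0 < L) (hm0 : 0 < m)
  (hmom : ∀ x : ι → ℝ, ∫ ω, (z 0 ω ⬝ᵥ x) ^ 2 ∂μ ≤ m * (x ⬝ᵥ x)) {n : ℕ}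
  {t : ℝ} (ht : 0 < t) (htm : t ≤ 2 * m)
    {s : ℝ} (hs : s = 1 ∨ s = -1) :
    μ {ω | ∃ x : ι → ℝ, n * t * (x ⬝ᵥ x) <
      s * (∑ i ∈ Finset.range n, (z i ω ⬝ᵥ x) ^ 2 - n * ∫ ω, (z 0 ω ⬝ᵥ x) ^ 2 ∂μ)} ≤
    ENNReal.ofReal (Fintype.card ι * Real.exp (-(n * t ^ 2 / (4 * L * m)))) := by
  set G : Matrix ι ι ℝ := Matrix.of fun k l => ∫ ω, z 0 ω k * z 0 ω l ∂μ
  -- This θ minimizes −θt + θ²Lm, with minimum −t²/(4Lm). The restriction t ≤ 2m is exactly θL ≤ 1.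
  set θ := t / (2 * L * m)
  have hθ : 0 < θ := by positivity
  have hθL : θ * L ≤ 1 := by
    rw [show θ * L = t / (2 * m) by simp only [θ]; field_simp]
    exact (div_le_one (by positivity)).2 htm
  have hs2 : s * s = 1 := by rcases hs with rfl | rfl <;> norm_num
  have hsa : |s| = 1 := by rcases hs with rfl | rfl <;> norm_num
  have hLi : ∀ i, ∀ᵐ ω ∂μ, z i ω ⬝ᵥ z i ω ≤ L := fun i => by
    have hc : Measurable fun v : ι → ℝ => v ⬝ᵥ v := by
      simp only [dotProduct]; fun_prop
    exact (hid i).symm.ae_snd (p := fun v : ι → ℝ => v ⬝ᵥ v ≤ L) (measurableSet_le hc measurable_const) hL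
  have hdm : ∀ i (x : ι → ℝ), Measurable fun ω => z i ω ⬝ᵥ x := fun i x => by
    have : Measurable fun v : ι → ℝ => v ⬝ᵥ x := by simp only [dotProduct]; fun_prop
    exact this.comp (hm i)
  have hdb : ∀ i, ∀ᵐ ω ∂μ, ∀ x : ι → ℝ, (z i ω ⬝ᵥ x) ^ 2 ≤ L * (x ⬝ᵥ x) := fun i => by
    filter_upwards [hLi i] with ω h x
    exact (dotProduct_sq_le _ _).trans (mul_le_mul_of_nonneg_right h (dotProduct_self_nonneg' x))
  have hdi : ∀ i (x y : ι → ℝ), Integrable (fun ω => (z i ω ⬝ᵥ x) * (z i ω ⬝ᵥ y)) μ :=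
    fun i x y => integrable_dotProduct_mul_dotProduct (hm i) (hLi i) x y
  have hde : ∀ i (x y : ι → ℝ), ∫ ω, (z i ω ⬝ᵥ x) * (z i ω ⬝ᵥ y) ∂μ = ∫ ω, (z 0 ω ⬝ᵥ x) * (z 0 ω ⬝ᵥ y) ∂μ := fun i x y => by
    have : Measurable fun v : ι → ℝ => (v ⬝ᵥ x) * (v ⬝ᵥ y) := by simp only [dotProduct]; fun_prop
    exact ((hid i).comp this).integral_eq
  have hG : ∀ x y : ι → ℝ, x ⬝ᵥ (G *ᵥ y) = ∫ ω, (z 0 ω ⬝ᵥ x) * (z 0 ω ⬝ᵥ y) ∂μ := fun x y => by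
    have hzi : ∀ k l, Integrable (fun ω => z 0 ω k * z 0 ω l) μ := fun k l => by
      simpa using hdi 0 (Pi.single k 1) (Pi.single l 1)
    have : (fun ω => (z 0 ω ⬝ᵥ x) * (z 0 ω ⬝ᵥ y)) = fun ω => ∑ k, ∑ l, x k * (z 0 ω k * z 0 ω l * y l) := by
      ext ω
      simp only [dotProduct, Finset.sum_mul_sum]
      refine Finset.sum_congr rfl fun k _ => Finset.sum_congr rfl fun l _ => by ring
    rw [this, integral_finsetSum _ fun k _ => integrable_finsetSum _ fun l _ => ((hzi k l).mul_const _).const_mul _]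
    simp only [dotProduct, mulVec, G, of_apply]
    refine Finset.sum_congr rfl fun k _ => ?_
    rw [integral_finsetSum _ fun l _ => ((hzi k l).mul_const _).const_mul _, Finset.mul_sum]
    refine Finset.sum_congr rfl fun l _ => ?_
    rw [integral_const_mul, integral_mul_const]
  have hGs : Gᵀ = G := by
    ext k l
    simp only [G, transpose_apply, of_apply, mul_comm]
  have hGL : ∀ x : ι → ℝ, 0 ≤ x ⬝ᵥ (G *ᵥ x) ∧ x ⬝ᵥ (G *ᵥ x) ≤ L * (x ⬝ᵥ x) := fun x => by
    rw [hG]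
    refine ⟨integral_nonneg fun ω => mul_self_nonneg _, ?_⟩
    have := integral_mono_ae (hdi 0 x x) (integrable_const (μ := μ) (L * (x ⬝ᵥ x)))
      (by filter_upwards [hdb 0] with ω h using by simpa [sq] using h x)
    simpa using this
  set X : ℕ → Ω → ι → ι → ℝ := fun i ω k l => s * θ * (z i ω k * z i ω l - G k l)
  have hXof : ∀ i ω, Matrix.of (X i ω) = (s * θ) • (vecMulVec (z i ω) (z i ω) - G) := fun i ω => by
    ext k l; simp [X, vecMulVec_apply]
  have hXmv : ∀ i ω (x : ι → ℝ), Matrix.of (X i ω) *ᵥ x = (s * θ) • ((z i ω ⬝ᵥ x) • z i ω - G *ᵥ x) := fun i ω x => by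
    rw [hXof, smul_mulVec, sub_mulVec]
    congr 2
    ext k
    simp only [mulVec, vecMulVec_apply, dotProduct, Pi.smul_apply, smul_eq_mul, Finset.sum_mul]
    exact Finset.sum_congr rfl fun j _ => by ring
  have hXform : ∀ i ω (x : ι → ℝ), x ⬝ᵥ (Matrix.of (X i ω) *ᵥ x) = s * θ * ((z i ω ⬝ᵥ x) ^ 2 - x ⬝ᵥ (G *ᵥ x)) := fun i ω x => by
    rw [hXmv, dotProduct_smul, dotProduct_sub, dotProduct_smul, dotProduct_comm x (z i ω)]
    simp only [smul_eq_mul]; ring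
  have hsymm : ∀ i ω, (Matrix.of (X i ω))ᵀ = Matrix.of (X i ω) := fun i ω => by
    rw [hXof, transpose_smul, transpose_sub, hGs, transpose_vecMulVec]
  have hsum : ∀ ω, Matrix.of ((∑ i ∈ Finset.range n, X i) ω) =
      ∑ i ∈ Finset.range n, Matrix.of (X i ω) := fun ω => by
    ext k l; simp [Matrix.sum_apply]
  have hsymS : ∀ ω, (Matrix.of ((∑ i ∈ Finset.range n, X i) ω)).IsHermitian := fun ω => by
    rw [hsum, IsHermitian, conjTranspose_eq_transpose_of_trivial, transpose_sum]
    exact Finset.sum_congr rfl fun i _ => hsymm i ω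
  have hze : ∀ i k, Measurable fun ω => z i ω k := fun i k =>
    (measurable_pi_apply k).comp (hm i)
  have hmain := integral_trace_exp_sum_le (X := X) (μ := μ) (v := θ ^ 2 * L * m) ?_ ?_ ?_ ?_ ?_ (by positivity) ?_ n
  · obtain ⟨hint, hle⟩ := hmain
    have hmk := mul_meas_ge_le_integral_of_nonneg (μ := μ) (Eventually.of_forall fun ω => ?_) hint (Real.exp (θ * (n * t)))
    · have hsub : {ω | ∃ x : ι → ℝ, n * t * (x ⬝ᵥ x) <
          s * (∑ i ∈ Finset.range n, (z i ω ⬝ᵥ x) ^ 2 - n * ∫ ω, (z 0 ω ⬝ᵥ x) ^ 2 ∂μ)} ⊆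
          {ω | Real.exp (θ * (n * t)) ≤ (NormedSpace.exp (Matrix.of ((∑ i ∈ Finset.range n, X i) ω))).trace} := by
        rintro ω ⟨x, hx⟩
        have hxS : x ⬝ᵥ (Matrix.of ((∑ i ∈ Finset.range n, X i) ω) *ᵥ x) =
            θ * (s * (∑ i ∈ Finset.range n, (z i ω ⬝ᵥ x) ^ 2 - n * x ⬝ᵥ (G *ᵥ x))) := by
          rw [hsum, sum_mulVec, dotProduct_sum]
          simp only [hXform]
          rw [← Finset.mul_sum, Finset.sum_sub_distrib]
          simp; ring
        refine (hsymS ω).exp_le_trace_exp (x := x) ?_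
        rw [hxS, mul_assoc]
        refine mul_lt_mul_of_pos_left ?_ hθ
        have : ∫ ω, (z 0 ω ⬝ᵥ x) ^ 2 ∂μ = x ⬝ᵥ (G *ᵥ x) := by simp only [hG, sq]
        rwa [this] at hx
      refine (measure_mono hsub).trans ?_
      rw [← ofReal_measureReal]
      refine ENNReal.ofReal_le_ofReal ?_
      have h1 : (1 + θ ^ 2 * L * m) ^ n ≤ Real.exp (n * (θ ^ 2 * L * m)) := by
        rw [Real.exp_nat_mul]
        refine pow_le_pow_left₀ (by positivity) ?_ n
        linarith [Real.add_one_le_exp (θ ^ 2 * L * m)]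
      have h2 := hmk.trans (hle.trans (mul_le_mul_of_nonneg_left h1 (Nat.cast_nonneg _)))
      have h3 : Real.exp (-(n * t ^ 2 / (4 * L * m))) = Real.exp (n * (θ ^ 2 * L * m)) / Real.exp (θ * (n * t)) := by
        rw [← Real.exp_sub]
        congr 1
        simp only [θ]; field_simp; ring
      rw [h3, ← mul_div_assoc, le_div_iff₀ (Real.exp_pos _), mul_comm]
      exact h2
    · exact (hsymS ω).posSemidef_exp.trace_nonneg
  · intro i
    refine measurable_pi_lambda _ fun k => measurable_pi_lambda _ fun l => ?_
    exact (((hze i k).mul (hze i l)).sub_const _).const_mul _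
  · have : Measurable fun (v : ι → ℝ) k l => s * θ * (v k * v l - G k l) := by fun_prop
    exact hind.comp (fun _ v k l => s * θ * (v k * v l - G k l)) fun _ => this
  · exact hsymm
  · intro i
    filter_upwards [hdb i] with ω h x
    rw [hXform, abs_mul, abs_mul, hsa, one_mul, abs_of_pos hθ]
    have h1 := h x
    have h2 := hGL x
    have h3 : |(z i ω ⬝ᵥ x) ^ 2 - x ⬝ᵥ (G *ᵥ x)| ≤ L * (x ⬝ᵥ x) := by
      rw [abs_le]; constructor <;> nlinarith [sq_nonneg (z i ω ⬝ᵥ x)]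
    calc _ ≤ θ * (L * (x ⬝ᵥ x)) := mul_le_mul_of_nonneg_left h3 hθ.le
      _ = (θ * L) * (x ⬝ᵥ x) := by ring
      _ ≤ _ := mul_le_of_le_one_left (dotProduct_self_nonneg' x) hθL
  · intro i k l
    have h1 := hdi i (Pi.single k 1) (Pi.single l 1)
    have h2 := hde i (Pi.single k 1) (Pi.single l 1)
    simp only [dotProduct_single_one] at h1 h2
    simp only [X]
    rw [integral_const_mul, integral_sub h1 (integrable_const _), h2]
    simp [G]
  · intro i x
    -- The mean of (zz' − G)² is E|z|²zz' − G². Dropping G² leaves a form bounded by L times that of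
    -- E zz', hence by Lm.
    have e : (fun ω => x ⬝ᵥ ((Matrix.of (X i ω) * Matrix.of (X i ω)) *ᵥ x)) = fun ω =>
        θ ^ 2 * ((z i ω ⬝ᵥ z i ω) * (z i ω ⬝ᵥ x) ^ 2 -
          2 * ((z i ω ⬝ᵥ x) * (z i ω ⬝ᵥ (G *ᵥ x))) + (G *ᵥ x) ⬝ᵥ (G *ᵥ x)) := by
      ext ω
      have : x ⬝ᵥ ((Matrix.of (X i ω) * Matrix.of (X i ω)) *ᵥ x) =
          (Matrix.of (X i ω) *ᵥ x) ⬝ᵥ (Matrix.of (X i ω) *ᵥ x) := by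
        rw [← mulVec_mulVec, dotProduct_mulVec, ← mulVec_transpose, hsymm]
      rw [this, hXmv]
      simp only [smul_dotProduct, dotProduct_smul, sub_dotProduct, dotProduct_sub, smul_eq_mul,
        dotProduct_comm (G *ᵥ x) (z i ω)]
      linear_combination (θ ^ 2 * ((z i ω ⬝ᵥ z i ω) * (z i ω ⬝ᵥ x) ^ 2 -
          2 * ((z i ω ⬝ᵥ x) * (z i ω ⬝ᵥ (G *ᵥ x))) + (G *ᵥ x) ⬝ᵥ (G *ᵥ x))) * hs2
    rw [e, integral_const_mul]
    have hq : Integrable (fun ω => (z i ω ⬝ᵥ z i ω) * (z i ω ⬝ᵥ x) ^ 2) μ := by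
      have hzz : Measurable fun ω => z i ω ⬝ᵥ z i ω := by
        simp only [dotProduct]
        exact Finset.measurable_sum _ fun k _ => (hze i k).mul (hze i k)
      refine integrable_of_measurable_of_abs_le (hzz.mul ((hdm i x).pow_const 2))
        (C := L * (L * (x ⬝ᵥ x))) ?_
      filter_upwards [hdb i, hLi i] with ω h h'
      rw [abs_of_nonneg (mul_nonneg (dotProduct_self_nonneg' _) (sq_nonneg _))]
      exact mul_le_mul h' (h x) (sq_nonneg _) hL0.le
    have hr := (hdi i x (G *ᵥ x)).const_mul 2
    have hqe : ∫ ω, (z i ω ⬝ᵥ z i ω) * (z i ω ⬝ᵥ x) ^ 2 ∂μ ≤ L * (m * (x ⬝ᵥ x)) := by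
      calc _ ≤ ∫ ω, L * ((z i ω ⬝ᵥ x) * (z i ω ⬝ᵥ x)) ∂μ := by
            refine integral_mono_ae hq ((hdi i x x).const_mul L) ?_
            filter_upwards [hLi i] with ω h
            rw [← sq]
            exact mul_le_mul_of_nonneg_right h (sq_nonneg _)
        _ = L * ∫ ω, (z 0 ω ⬝ᵥ x) ^ 2 ∂μ := by
            rw [integral_const_mul, hde]; simp only [sq]
        _ ≤ _ := mul_le_mul_of_nonneg_left (hmom x) hL0.le
    have hGG : ∫ ω, (z i ω ⬝ᵥ x) * (z i ω ⬝ᵥ (G *ᵥ x)) ∂μ = (G *ᵥ x) ⬝ᵥ (G *ᵥ x) := by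
      rw [hde, ← hG, dotProduct_mulVec, ← mulVec_transpose, hGs]
    have h1 := integral_add (hq.sub hr) (integrable_const (μ := μ) ((G *ᵥ x) ⬝ᵥ (G *ᵥ x)))
    have h2 := integral_sub hq hr
    simp only [Pi.sub_apply, integral_const, probReal_univ, one_smul] at h1 h2
    rw [integral_const_mul, hGG] at h2
    rw [h1, h2]
    have := dotProduct_self_nonneg' (G *ᵥ x)
    calc _ ≤ θ ^ 2 * (L * (m * (x ⬝ᵥ x))) := by
          refine mul_le_mul_of_nonneg_left ?_ (sq_nonneg _)
          linarith
      _ = _ := by ring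

/-- Concentration of the empirical second moment of bounded random vectors, as a bilinear form. -/
theorem measure_gram_bilin_gt_le {z : ℕ → Ω → ι → ℝ} (hm : ∀ i, Measurable (z i))
    (hind : iIndepFun z μ) (hid : ∀ i, IdentDistrib (z i) (z 0) μ μ) {L m : ℝ}
    (hL : ∀ᵐ ω ∂μ, z 0 ω ⬝ᵥ z 0 ω ≤ L) (hL0 : 0 < L) (hm0 : 0 < m)
    (hmom : ∀ x : ι → ℝ, ∫ ω, (z 0 ω ⬝ᵥ x) ^ 2 ∂μ ≤ m * (x ⬝ᵥ x)) {n : ℕ} (hn : 0 < n)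
    {t : ℝ} (ht : 0 < t) (htm : t ≤ 2 * m) :
    μ {ω | ∃ x y : ι → ℝ, t * √(x ⬝ᵥ x) * √(y ⬝ᵥ y) <
      |(n : ℝ)⁻¹ * ∑ i ∈ Finset.range n, (z i ω ⬝ᵥ x) * (z i ω ⬝ᵥ y) -
        ∫ ω, (z 0 ω ⬝ᵥ x) * (z 0 ω ⬝ᵥ y) ∂μ|} ≤
    ENNReal.ofReal (2 * Fintype.card ι * Real.exp (-(n * t ^ 2 / (4 * L * m)))) := by
  have h1 := measure_gram_quadratic_gt_le hm hind hid hL hL0 hm0 hmom (n := n) ht htm (Or.inl rfl)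
  have h2 := measure_gram_quadratic_gt_le hm hind hid hL hL0 hm0 hmom (n := n) ht htm (Or.inr rfl)
  rw [show 2 * (Fintype.card ι : ℝ) * Real.exp (-(n * t ^ 2 / (4 * L * m))) =
    Fintype.card ι * Real.exp (-(n * t ^ 2 / (4 * L * m))) +
    Fintype.card ι * Real.exp (-(n * t ^ 2 / (4 * L * m))) by ring,
    ENNReal.ofReal_add (by positivity) (by positivity)]
  refine le_trans (measure_mono ?_) ((measure_union_le _ _).trans (add_le_add h1 h2))
  intro ω hω
  by_contra hc
  simp only [Set.mem_union, Set.mem_ofPred_eq, not_or, not_exists, not_lt, one_mul] at hc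
  obtain ⟨hc1, hc2⟩ := hc
  obtain ⟨x, y, hxy⟩ := hω
  have hn' : (0 : ℝ) < n := Nat.cast_pos.2 hn
  set D : (ι → ℝ) → (ι → ℝ) → ℝ := fun x y =>
    (n : ℝ)⁻¹ * ∑ i ∈ Finset.range n, (z i ω ⬝ᵥ x) * (z i ω ⬝ᵥ y) -
        ∫ ω, (z 0 ω ⬝ᵥ x) * (z 0 ω ⬝ᵥ y) ∂μ
  have hquad : ∀ x, |D x x| ≤ t * (x ⬝ᵥ x) := fun x => by
    have e : n * D x x = ∑ i ∈ Finset.range n, (z i ω ⬝ᵥ x) ^ 2 - n * ∫ ω, (z 0 ω ⬝ᵥ x) ^ 2 ∂μ := by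
      simp only [D, sq]; field_simp
    have g1 := hc1 x
    have g2 := hc2 x
    rw [← e] at g1 g2
    rw [abs_le]
    constructor
    · by_contra hh
      nlinarith [mul_lt_mul_of_pos_left (not_le.1 hh) hn']
    · by_contra hh
      nlinarith [mul_lt_mul_of_pos_left (not_le.1 hh) hn']
  -- Both one-sided bounds control D(x, x). Polarization bounds D(x, y) by the mean of the squared
  -- norms, and rescaling x and y to unit length turns this mean into the product of the norms.
  have hpol : ∀ x y, D (x + y) (x + y) - D (x - y) (x - y) = 4 * D x y := fun x y => by
    have hi := fun a b => integrable_dotProduct_mul_dotProduct (hm 0) hL a b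
    have e1 : ∫ ω, (z 0 ω ⬝ᵥ (x + y)) * (z 0 ω ⬝ᵥ (x + y)) ∂μ -
        ∫ ω, (z 0 ω ⬝ᵥ (x - y)) * (z 0 ω ⬝ᵥ (x - y)) ∂μ =
        4 * ∫ ω, (z 0 ω ⬝ᵥ x) * (z 0 ω ⬝ᵥ y) ∂μ := by
      rw [← integral_sub (hi _ _) (hi _ _), ← integral_const_mul]
      congr 1; ext ω
      simp only [dotProduct_add, dotProduct_sub]; ring
    have e2 : ∑ i ∈ Finset.range n, (z i ω ⬝ᵥ (x + y)) * (z i ω ⬝ᵥ (x + y)) -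
        ∑ i ∈ Finset.range n, (z i ω ⬝ᵥ (x - y)) * (z i ω ⬝ᵥ (x - y)) =
        4 * ∑ i ∈ Finset.range n, (z i ω ⬝ᵥ x) * (z i ω ⬝ᵥ y) := by
      rw [← Finset.sum_sub_distrib, Finset.mul_sum]
      refine Finset.sum_congr rfl fun i _ => ?_
      simp only [dotProduct_add, dotProduct_sub]; ring
    simp only [D]
    linear_combination (n : ℝ)⁻¹ * e2 - e1
  have hhalf : ∀ x y, |D x y| ≤ t * (x ⬝ᵥ x + y ⬝ᵥ y) / 2 := fun x y => by
    have g1 := abs_le.1 (hquad (x + y))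
    have g2 := abs_le.1 (hquad (x - y))
    have g3 := hpol x y
    simp only [dotProduct_add, dotProduct_sub, add_dotProduct, sub_dotProduct,
      dotProduct_comm y x] at g1 g2
    rw [abs_le]
    constructor <;> linarith
  have hsc : ∀ (a b : ℝ) x y, D (a • x) (b • y) = a * b * D x y := fun a b x y => by
    simp only [D, dotProduct_smul, smul_eq_mul]
    rw [mul_sub, ← integral_const_mul, Finset.mul_sum, Finset.mul_sum, Finset.mul_sum]
    congr 1
    · exact Finset.sum_congr rfl fun i _ => by ring
    · congr 1; ext ω; ring
  have hnn := fun v : ι → ℝ => dotProduct_self_nonneg' v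
  rcases (hnn x).eq_or_lt with h0 | hx0
  · rw [dotProduct_self_eq_zero.1 h0.symm] at hxy
    simp at hxy
  rcases (hnn y).eq_or_lt with h0 | hy0
  · rw [dotProduct_self_eq_zero.1 h0.symm] at hxy
    simp at hxy
  have ha := Real.sqrt_pos.2 hx0
  have hb := Real.sqrt_pos.2 hy0
  have := hhalf ((√(x ⬝ᵥ x))⁻¹ • x) ((√(y ⬝ᵥ y))⁻¹ • y)
  have hx1 : ((√(x ⬝ᵥ x))⁻¹ • x) ⬝ᵥ ((√(x ⬝ᵥ x))⁻¹ • x) = 1 := by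
    simp only [dotProduct_smul, smul_dotProduct, smul_eq_mul]
    rw [← mul_assoc, ← mul_inv, Real.mul_self_sqrt (hnn x), inv_mul_cancel₀ hx0.ne']
  have hy1 : ((√(y ⬝ᵥ y))⁻¹ • y) ⬝ᵥ ((√(y ⬝ᵥ y))⁻¹ • y) = 1 := by
    simp only [dotProduct_smul, smul_dotProduct, smul_eq_mul]
    rw [← mul_assoc, ← mul_inv, Real.mul_self_sqrt (hnn y), inv_mul_cancel₀ hy0.ne']
  rw [hsc, hx1, hy1, abs_mul, ← mul_inv, abs_of_pos (inv_pos.2 (mul_pos ha hb)),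
    inv_mul_le_iff₀ (mul_pos ha hb)] at this
  have : |D x y| ≤ t * √(x ⬝ᵥ x) * √(y ⬝ᵥ y) := by linarith
  exact absurd hxy (not_lt.2 this)

end Gram

/-! ### Uniform concentration of weighted sums of residuals with few moments -/

/-- The difference F of the two sides vanishes at 0, decreases on the negative axis since 1 + y ≤
e^y and e^R ≥ 1, and increases on [0, R] since e^y − 1 ≤ ye^y ≤ ye^R. When R is small the quadratic
coefficient is close to the Gaussian 1/2, and this preserves the sharp constant. -/
theorem Real.exp_le_one_add_add_sq_mul_exp {x R : ℝ} (hx : x ≤ R) (hR : 0 ≤ R) :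
    Real.exp x ≤ 1 + x + x ^ 2 / 2 * Real.exp R := by
  set c := Real.exp R
  have hc : 1 ≤ c := Real.one_le_exp hR
  set F : ℝ → ℝ := fun y => 1 + y + y ^ 2 / 2 * c - Real.exp y
  have hd : ∀ y, HasDerivAt F (1 + y * c - Real.exp y) y := fun y => by
    have h := ((((hasDerivAt_id y).const_add 1).add
      ((((hasDerivAt_id y).pow 2).div_const 2).mul_const c)).sub (Real.hasDerivAt_exp y))
    refine h.congr_deriv ?_
    simp
  have hcont : Continuous F := by fun_prop
  have h0 : F 0 = 0 := by simp [F]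
  suffices 0 ≤ F x by simp only [F] at this; linarith
  rw [← h0]
  rcases le_total x 0 with hx0 | hx0
  · have hanti : AntitoneOn F (Set.Iic 0) := by
      refine antitoneOn_of_deriv_nonpos (convex_Iic 0) hcont.continuousOn
        (fun y _ => (hd y).differentiableAt.differentiableWithinAt) fun y hy => ?_
      rw [interior_Iic] at hy
      rw [(hd y).deriv]
      have := Real.add_one_le_exp y
      nlinarith [Set.mem_Iio.1 hy]
    exact hanti hx0 (Set.mem_Iic.2 le_rfl) hx0
  · have hmono : MonotoneOn F (Set.Icc 0 R) := by
      refine monotoneOn_of_deriv_nonneg (convex_Icc 0 R) hcont.continuousOn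
        (fun y _ => (hd y).differentiableAt.differentiableWithinAt) fun y hy => ?_
      rw [interior_Icc] at hy
      rw [(hd y).deriv]
      have h1 := Real.add_one_le_exp (-y)
      have h2 : Real.exp y * Real.exp (-y) = 1 := by rw [← Real.exp_add]; simp
      have h3 : Real.exp y ≤ c := Real.exp_le_exp.2 hy.2.le
      nlinarith [Real.exp_pos y, hy.1]
    exact hmono ⟨le_rfl, hR⟩ ⟨hx0, hx⟩ hx0

/-! ### Truncated residuals -/

section Truncated

variable {Ω E : Type*} [MeasurableSpace Ω] [MeasurableSpace E] {μ : Measure Ω}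
  [IsProbabilityMeasure μ]

/-- `u` truncated at level `D`. -/
def truncAt (D u : ℝ) : ℝ := if |u| ≤ D then u else 0

/-- The part of `|u|` above the level `D`. -/
def excessAt (D u : ℝ) : ℝ := if |u| ≤ D then 0 else |u|

theorem measurable_truncAt (D : ℝ) : Measurable (truncAt D) :=
  Measurable.ite (measurableSet_le measurable_id.abs measurable_const) measurable_id
    measurable_const

theorem measurable_excessAt (D : ℝ) : Measurable (excessAt D) :=
  Measurable.ite (measurableSet_le measurable_id.abs measurable_const) measurable_const
    measurable_id.abs

theorem abs_truncAt_le {D : ℝ} (hD : 0 ≤ D) (u : ℝ) : |truncAt D u| ≤ D := by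
  unfold truncAt; split_ifs with h <;> simp [h, hD]

theorem abs_truncAt_le_abs (D u : ℝ) : |truncAt D u| ≤ |u| := by
  unfold truncAt; split_ifs with h <;> simp

theorem excessAt_nonneg (D u : ℝ) : 0 ≤ excessAt D u := by
  unfold excessAt; split_ifs with h <;> simp

theorem excessAt_le_abs (D u : ℝ) : excessAt D u ≤ |u| := by
  unfold excessAt; split_ifs with h <;> simp

theorem abs_sub_truncAt (D u : ℝ) : |u - truncAt D u| = excessAt D u := by
  unfold truncAt excessAt; split_ifs with h <;> simp

/-- Where the excess is nonzero, |u| exceeds D, so the remaining factor |u|^{1+δ} is at least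
D^{1+δ}. -/
theorem excessAt_le_rpow {D δ : ℝ} (hD : 0 < D) (hδ : 0 < δ) (u : ℝ) :
    excessAt D u ≤ D ^ (-(1 + δ)) * |u| ^ (2 + δ) := by
  unfold excessAt
  split_ifs with h
  · positivity
  · rw [not_le] at h
    have hu : 0 < |u| := hD.trans h
    rw [show (2 : ℝ) + δ = 1 + (1 + δ) by ring, Real.rpow_add hu, Real.rpow_one,
      Real.rpow_neg hD.le]
    have : D ^ (1 + δ) ≤ |u| ^ (1 + δ) := Real.rpow_le_rpow hD.le h.le (by linarith)
    have hp : 0 < D ^ (1 + δ) := Real.rpow_pos_of_pos hD _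
    rw [inv_mul_eq_div, le_div_iff₀ hp]
    exact mul_le_mul_of_nonneg_left this hu.le

variable {V : ℕ → Ω → E × ℝ}

/-- Truncation bounds the exponent by θDZ, so the exponential has a quadratic majorant with factor
e^{θDZ}/2. The second moment only shrinks under truncation, and the mean becomes at most Z times the
expected excess. -/
theorem integral_exp_truncAt_le {V : Ω → E × ℝ} (hV : Measurable V) {q : E → ℝ}
    (hq : Measurable q) {Z σ D θ : ℝ}
    (hD : 0 ≤ D) (hθ : 0 ≤ θ) (hZ : 0 ≤ Z) (hqZ : ∀ᵐ ω ∂μ, |q (V ω).1| ≤ Z)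
    (hu2 : Integrable (fun ω => (V ω).2 ^ 2) μ)
    (hvar : ∫ ω, q (V ω).1 ^ 2 * (V ω).2 ^ 2 ∂μ ≤ σ ^ 2)
    (hzero : ∫ ω, q (V ω).1 * (V ω).2 ∂μ = 0) :
    Integrable (fun ω => Real.exp (θ * (q (V ω).1 * truncAt D (V ω).2))) μ ∧
    ∫ ω, Real.exp (θ * (q (V ω).1 * truncAt D (V ω).2)) ∂μ ≤
      Real.exp (θ * (Z * ∫ ω, excessAt D (V ω).2 ∂μ) +
        θ ^ 2 * σ ^ 2 * Real.exp (θ * (D * Z)) / 2) := by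
  have hu : Measurable fun ω => (V ω).2 := measurable_snd.comp hV
  have hqm : Measurable fun ω => q (V ω).1 := hq.comp (measurable_fst.comp hV)
  have htm : Measurable fun ω => truncAt D (V ω).2 := (measurable_truncAt D).comp hu
  have hui : Integrable (fun ω => (V ω).2) μ := by
    have := (memLp_two_iff_integrable_sq hu.aestronglyMeasurable).2 hu2
    exact this.integrable one_le_two
  have hbd : ∀ᵐ ω ∂μ, |q (V ω).1 * truncAt D (V ω).2| ≤ D * Z := by
    filter_upwards [hqZ] with ω h
    rw [abs_mul, mul_comm D]
    exact mul_le_mul h (abs_truncAt_le hD _) (abs_nonneg _) hZ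
  have hexi : Integrable (fun ω => Real.exp (θ * (q (V ω).1 * truncAt D (V ω).2))) μ := by
    refine integrable_of_measurable_of_abs_le ((hqm.mul htm).const_mul θ).exp
      (C := Real.exp (θ * (D * Z))) ?_
    filter_upwards [hbd] with ω h
    rw [Real.abs_exp]
    exact Real.exp_le_exp.2 (mul_le_mul_of_nonneg_left ((le_abs_self _).trans h) hθ)
  refine ⟨hexi, ?_⟩
  have hqt : Integrable (fun ω => q (V ω).1 * truncAt D (V ω).2) μ :=
    integrable_of_measurable_of_abs_le (hqm.mul htm) hbd
  have hqu : Integrable (fun ω => q (V ω).1 * (V ω).2) μ := by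
    refine hui.bdd_mul (c := Z) hqm.aestronglyMeasurable (by simpa using hqZ)
  have hq2 : Integrable (fun ω => q (V ω).1 ^ 2 * (V ω).2 ^ 2) μ := by
    refine hu2.bdd_mul (c := Z ^ 2) (hqm.pow_const 2).aestronglyMeasurable ?_
    filter_upwards [hqZ] with ω h
    rw [norm_pow, Real.norm_eq_abs]
    exact pow_le_pow_left₀ (abs_nonneg _) h 2
  have hexc : Integrable (fun ω => excessAt D (V ω).2) μ := by
    refine hui.abs.mono' ((measurable_excessAt D).comp hu).aestronglyMeasurable
      (Eventually.of_forall fun ω => ?_)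
    rw [Real.norm_of_nonneg (excessAt_nonneg _ _)]
    exact excessAt_le_abs _ _
  -- The untruncated product has mean zero, so the truncated mean is minus the mean of the part
  -- removed.
  have hmean : ∫ ω, q (V ω).1 * truncAt D (V ω).2 ∂μ ≤ Z * ∫ ω, excessAt D (V ω).2 ∂μ := by
    have : ∫ ω, q (V ω).1 * truncAt D (V ω).2 ∂μ =
        ∫ ω, (q (V ω).1 * truncAt D (V ω).2 - q (V ω).1 * (V ω).2) ∂μ := by
      rw [integral_sub hqt hqu, hzero, sub_zero]
    rw [this, ← integral_const_mul]
    refine integral_mono_ae (hqt.sub hqu) (hexc.const_mul Z) ?_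
    filter_upwards [hqZ] with ω h
    rw [← mul_sub]
    refine (le_abs_self _).trans ?_
    rw [abs_mul, abs_sub_comm, abs_sub_truncAt]
    exact mul_le_mul_of_nonneg_right h (excessAt_nonneg _ _)
  set c := Real.exp (θ * (D * Z))
  calc _ ≤ ∫ ω, (1 + θ * (q (V ω).1 * truncAt D (V ω).2) +
        θ ^ 2 * c / 2 * (q (V ω).1 ^ 2 * (V ω).2 ^ 2)) ∂μ := by
        refine integral_mono_ae hexi
          (((integrable_const 1).add (hqt.const_mul θ)).add (hq2.const_mul _)) ?_
        filter_upwards [hbd] with ω h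
        have h1 := Real.exp_le_one_add_add_sq_mul_exp
          (mul_le_mul_of_nonneg_left ((le_abs_self _).trans h) hθ)
          (mul_nonneg hθ (mul_nonneg hD hZ))
        refine h1.trans ?_
        have h2 : (truncAt D (V ω).2) ^ 2 ≤ (V ω).2 ^ 2 := sq_le_sq.2 (abs_truncAt_le_abs _ _)
        have h3 : 0 ≤ θ ^ 2 * c / 2 * q (V ω).1 ^ 2 := by positivity
        nlinarith [mul_le_mul_of_nonneg_left h2 h3]
    _ = 1 + θ * ∫ ω, q (V ω).1 * truncAt D (V ω).2 ∂μ +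
        θ ^ 2 * c / 2 * ∫ ω, q (V ω).1 ^ 2 * (V ω).2 ^ 2 ∂μ := by
        have h1 := integral_add ((integrable_const (μ := μ) (1 : ℝ)).add (hqt.const_mul θ))
          (hq2.const_mul (θ ^ 2 * c / 2))
        have h2 := integral_add (integrable_const (μ := μ) (1 : ℝ)) (hqt.const_mul θ)
        simp only [Pi.add_apply, integral_const, probReal_univ, one_smul, integral_const_mul]
          at h1 h2
        rw [h1, h2]
    _ ≤ 1 + θ * (Z * ∫ ω, excessAt D (V ω).2 ∂μ) + θ ^ 2 * c / 2 * σ ^ 2 := by gcongr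
    _ ≤ _ := by
        refine le_trans (le_of_eq ?_) (Real.add_one_le_exp _)
        ring

/-- Chernoff bound for a sum of weighted truncated residuals. -/
theorem measure_sum_truncAt_ge_le (hV : ∀ i, Measurable (V i)) (hind : iIndepFun V μ)
    (hid : ∀ i, IdentDistrib (V i) (V 0) μ μ) {q : E → ℝ} (hq : Measurable q) {Z σ D θ : ℝ}
    (hD : 0 ≤ D) (hθ : 0 ≤ θ) (hZ : 0 ≤ Z) (hqZ : ∀ᵐ ω ∂μ, |q (V 0 ω).1| ≤ Z)
    (hu2 : Integrable (fun ω => (V 0 ω).2 ^ 2) μ)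
    (hvar : ∫ ω, q (V 0 ω).1 ^ 2 * (V 0 ω).2 ^ 2 ∂μ ≤ σ ^ 2)
    (hzero : ∫ ω, q (V 0 ω).1 * (V 0 ω).2 ∂μ = 0) (n : ℕ) (x : ℝ) :
    μ {ω | x ≤ ∑ i ∈ Finset.range n, q (V i ω).1 * truncAt D (V i ω).2} ≤
      ENNReal.ofReal (Real.exp (-(θ * x) + n * (θ * (Z * ∫ ω, excessAt D (V 0 ω).2 ∂μ) +
        θ ^ 2 * σ ^ 2 * Real.exp (θ * (D * Z)) / 2))) := by
  obtain ⟨hint, hle⟩ := integral_exp_truncAt_le (hV 0) hq hD hθ hZ hqZ hu2 hvar hzero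
  set g : E × ℝ → ℝ := fun v => q v.1 * truncAt D v.2
  have hg : Measurable g :=
    (hq.comp measurable_fst).mul ((measurable_truncAt D).comp measurable_snd)
  have hindg : iIndepFun (fun i ω => g (V i ω)) μ := hind.comp (fun _ => g) fun _ => hg
  have hidg : ∀ i, IdentDistrib (fun ω => g (V i ω)) (fun ω => g (V 0 ω)) μ μ := fun i =>
    (hid i).comp hg
  have hexpi : ∀ i, Integrable (fun ω => Real.exp (θ * g (V i ω))) μ := fun i =>
    (((hid i).comp (u := fun v => Real.exp (θ * g v)) (hg.const_mul θ).exp).integrable_iff).2 hint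
  have hmgf : mgf (∑ i ∈ Finset.range n, fun ω => g (V i ω)) μ θ =
      ∏ i ∈ Finset.range n, mgf (fun ω => g (V i ω)) μ θ :=
    hindg.mgf_sum (fun i => hg.comp (hV i)) _
  have hmgfi : ∀ i, mgf (fun ω => g (V i ω)) μ θ = mgf (fun ω => g (V 0 ω)) μ θ := fun i =>
    ((hidg i).comp (u := fun v => Real.exp (θ * v)) (by fun_prop)).integral_eq
  have hsumi : Integrable (fun ω => Real.exp (θ * (∑ i ∈ Finset.range n, fun ω => g (V i ω)) ω)) μ :=
    hindg.integrable_exp_mul_sum (fun i => hg.comp (hV i)) fun i _ => hexpi i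
  have hch := measure_ge_le_exp_mul_mgf (μ := μ) (X := ∑ i ∈ Finset.range n, fun ω => g (V i ω))
    x hθ hsumi
  rw [hmgf, Finset.prod_congr rfl fun i _ => hmgfi i, Finset.prod_const, Finset.card_range] at hch
  simp only [Finset.sum_apply] at hch
  rw [← ofReal_measureReal]
  refine ENNReal.ofReal_le_ofReal (hch.trans ?_)
  rw [Real.exp_add, Real.exp_nat_mul, ← neg_mul]
  gcongr
  · exact integral_nonneg fun ω => (Real.exp_pos _).le
  · exact hle

end Truncated

section UniformSums

variable {Ω E β : Type*} [MeasurableSpace Ω] [MeasurableSpace E] {μ : Measure Ω}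
  [IsProbabilityMeasure μ] {V : ℕ → Ω → E × ℝ}

/-- Markov's inequality. The event does not involve the weights, so it is paid for once for a whole
family of them. -/
theorem measure_excess_ge_le (hV : ∀ i, Measurable (V i))
    (hid : ∀ i, IdentDistrib (V i) (V 0) μ μ) (hu : Integrable (fun ω => (V 0 ω).2) μ)
    (D : ℝ) {n : ℕ} (hn : 0 < n) {y : ℝ} (hy : 0 < y) :
    μ {ω | y ≤ (n : ℝ)⁻¹ * ∑ i ∈ Finset.range n, excessAt D (V i ω).2} ≤
      ENNReal.ofReal ((∫ ω, excessAt D (V 0 ω).2 ∂μ) / y) := by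
  have hm : Measurable fun v : E × ℝ => excessAt D v.2 :=
    (measurable_excessAt D).comp measurable_snd
  have hi0 : Integrable (fun ω => excessAt D (V 0 ω).2) μ := by
    refine hu.abs.mono' (hm.comp (hV 0)).aestronglyMeasurable (Eventually.of_forall fun ω => ?_)
    rw [Real.norm_of_nonneg (excessAt_nonneg _ _)]
    exact excessAt_le_abs _ _
  have hi : ∀ i, Integrable (fun ω => excessAt D (V i ω).2) μ := fun i =>
    (((hid i).comp hm).integrable_iff).2 hi0
  have he : ∀ i, ∫ ω, excessAt D (V i ω).2 ∂μ = ∫ ω, excessAt D (V 0 ω).2 ∂μ := fun i =>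
    ((hid i).comp hm).integral_eq
  have hmk := mul_meas_ge_le_integral_of_nonneg (μ := μ)
    (f := fun ω => (n : ℝ)⁻¹ * ∑ i ∈ Finset.range n, excessAt D (V i ω).2)
    (Eventually.of_forall fun ω => mul_nonneg (by positivity)
      (Finset.sum_nonneg fun i _ => excessAt_nonneg _ _))
    ((integrable_finsetSum _ fun i _ => hi i).const_mul _) y
  rw [integral_const_mul, integral_finsetSum _ fun i _ => hi i,
    Finset.sum_congr rfl fun i _ => he i, Finset.sum_const, Finset.card_range, nsmul_eq_mul,
    inv_mul_cancel_left₀ (Nat.cast_pos.2 hn).ne'] at hmk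
  rw [← ofReal_measureReal]
  exact ENNReal.ofReal_le_ofReal ((le_div_iff₀ hy).2 (by rwa [mul_comm]))

/-- The deviation of a finite family of weighted sums of residuals, split by truncation. -/
theorem measure_exists_weighted_sum_gt_le (hV : ∀ i, Measurable (V i)) (hind : iIndepFun V μ)
    (hid : ∀ i, IdentDistrib (V i) (V 0) μ μ) {F : Finset β} {q : β → E → ℝ}
    (hq : ∀ f ∈ F, Measurable (q f)) {Z σ D θ : ℝ}
    (hD : 0 ≤ D) (hθ : 0 ≤ θ) (hZ : 0 < Z) (hqZ : ∀ f ∈ F, ∀ᵐ ω ∂μ, |q f (V 0 ω).1| ≤ Z)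
    (hu2 : Integrable (fun ω => (V 0 ω).2 ^ 2) μ)
    (hvar : ∀ f ∈ F, ∫ ω, q f (V 0 ω).1 ^ 2 * (V 0 ω).2 ^ 2 ∂μ ≤ σ ^ 2)
    (hzero : ∀ f ∈ F, ∫ ω, q f (V 0 ω).1 * (V 0 ω).2 ∂μ = 0) {n : ℕ} (hn : 0 < n) (x : ℝ)
    {y : ℝ} (hy : 0 < y) :
    μ {ω | ∃ f ∈ F, x + y < |(n : ℝ)⁻¹ * ∑ i ∈ Finset.range n, q f (V i ω).1 * (V i ω).2|} ≤
      ENNReal.ofReal (2 * F.card * Real.exp (-(θ * (n * x)) +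
        n * (θ * (Z * ∫ ω, excessAt D (V 0 ω).2 ∂μ) +
          θ ^ 2 * σ ^ 2 * Real.exp (θ * (D * Z)) / 2)) +
        Z * (∫ ω, excessAt D (V 0 ω).2 ∂μ) / y) := by
  set B := Real.exp (-(θ * (n * x)) + n * (θ * (Z * ∫ ω, excessAt D (V 0 ω).2 ∂μ) +
          θ ^ 2 * σ ^ 2 * Real.exp (θ * (D * Z)) / 2))
  have hu : Integrable (fun ω => (V 0 ω).2) μ :=
    ((memLp_two_iff_integrable_sq (measurable_snd.comp (hV 0)).aestronglyMeasurable).2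
      hu2).integrable one_le_two
  have hn' : (0 : ℝ) < n := Nat.cast_pos.2 hn
  set S1 : β → Set Ω := fun f =>
    {ω | n * x ≤ ∑ i ∈ Finset.range n, q f (V i ω).1 * truncAt D (V i ω).2}
  set S2 : β → Set Ω := fun f =>
    {ω | n * x ≤ ∑ i ∈ Finset.range n, -q f (V i ω).1 * truncAt D (V i ω).2}
  set S3 : Set Ω := {ω | y / Z ≤ (n : ℝ)⁻¹ * ∑ i ∈ Finset.range n, excessAt D (V i ω).2}
  have h1 : ∀ f ∈ F, μ (S1 f) ≤ ENNReal.ofReal B := fun f hf =>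
    measure_sum_truncAt_ge_le hV hind hid (hq f hf) hD hθ hZ.le (hqZ f hf) hu2 (hvar f hf)
      (hzero f hf) n _
  have h2 : ∀ f ∈ F, μ (S2 f) ≤ ENNReal.ofReal B := fun f hf => by
    refine measure_sum_truncAt_ge_le hV hind hid (q := fun w => -q f w) (hq f hf).neg hD hθ hZ.le
      ?_ hu2 ?_ ?_ n _
    · simpa using hqZ f hf
    · simpa using hvar f hf
    · simp only [neg_mul, integral_neg, hzero f hf, neg_zero]
  have h3 : μ S3 ≤ ENNReal.ofReal (Z * (∫ ω, excessAt D (V 0 ω).2 ∂μ) / y) := by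
    refine (measure_excess_ge_le hV hid hu D hn (div_pos hy hZ)).trans (le_of_eq ?_)
    congr 1; field_simp
  -- The weights are bounded only almost surely; the exceptional set is null as the family and the
  -- sample are countable.
  set Nn : Set Ω := {ω | ¬ ∀ i, ∀ f ∈ F, |q f (V i ω).1| ≤ Z}
  have h4 : μ Nn = 0 := by
    have : ∀ᵐ ω ∂μ, ∀ i, ∀ f ∈ F, |q f (V i ω).1| ≤ Z := by
      refine ae_all_iff.2 fun i => (Finset.eventually_all F).2 fun f hf => ?_
      exact (hid i).symm.ae_snd (p := fun v : E × ℝ => |q f v.1| ≤ Z)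
        (measurableSet_le ((hq f hf).comp measurable_fst).abs measurable_const) (hqZ f hf)
    exact ae_iff.1 this
  have hsub : {ω | ∃ f ∈ F, x + y < |(n : ℝ)⁻¹ *
      ∑ i ∈ Finset.range n, q f (V i ω).1 * (V i ω).2|} ⊆
      ((⋃ f ∈ F, S1 f) ∪ (⋃ f ∈ F, S2 f)) ∪ (S3 ∪ Nn) := by
    rintro ω ⟨f, hf, hω⟩
    by_contra hc
    simp only [Set.mem_union, Set.mem_iUnion, not_or, not_exists, S1, S2, S3, Nn,
      Set.mem_ofPred_eq, not_le, not_not] at hc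
    obtain ⟨⟨hc1, hc2⟩, hc3, hc4⟩ := hc
    have g1 := hc1 f hf
    have g2 := hc2 f hf
    simp only [neg_mul, Finset.sum_neg_distrib] at g2
    have g3 : |∑ i ∈ Finset.range n, q f (V i ω).1 * (V i ω).2 -
        ∑ i ∈ Finset.range n, q f (V i ω).1 * truncAt D (V i ω).2| ≤
        Z * ∑ i ∈ Finset.range n, excessAt D (V i ω).2 := by
      rw [← Finset.sum_sub_distrib, Finset.mul_sum]
      refine (Finset.abs_sum_le_sum_abs _ _).trans (Finset.sum_le_sum fun i _ => ?_)
      rw [← mul_sub, abs_mul, abs_sub_truncAt]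
      exact mul_le_mul_of_nonneg_right (hc4 i f hf) (excessAt_nonneg _ _)
    rw [lt_div_iff₀ hZ, inv_mul_eq_div, div_mul_eq_mul_div, div_lt_iff₀ hn'] at hc3
    rw [abs_mul, abs_of_pos (inv_pos.2 hn'), inv_mul_eq_div, lt_div_iff₀ hn'] at hω
    rw [abs_le] at g3
    have : |∑ i ∈ Finset.range n, q f (V i ω).1 * (V i ω).2| ≤ (x + y) * n :=
      abs_le.2 ⟨by linarith, by linarith⟩
    linarith
  have hB : 0 ≤ B := (Real.exp_pos _).le
  have hT : 0 ≤ Z * (∫ ω, excessAt D (V 0 ω).2 ∂μ) / y :=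
    div_nonneg (mul_nonneg hZ.le (integral_nonneg fun ω => excessAt_nonneg _ _)) hy.le
  have hU : ∀ S : β → Set Ω, (∀ f ∈ F, μ (S f) ≤ ENNReal.ofReal B) →
      μ (⋃ f ∈ F, S f) ≤ ENNReal.ofReal (F.card * B) := fun S hS => by
    refine (measure_biUnion_finset_le _ _).trans ((Finset.sum_le_card_nsmul _ _ _ hS).trans ?_)
    rw [nsmul_eq_mul, ENNReal.ofReal_mul (Nat.cast_nonneg _), ENNReal.ofReal_natCast]
  refine (measure_mono hsub).trans ((measure_union_le _ _).trans ?_)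
  rw [ENNReal.ofReal_add (by positivity) hT,
    show 2 * (F.card : ℝ) * B = F.card * B + F.card * B by ring,
    ENNReal.ofReal_add (by positivity) (by positivity)]
  refine add_le_add ((measure_union_le _ _).trans (add_le_add (hU S1 h1) (hU S2 h2))) ?_
  refine (measure_union_le _ _).trans ?_
  rw [h4, add_zero]
  exact h3

theorem eventually_sqrt_log_div_pos : ∀ᶠ n : ℕ in atTop, 0 < √(Real.log n / n) := by
  filter_upwards [eventually_ge_atTop 2] with n hn
  have h1 : (1 : ℝ) < n := by exact_mod_cast hn
  exact Real.sqrt_pos.2 (div_pos (Real.log_pos h1) (by linarith))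

/-- Uniform concentration of a slowly growing number of weighted sums of residuals. -/
theorem tendsto_measure_exists_weighted_sum_gt (hV : ∀ i, Measurable (V i))
    (hind : iIndepFun V μ) (hid : ∀ i, IdentDistrib (V i) (V 0) μ μ) {F : ℕ → Finset β}
    {q : β → E → ℝ} {Z : ℕ → ℝ} {σ δ C κ ρ η : ℝ} (hσ : 0 < σ) (hδ : 0 < δ) (hκ0 : 0 < κ)
    (hκ1 : κ ≤ 1) (hρ0 : 0 < ρ) (hρ1 : ρ < 1) (hρκ : 1 - κ / 4 ≤ ρ ^ 2) (hη : 0 < η)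
    (hq : ∀ᶠ n in atTop, ∀ f ∈ F n, Measurable (q f)) (hZ : ∀ᶠ n in atTop, 0 < Z n)
    (hqZ : ∀ᶠ n in atTop, ∀ f ∈ F n, ∀ᵐ ω ∂μ, |q f (V 0 ω).1| ≤ Z n)
    (hu2 : Integrable (fun ω => (V 0 ω).2 ^ 2) μ)
    (hmom : Integrable (fun ω => |(V 0 ω).2| ^ (2 + δ)) μ)
    (hvar : ∀ᶠ n in atTop, ∀ f ∈ F n, ∫ ω, q f (V 0 ω).1 ^ 2 * (V 0 ω).2 ^ 2 ∂μ ≤ σ ^ 2)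
    (hzero : ∀ᶠ n in atTop, ∀ f ∈ F n, ∫ ω, q f (V 0 ω).1 * (V 0 ω).2 ∂μ = 0)
    (hgrow : Tendsto (fun n : ℕ => Z n ^ ((2 + δ) / δ) * √(Real.log n / n)) atTop (𝓝 0))
    (hcard : ∀ᶠ n : ℕ in atTop, ((F n).card : ℝ) ≤ C * (n : ℝ) ^ (1 - κ)) :
    Tendsto (fun n : ℕ => μ {ω | ∃ f ∈ F n, (√2 * ρ + η) * σ * √(Real.log n / n) <
      |(n : ℝ)⁻¹ * ∑ i ∈ Finset.range n, q f (V i ω).1 * (V i ω).2|}) atTop (𝓝 0) := by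
  set ε : ℕ → ℝ := fun n => √(Real.log n / n)
  -- With D = a/(Zε) and θ as below, θDZ is at most log(1 + κ/8), so the factor e^{θDZ} in the
  -- Chernoff exponent is at most 1 + κ/8.
  set a := σ * Real.log (1 + κ / 8) / 2
  have hlog : 0 < Real.log (1 + κ / 8) := Real.log_pos (by linarith)
  have ha : 0 < a := by positivity
  set D : ℕ → ℝ := fun n => a / (Z n * ε n)
  set T : ℕ → ℝ := fun n => ∫ ω, excessAt (D n) (V 0 ω).2 ∂μ
  set m := ∫ ω, |(V 0 ω).2| ^ (2 + δ) ∂μ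
  have hu : Integrable (fun ω => (V 0 ω).2) μ :=
    ((memLp_two_iff_integrable_sq (measurable_snd.comp (hV 0)).aestronglyMeasurable).2
      hu2).integrable one_le_two
  have hT0 : ∀ n, 0 ≤ T n := fun n => integral_nonneg fun ω => excessAt_nonneg _ _
  -- Bounding the excess by D^{−(1+δ)}|u|^{2+δ} turns this quotient into a constant times
  -- (Z^{(2+δ)/δ}ε)^δ, which is where the exponent (2+δ)/δ comes from.
  have hlim : Tendsto (fun n => Z n * T n / ε n) atTop (𝓝 0) := by
    have h1 : Tendsto (fun n : ℕ => a ^ (-(1 + δ)) * m * (Z n ^ ((2 + δ) / δ) * ε n) ^ δ) atTop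
        (𝓝 0) := by
      have := (hgrow.rpow_const (p := δ) (Or.inr hδ.le)).const_mul (a ^ (-(1 + δ)) * m)
      rw [Real.zero_rpow hδ.ne', mul_zero] at this
      exact this
    refine squeeze_zero' ?_ ?_ h1
    · filter_upwards [hZ] with n hZn
      exact div_nonneg (mul_nonneg hZn.le (hT0 n)) (Real.sqrt_nonneg _)
    · filter_upwards [hZ, eventually_sqrt_log_div_pos] with n hZn hεn
      change 0 < ε n at hεn
      have hDn : 0 < D n := by positivity
      have hTle : T n ≤ D n ^ (-(1 + δ)) * m := by
        rw [← integral_const_mul]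
        refine integral_mono_of_nonneg (Eventually.of_forall fun ω => excessAt_nonneg _ _)
          (hmom.const_mul _) (Eventually.of_forall fun ω => excessAt_le_rpow hDn hδ _)
      have hDe : D n ^ (-(1 + δ)) = a ^ (-(1 + δ)) * (Z n ^ (1 + δ) * ε n ^ (1 + δ)) := by
        simp only [D]
        rw [Real.div_rpow ha.le (by positivity), Real.rpow_neg (by positivity : 0 ≤ Z n * ε n),
          div_inv_eq_mul, Real.mul_rpow hZn.le hεn.le]
      have hr : (Z n ^ ((2 + δ) / δ) * ε n) ^ δ = Z n * Z n ^ (1 + δ) * (ε n ^ (1 + δ) / ε n) := by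
        rw [Real.mul_rpow (by positivity) hεn.le, ← Real.rpow_mul hZn.le,
          div_mul_cancel₀ _ hδ.ne', show 2 + δ = 1 + (1 + δ) by ring, Real.rpow_add hZn,
          Real.rpow_one, Real.rpow_add hεn, Real.rpow_one]
        field_simp
      calc Z n * T n / ε n ≤ Z n * (D n ^ (-(1 + δ)) * m) / ε n := by gcongr
        _ = _ := by rw [hDe, hr]; ring
  have hb1 : Tendsto (fun n : ℕ => 2 * C * (n : ℝ) ^ (-(κ / 2)) + η⁻¹ * σ⁻¹ * (Z n * T n / ε n))
      atTop (𝓝 0) := by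
    have h1 := ((tendsto_rpow_neg_atTop (half_pos hκ0)).comp
      tendsto_natCast_atTop_atTop).const_mul (2 * C)
    have := h1.add (hlim.const_mul (η⁻¹ * σ⁻¹))
    simpa [Function.comp_def] using this
  have hb2 := ENNReal.tendsto_ofReal hb1
  rw [ENNReal.ofReal_zero] at hb2
  refine tendsto_of_tendsto_of_tendsto_of_le_of_le' tendsto_const_nhds hb2
    (Eventually.of_forall fun _ => zero_le) ?_
  have hsmall : ∀ᶠ n in atTop, √2 * ρ / σ * (Z n * T n / ε n) ≤ κ / 8 := by
    have := hlim.const_mul (√2 * ρ / σ)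
    rw [mul_zero] at this
    exact this.eventually (eventually_le_nhds (by positivity))
  filter_upwards [hq, hZ, hqZ, hvar, hzero, hcard, hsmall, eventually_sqrt_log_div_pos,
    eventually_ge_atTop 2] with n hq hZn hqZ hvar hzero hcard hsmall hεn hn2
  change 0 < ε n at hεn
  have hn : 0 < n := by omega
  have hn' : (0 : ℝ) < n := Nat.cast_pos.2 hn
  have hD : 0 ≤ D n := by positivity
  -- The minimizer of −θx + θ²σ²/2 at the level x = √2ρσε.
  set θ := √2 * ρ * ε n / σ
  have hθ : 0 ≤ θ := by positivity
  have hlogn : 0 ≤ Real.log n := Real.log_natCast_nonneg n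
  have hε2 : n * ε n ^ 2 = Real.log n := by
    simp only [ε]
    rw [Real.sq_sqrt (by positivity)]; field_simp
  have h22 : √2 ^ 2 = 2 := Real.sq_sqrt zero_le_two
  have key := measure_exists_weighted_sum_gt_le hV hind hid hq hD hθ hZn hqZ hu2 hvar hzero hn
    (√2 * ρ * σ * ε n) (y := η * σ * ε n) (by positivity)
  have e0 : (√2 * ρ + η) * σ * ε n = √2 * ρ * σ * ε n + η * σ * ε n := by ring
  rw [e0]
  refine key.trans (ENNReal.ofReal_le_ofReal ?_)
  refine add_le_add ?_ (le_of_eq ?_)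
  -- Relative to log n, the exponent is at most −ρ²(1 − κ/8) + κ/8 ≤ −(1 − κ/4)(1 − κ/8) + κ/8 ≤ −(1
  -- − κ/2). Against n^{1−κ} sums this leaves n^{−κ/2}.
  · have hexpo : -(θ * (n * (√2 * ρ * σ * ε n))) + n * (θ * (Z n * T n) +
        θ ^ 2 * σ ^ 2 * Real.exp (θ * (D n * Z n)) / 2) ≤ Real.log n * (-(1 - κ / 2)) := by
      have h1 : θ * (n * (√2 * ρ * σ * ε n)) = 2 * ρ ^ 2 * Real.log n := by
        calc _ = √2 ^ 2 * ρ ^ 2 * (n * ε n ^ 2) := by simp only [θ]; field_simp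
          _ = _ := by rw [h22, hε2]
      have h2 : n * (θ * (Z n * T n)) = √2 * ρ / σ * (Z n * T n / ε n) * Real.log n := by
        rw [← hε2]; simp only [θ]; field_simp
      have h3 : n * (θ ^ 2 * σ ^ 2) = 2 * ρ ^ 2 * Real.log n := by
        calc _ = √2 ^ 2 * ρ ^ 2 * (n * ε n ^ 2) := by simp only [θ]; field_simp
          _ = _ := by rw [h22, hε2]
      have h4 : Real.exp (θ * (D n * Z n)) ≤ 1 + κ / 8 := by
        rw [← Real.exp_log (by linarith : 0 < 1 + κ / 8)]
        refine Real.exp_le_exp.2 ?_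
        have : θ * (D n * Z n) = √2 * ρ / 2 * Real.log (1 + κ / 8) := by
          simp only [θ, D, a]; field_simp
        rw [this]
        have : √2 * ρ / 2 ≤ 1 := by
          have : √2 ≤ 2 := by rw [Real.sqrt_le_left (by norm_num)]; norm_num
          nlinarith [Real.sqrt_nonneg 2]
        nlinarith
      have h5 : n * (θ ^ 2 * σ ^ 2 * Real.exp (θ * (D n * Z n)) / 2) ≤
          ρ ^ 2 * Real.log n * (1 + κ / 8) := by
        have : n * (θ ^ 2 * σ ^ 2 * Real.exp (θ * (D n * Z n)) / 2) =
            n * (θ ^ 2 * σ ^ 2) / 2 * Real.exp (θ * (D n * Z n)) := by ring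
        rw [this, h3]
        have h6 : 0 ≤ 2 * ρ ^ 2 * Real.log n / 2 := by positivity
        calc _ ≤ 2 * ρ ^ 2 * Real.log n / 2 * (1 + κ / 8) := mul_le_mul_of_nonneg_left h4 h6
          _ = _ := by ring
      rw [h1, mul_add, h2]
      have h7 : √2 * ρ / σ * (Z n * T n / ε n) * Real.log n ≤ κ / 8 * Real.log n :=
        mul_le_mul_of_nonneg_right hsmall hlogn
      have h8 : (1 - κ / 4) * (1 - κ / 8) * Real.log n ≤ ρ ^ 2 * (1 - κ / 8) * Real.log n := by
        refine mul_le_mul_of_nonneg_right (mul_le_mul_of_nonneg_right hρκ (by linarith)) hlogn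
      nlinarith [mul_nonneg (sq_nonneg κ) hlogn]
    calc _ ≤ 2 * (C * (n : ℝ) ^ (1 - κ)) * Real.exp (Real.log n * (-(1 - κ / 2))) := by
          have hc0 : (0 : ℝ) ≤ (F n).card := Nat.cast_nonneg _
          exact mul_le_mul (by linarith) (Real.exp_le_exp.2 hexpo) (Real.exp_pos _).le
            (by linarith)
      _ = 2 * C * (n : ℝ) ^ (-(κ / 2)) := by
          rw [← Real.rpow_def_of_pos hn', mul_assoc, mul_assoc, mul_assoc, ← Real.rpow_add hn']
          congr 3; ring
  · change Z n * T n / (η * σ * ε n) = _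
    field_simp

end UniformSums

/-! ### Quadratic norms and perturbation of the two-stage least squares system -/

section QuadraticNorm

variable {κ : Type*} [Fintype κ]

/-- The norm `√(x' G x)`. -/
def qnorm (G : Matrix κ κ ℝ) (x : κ → ℝ) : ℝ := √(x ⬝ᵥ (G *ᵥ x))

theorem qnorm_nonneg (G : Matrix κ κ ℝ) (x : κ → ℝ) : 0 ≤ qnorm G x := Real.sqrt_nonneg _

theorem Matrix.PosSemidef.form_nonneg {G : Matrix κ κ ℝ} (hG : G.PosSemidef) (x : κ → ℝ) :
    0 ≤ x ⬝ᵥ (G *ᵥ x) := by simpa using hG.dotProduct_mulVec_nonneg x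

theorem qnorm_sq {G : Matrix κ κ ℝ} (hG : G.PosSemidef) (x : κ → ℝ) :
    qnorm G x ^ 2 = x ⬝ᵥ (G *ᵥ x) := Real.sq_sqrt (hG.form_nonneg x)

theorem qnorm_pos {G : Matrix κ κ ℝ} (hG : G.PosDef) {x : κ → ℝ} (hx : x ≠ 0) :
    0 < qnorm G x := Real.sqrt_pos.2 (by simpa using hG.dotProduct_mulVec_pos hx)

theorem dotProduct_mulVec_symm {G : Matrix κ κ ℝ} (hG : G.IsHermitian) (x y : κ → ℝ) :
    x ⬝ᵥ (G *ᵥ y) = y ⬝ᵥ (G *ᵥ x) := by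
  have h : Gᵀ = G := by rw [← conjTranspose_eq_transpose_of_trivial]; exact hG
  rw [dotProduct_mulVec, ← mulVec_transpose, h, dotProduct_comm]

theorem abs_form_le_qnorm_mul_qnorm {G : Matrix κ κ ℝ} (hG : G.PosSemidef) (x y : κ → ℝ) :
    |x ⬝ᵥ (G *ᵥ y)| ≤ qnorm G x * qnorm G y := by
  have hq : ∀ t : ℝ, 0 ≤ (y ⬝ᵥ (G *ᵥ y)) * (t * t) + 2 * (x ⬝ᵥ (G *ᵥ y)) * t +
      x ⬝ᵥ (G *ᵥ x) := fun t => by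
    have := hG.form_nonneg (x + t • y)
    simp only [mulVec_add, mulVec_smul, dotProduct_add, add_dotProduct, dotProduct_smul,
      smul_dotProduct, smul_eq_mul, dotProduct_mulVec_symm hG.1 y x] at this
    linarith
  have hd := discrim_le_zero hq
  rw [discrim] at hd
  unfold qnorm
  rw [← Real.sqrt_mul (hG.form_nonneg x)]
  exact Real.abs_le_sqrt (by nlinarith)

/-- A = UΛ^{−1/2} from the spectral decomposition. It plays the role of G^{−1/2}: its columns are
the coefficients of an orthonormal basis. -/
theorem exists_conj_eq_one [DecidableEq κ] {G : Matrix κ κ ℝ} (hG : G.PosDef) :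
    ∃ A : Matrix κ κ ℝ, Aᵀ * G * A = 1 ∧ IsUnit A := by
  set U := (hG.1.eigenvectorUnitary : Matrix κ κ ℝ)
  have hU' : Uᴴ * U = 1 := Unitary.coe_star_mul_self hG.1.eigenvectorUnitary
  have hpos := hG.eigenvalues_pos
  have hone : (U * diagonal fun i => (√(hG.1.eigenvalues i))⁻¹)ᵀ * G *
      (U * diagonal fun i => (√(hG.1.eigenvalues i))⁻¹) = 1 := by
    conv_lhs => enter [1, 2]; rw [hG.1.eq_conj_diagonal]
    rw [transpose_mul, diagonal_transpose, ← conjTranspose_eq_transpose_of_trivial U]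
    calc _ = diagonal (fun i => (√(hG.1.eigenvalues i))⁻¹) * (Uᴴ * U) * diagonal hG.1.eigenvalues *
          (Uᴴ * U) * diagonal (fun i => (√(hG.1.eigenvalues i))⁻¹) := by
          simp only [Matrix.mul_assoc]; rfl
      _ = 1 := by
          rw [hU', Matrix.mul_one, Matrix.mul_one, diagonal_mul_diagonal, diagonal_mul_diagonal,
            ← diagonal_one]
          congr 1; ext i
          have h1 := Real.sqrt_pos.2 (hpos i)
          have h2 := Real.mul_self_sqrt (hpos i).le
          field_simp
          rw [sq, h2]
  exact ⟨_, hone, IsUnit.of_mul_eq_one_right _ hone⟩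

end QuadraticNorm

section Saddle

variable {κ ι : Type*} [Fintype κ] [Fintype ι] {G Gh : Matrix κ κ ℝ}
  {S Sh : Matrix κ ι ℝ} {H Hh : Matrix ι ι ℝ} {s d : ℝ}

theorem posDef_of_form_close (hG : G.PosDef) (hGh : Gh.IsHermitian) (hd : d < 1)
    (h1 : ∀ p q, |p ⬝ᵥ (Gh *ᵥ q) - p ⬝ᵥ (G *ᵥ q)| ≤ d * qnorm G p * qnorm G q) : Gh.PosDef := by
  refine PosDef.of_dotProduct_mulVec_pos hGh fun x hx => ?_
  have a1 := abs_le.1 (h1 x x)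
  have a2 := qnorm_sq hG.posSemidef x
  have a3 := qnorm_pos hG hx
  simp only [star_trivial]
  nlinarith [mul_pos a3 a3]

variable [DecidableEq κ]

theorem form_projection (hG : G.PosDef) (q : κ → ℝ) (c : ι → ℝ) :
    q ⬝ᵥ (G *ᵥ (G⁻¹ *ᵥ (S *ᵥ c))) = q ⬝ᵥ (S *ᵥ c) := by
  rw [mulVec_mulVec, mul_nonsing_inv _ ((isUnit_iff_isUnit_det _).1 hG.isUnit), one_mulVec]

/-- Perturbation bound for the saddle point form of two-stage least squares. -/
theorem saddle_perturbation (hG : G.PosDef) (hs : 0 < s) (hs1 : s ≤ 1) (hd0 : 0 ≤ d)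
    (hd : d ≤ s / 2) (hS : ∀ c, s * qnorm H c ≤ qnorm G (G⁻¹ *ᵥ (S *ᵥ c)))
    (h1 : ∀ p q, |p ⬝ᵥ (Gh *ᵥ q) - p ⬝ᵥ (G *ᵥ q)| ≤ d * qnorm G p * qnorm G q)
    (h2 : ∀ p c, |p ⬝ᵥ (Sh *ᵥ c) - p ⬝ᵥ (S *ᵥ c)| ≤ d * qnorm G p * qnorm H c)
    {v vh p w : κ → ℝ} {ch c : ι → ℝ} {V V' : ℝ} (hV : 0 ≤ V) (hV' : 0 ≤ V')
    (hp : Gh *ᵥ p + Sh *ᵥ ch = vh) (hp' : Shᵀ *ᵥ p = 0) (hw : G *ᵥ w + S *ᵥ c = v)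
    (hw' : Sᵀ *ᵥ w = 0) (hv : ∀ q, |q ⬝ᵥ v| ≤ V * qnorm G q)
    (hvh : ∀ q, |q ⬝ᵥ (vh - v)| ≤ V' * qnorm G q) :
    qnorm H (ch - c) ≤ 12 * d * (V + V') / s ^ 2 + V' / s := by
  have hGs := hG.posSemidef
  have nb0 := qnorm_nonneg G
  have nh0 := qnorm_nonneg H
  have hvt : ∀ q, |q ⬝ᵥ vh| ≤ (V + V') * qnorm G q := fun q => by
    have e : q ⬝ᵥ vh = q ⬝ᵥ v + q ⬝ᵥ (vh - v) := by rw [dotProduct_sub]; ring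
    rw [e]
    exact (abs_add_le _ _).trans (by linarith [hv q, hvh q])
  have horth : ∀ e, p ⬝ᵥ (Sh *ᵥ e) = 0 := fun e => by
    rw [dotProduct_mulVec, ← mulVec_transpose, hp', zero_dotProduct]
  have horth' : ∀ e, w ⬝ᵥ (S *ᵥ e) = 0 := fun e => by
    rw [dotProduct_mulVec, ← mulVec_transpose, hw', zero_dotProduct]
  have hsys : ∀ q, q ⬝ᵥ (Gh *ᵥ p) + q ⬝ᵥ (Sh *ᵥ ch) = q ⬝ᵥ vh := fun q => by
    rw [← dotProduct_add, hp]
  have hsys' : ∀ q, q ⬝ᵥ (G *ᵥ w) + q ⬝ᵥ (S *ᵥ c) = q ⬝ᵥ v := fun q => by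
    rw [← dotProduct_add, hw]
  have cancel : ∀ {x y : ℝ}, 0 ≤ x → 0 ≤ y → x * x ≤ y * x → x ≤ y := fun {x y} hx hy h => by
    rcases hx.eq_or_lt with h0 | h0
    · rw [← h0]; exact hy
    · exact le_of_mul_le_mul_right h h0
  set W := V + V'
  have hW : 0 ≤ W := add_nonneg hV hV'
  -- Testing the sample system with p itself removes the term in ĉ, since p is orthogonal to the
  -- range of Ŝ; d ≤ 1/2 absorbs the error in the Gram matrix.
  have hpn : qnorm G p ≤ 2 * W := by
    have a1 := abs_le.1 (h1 p p)
    have a2 := abs_le.1 (hvt p)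
    have a3 := hsys p
    rw [horth] at a3
    have a4 := qnorm_sq hGs p
    refine cancel (nb0 p) (by linarith) ?_
    nlinarith [mul_nonneg hd0 (mul_nonneg (nb0 p) (nb0 p)), mul_nonneg (nb0 p) (nb0 p)]
  -- The next test vector is G⁻¹Sĉ, whose pairing with Sĉ is its own squared norm; by `hS` that norm
  -- dominates s times the norm of ĉ.
  have hchn : s * qnorm H ch ≤ 8 * W := by
    refine (hS ch).trans ?_
    set g := G⁻¹ *ᵥ (S *ᵥ ch)
    have a0 := hS ch
    have a1 := abs_le.1 (h1 g p)
    have a2 := abs_le.1 (hvt g)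
    have a3 := hsys g
    have a4 := abs_le.1 (h2 g ch)
    have a5 : g ⬝ᵥ (S *ᵥ ch) = qnorm G g ^ 2 := by rw [qnorm_sq hGs, form_projection hG]
    have a6 := abs_le.1 (abs_form_le_qnorm_mul_qnorm hGs g p)
    have a7 : d * qnorm H ch ≤ qnorm G g / 2 := by
      have : d * qnorm H ch ≤ s / 2 * qnorm H ch := mul_le_mul_of_nonneg_right hd (nh0 _)
      linarith
    have a8 : d * qnorm G g * qnorm H ch ≤ qnorm G g * (qnorm G g / 2) := by
      calc _ = qnorm G g * (d * qnorm H ch) := by ring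
        _ ≤ _ := mul_le_mul_of_nonneg_left a7 (nb0 g)
    have a9 : d * qnorm G g * qnorm G p ≤ 1 / 2 * (qnorm G g * (2 * W)) := by
      calc _ = d * (qnorm G g * qnorm G p) := by ring
        _ ≤ 1 / 2 * (qnorm G g * (2 * W)) :=
          mul_le_mul (by linarith) (mul_le_mul_of_nonneg_left hpn (nb0 g))
            (mul_nonneg (nb0 g) (nb0 p)) (by norm_num)
    have a10 : qnorm G g * qnorm G p ≤ qnorm G g * (2 * W) :=
      mul_le_mul_of_nonneg_left hpn (nb0 g)
    refine cancel (nb0 g) (by linarith) ?_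
    nlinarith
  set y := ch - c
  -- The two systems are subtracted after testing both with this g. Then g'Gw = 0 by orthogonality,
  -- and g'Gp = p'Sy is of order d because p'Ŝy = 0. Four errors remain: three proportional to d,
  -- which contribute 2, 8 and 2 to the constant 12, and one from the right-hand side.
  set g := G⁻¹ *ᵥ (S *ᵥ y)
  have b5 : g ⬝ᵥ (S *ᵥ y) = qnorm G g ^ 2 := by rw [qnorm_sq hGs, form_projection hG]
  have hy := hS y
  have b1 := abs_le.1 (h1 g p)
  have b2 := abs_le.1 (h2 g ch)
  have b3 := abs_le.1 (hvh g)
  have b4 := abs_le.1 (h2 p y)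
  have b6 := hsys g
  have b7 := hsys' g
  have b8 : g ⬝ᵥ (S *ᵥ y) = g ⬝ᵥ (S *ᵥ ch) - g ⬝ᵥ (S *ᵥ c) := by
    rw [mulVec_sub, dotProduct_sub]
  have b9 : g ⬝ᵥ (G *ᵥ p) = p ⬝ᵥ (S *ᵥ y) := by
    rw [dotProduct_mulVec_symm hG.1, form_projection hG]
  have b10 : g ⬝ᵥ (G *ᵥ w) = 0 := by
    rw [dotProduct_mulVec_symm hG.1, form_projection hG, horth']
  rw [horth] at b4
  rw [dotProduct_sub] at b3
  have c1 : d * qnorm G g * qnorm G p ≤ 2 * d * W * qnorm G g := by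
    calc _ = d * qnorm G g * qnorm G p := rfl
      _ ≤ d * qnorm G g * (2 * W) := mul_le_mul_of_nonneg_left hpn (mul_nonneg hd0 (nb0 g))
      _ = _ := by ring
  have c2 : s * (d * qnorm G g * qnorm H ch) ≤ 8 * d * W * qnorm G g := by
    calc _ = d * qnorm G g * (s * qnorm H ch) := by ring
      _ ≤ d * qnorm G g * (8 * W) := mul_le_mul_of_nonneg_left hchn (mul_nonneg hd0 (nb0 g))
      _ = _ := by ring
  have c3 : s * (d * qnorm G p * qnorm H y) ≤ 2 * d * W * qnorm G g := by
    calc _ = d * qnorm G p * (s * qnorm H y) := by ring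
      _ ≤ d * (2 * W) * qnorm G g :=
        mul_le_mul (mul_le_mul_of_nonneg_left hpn hd0) hy (mul_nonneg hs.le (nh0 y))
          (mul_nonneg hd0 (by linarith))
      _ = _ := by ring
  have hgs : s * qnorm G g ≤ 12 * d * W + s * V' := by
    have hdW : 0 ≤ d * W := mul_nonneg hd0 hW
    refine cancel (mul_nonneg hs.le (nb0 g)) (by nlinarith [mul_nonneg hs.le hV']) ?_
    have e : qnorm G g ^ 2 ≤ d * qnorm G g * qnorm G p + d * qnorm G g * qnorm H ch +
        V' * qnorm G g + d * qnorm G p * qnorm H y := by linarith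
    have e2 : s * qnorm G g ^ 2 ≤ 2 * d * W * qnorm G g + 8 * d * W * qnorm G g +
        s * (V' * qnorm G g) + 2 * d * W * qnorm G g := by
      have e3 : s * (d * qnorm G g * qnorm G p) ≤ 2 * d * W * qnorm G g := by
        have : 0 ≤ d * qnorm G g * qnorm G p := mul_nonneg (mul_nonneg hd0 (nb0 g)) (nb0 p)
        nlinarith
      nlinarith [mul_le_mul_of_nonneg_left e hs.le]
    have e4 := mul_le_mul_of_nonneg_left e2 hs.le
    nlinarith
  have hfin : s * (s * qnorm H y) ≤ 12 * d * W + s * V' :=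
    (mul_le_mul_of_nonneg_left hy hs.le).trans hgs
  have : 12 * d * W / s ^ 2 + V' / s = (12 * d * W + s * V') / s ^ 2 := by field_simp
  rw [this, le_div_iff₀ (by positivity)]
  linarith

/-- For g = G⁻¹Sc the pairing g'Sc is |g|². If Ŝc = 0 it is at most d|g||c|, so |g| ≤ d|c|, against
s|c| ≤ |g|. -/
theorem eq_zero_of_mulVec_eq_zero (hG : G.PosDef) (hH : H.PosDef) (hs : 0 < s) (hd : d < s)
    (hS : ∀ c, s * qnorm H c ≤ qnorm G (G⁻¹ *ᵥ (S *ᵥ c)))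
    (h2 : ∀ p c, |p ⬝ᵥ (Sh *ᵥ c) - p ⬝ᵥ (S *ᵥ c)| ≤ d * qnorm G p * qnorm H c)
    {c : ι → ℝ} (hc : Sh *ᵥ c = 0) : c = 0 := by
  by_contra h0
  have hp := qnorm_pos hH h0
  set g := G⁻¹ *ᵥ (S *ᵥ c)
  have a5 : g ⬝ᵥ (S *ᵥ c) = qnorm G g ^ 2 := by rw [qnorm_sq hG.posSemidef, form_projection hG]
  have a1 := abs_le.1 (h2 g c)
  have a2 := hS c
  rw [hc, dotProduct_zero, a5] at a1
  have a3 := qnorm_nonneg G g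
  have a4 : 0 < qnorm G g := lt_of_lt_of_le (mul_pos hs hp) a2
  have a5 : qnorm G g * qnorm G g ≤ d * qnorm H c * qnorm G g := by linarith
  have a6 := le_of_mul_le_mul_right a5 a4
  linarith [mul_lt_mul_of_pos_right hd hp]

/-- Comparison of the empirical and the population ratio in the measure of ill-posedness. -/
theorem qnorm_ratio_bounds (hG : G.PosDef) (hGh : Gh.PosDef) (hH : H.PosDef)
    (hHh : Hh.PosSemidef) (hs : 0 < s) (hs1 : s ≤ 1) (hd0 : 0 ≤ d) (hd : d ≤ s / 2)
    (hS : ∀ c, s * qnorm H c ≤ qnorm G (G⁻¹ *ᵥ (S *ᵥ c)))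
    (h1 : ∀ p q, |p ⬝ᵥ (Gh *ᵥ q) - p ⬝ᵥ (G *ᵥ q)| ≤ d * qnorm G p * qnorm G q)
    (h2 : ∀ p c, |p ⬝ᵥ (Sh *ᵥ c) - p ⬝ᵥ (S *ᵥ c)| ≤ d * qnorm G p * qnorm H c)
    (h3 : ∀ c e, |c ⬝ᵥ (Hh *ᵥ e) - c ⬝ᵥ (H *ᵥ e)| ≤ d * qnorm H c * qnorm H e)
    {c : ι → ℝ} (hc : c ≠ 0) :
    (1 - d) / (1 + d / s) * (qnorm H c / qnorm G (G⁻¹ *ᵥ (S *ᵥ c))) ≤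
      qnorm Hh c / qnorm Gh (Gh⁻¹ *ᵥ (Sh *ᵥ c)) ∧
    qnorm Hh c / qnorm Gh (Gh⁻¹ *ᵥ (Sh *ᵥ c)) ≤
      (1 + d) / (1 - d / s) * (qnorm H c / qnorm G (G⁻¹ *ᵥ (S *ᵥ c))) := by
  set g := G⁻¹ *ᵥ (S *ᵥ c)
  set gh := Gh⁻¹ *ᵥ (Sh *ᵥ c)
  set a := qnorm H c
  set B := qnorm G g
  set ah := qnorm Hh c
  set Bh := qnorm Gh gh
  have ha : 0 < a := qnorm_pos hH hc
  have hB : s * a ≤ B := hS c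
  have hB0 : 0 < B := lt_of_lt_of_le (mul_pos hs ha) hB
  have hd12 : d ≤ 1 / 2 := by linarith
  set x := d / s
  have hx0 : 0 ≤ x := div_nonneg hd0 hs.le
  have hx : x ≤ 1 / 2 := by rw [div_le_iff₀ hs]; linarith
  have hda : d * a ≤ x * B := by
    calc d * a = x * (s * a) := by simp only [x]; field_simp
      _ ≤ _ := mul_le_mul_of_nonneg_left hB hx0
  have hgS : g ⬝ᵥ (S *ᵥ c) = B ^ 2 := by
    rw [qnorm_sq hG.posSemidef, form_projection hG]
  have hghS : gh ⬝ᵥ (Sh *ᵥ c) = Bh ^ 2 := by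
    rw [qnorm_sq hGh.posSemidef, form_projection hGh]
  have hBh0 : 0 ≤ Bh := qnorm_nonneg _ _
  have hah0 : 0 ≤ ah := qnorm_nonneg _ _
  set r := √(1 + d)
  set t := √(1 - d)
  have hr : r ^ 2 = 1 + d := Real.sq_sqrt (by linarith)
  have ht : t ^ 2 = 1 - d := Real.sq_sqrt (by linarith)
  have hr0 : 0 < r := Real.sqrt_pos.2 (by linarith)
  have ht0 : 0 < t := Real.sqrt_pos.2 (by linarith)
  -- lower bound for the empirical denominator
  have l1 : B * (1 - x) ≤ r * Bh := by
    have e1 := abs_le.1 (h2 g c)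
    have e2 := abs_le.1 (h1 g g)
    have e3 : g ⬝ᵥ (Sh *ᵥ c) ≤ qnorm Gh g * Bh := by
      rw [← form_projection hGh]
      exact (le_abs_self _).trans (abs_form_le_qnorm_mul_qnorm hGh.posSemidef _ _)
    have e4 : qnorm Gh g ≤ r * B := by
      refine abs_le_of_sq_le_sq' ?_ (by positivity) |>.2
      rw [qnorm_sq hGh.posSemidef, mul_pow, hr]
      have := qnorm_sq hG.posSemidef g
      change B ^ 2 = _ at this
      change _ ≤ _ * B ^ 2
      nlinarith
    have e5 : qnorm Gh g * Bh ≤ r * B * Bh := mul_le_mul_of_nonneg_right e4 hBh0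
    rw [hgS] at e1
    have e6 : d * B * a ≤ x * B * B := by nlinarith
    have e7 : B * (B * (1 - x)) ≤ B * (r * Bh) := by
      have : d * qnorm G g * qnorm H c = d * B * a := rfl
      nlinarith
    exact le_of_mul_le_mul_left e7 hB0
  have hBhpos : 0 < Bh := by
    have : 0 < B * (1 - x) := mul_pos hB0 (by linarith)
    exact pos_of_mul_pos_right (lt_of_lt_of_le this l1) hr0.le
  -- The norm of a projection is the largest pairing with a unit vector. The lower bound paired Ŝc
  -- with the population projection g; here Sc is paired with the empirical projection.
  have l2 : t * Bh ≤ B * (1 + x) := by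
    have e1 := abs_le.1 (h2 gh c)
    have e2 := abs_le.1 (h1 gh gh)
    have e3 : gh ⬝ᵥ (S *ᵥ c) ≤ qnorm G gh * B := by
      rw [← form_projection hG]
      exact (le_abs_self _).trans (abs_form_le_qnorm_mul_qnorm hG.posSemidef _ _)
    have e4 : t * qnorm G gh ≤ Bh := by
      refine abs_le_of_sq_le_sq' ?_ hBh0 |>.2
      have e5 : Bh ^ 2 = gh ⬝ᵥ (Gh *ᵥ gh) := qnorm_sq hGh.posSemidef gh
      rw [e5, mul_pow, ht]
      have := qnorm_sq hG.posSemidef gh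
      nlinarith
    rw [hghS] at e1
    have hq0 := qnorm_nonneg G gh
    have e6 : Bh ^ 2 ≤ qnorm G gh * (B * (1 + x)) := by
      have : d * qnorm G gh * qnorm H c ≤ qnorm G gh * (x * B) := by
        calc _ = qnorm G gh * (d * a) := by ring
          _ ≤ _ := mul_le_mul_of_nonneg_left hda hq0
      nlinarith
    have e7 : Bh * (t * Bh) ≤ Bh * (B * (1 + x)) := by
      have hBx : 0 ≤ B * (1 + x) := by positivity
      nlinarith [mul_le_mul_of_nonneg_left e6 ht0.le, mul_le_mul_of_nonneg_right e4 hBx]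
    exact le_of_mul_le_mul_left e7 hBhpos
  have e3 := abs_le.1 (h3 c c)
  have ea : a ^ 2 = c ⬝ᵥ (H *ᵥ c) := qnorm_sq hH.posSemidef c
  have eah : ah ^ 2 = c ⬝ᵥ (Hh *ᵥ c) := qnorm_sq hHh c
  have u1 : t * a ≤ ah := by
    refine abs_le_of_sq_le_sq' ?_ hah0 |>.2
    rw [mul_pow, ht, eah]; nlinarith
  have u2 : ah ≤ r * a := by
    refine abs_le_of_sq_le_sq' ?_ (by positivity) |>.2
    rw [mul_pow, hr, eah]; nlinarith
  have hx1 : 0 < 1 - x := by linarith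
  constructor
  · rw [div_mul_div_comm, div_le_div_iff₀ (by positivity) hBhpos]
    calc (1 - d) * a * Bh = (t * a) * (t * Bh) := by rw [← ht]; ring
      _ ≤ ah * (B * (1 + x)) := mul_le_mul u1 l2 (by positivity) hah0
      _ = _ := by ring
  · rw [div_mul_div_comm, div_le_div_iff₀ hBhpos (by positivity)]
    calc ah * ((1 - x) * B) = ah * (B * (1 - x)) := by ring
      _ ≤ (r * a) * (r * Bh) := mul_le_mul u2 l1 (by positivity) (by positivity)
      _ = _ := by rw [← hr]; ring

end Saddle

/-! ### Smallest eigenvalues -/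

section LambdaMin

variable {m : ℕ} {A B : Matrix (Fin m) (Fin m) ℝ}

/-- Positive dimension matters: otherwise the spectrum is empty and its infimum is the default 0. -/
theorem lambdaMin_attained (hm : 0 < m) (hA : A.IsHermitian) :
    ∃ x : Fin m → ℝ, x ⬝ᵥ x = 1 ∧ NPIV.lambdaMin A = x ⬝ᵥ (A *ᵥ x) := by
  have : Nonempty (Fin m) := ⟨⟨0, hm⟩⟩
  have h : NPIV.lambdaMin A ∈ Set.range hA.eigenvalues := by
    rw [NPIV.lambdaMin, hA.spectrum_real_eq_range_eigenvalues]
    exact (Set.range_nonempty _).csInf_mem (Set.finite_range _)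
  obtain ⟨i, hi⟩ := h
  obtain ⟨x, hx1, hx2⟩ := hA.exists_eigenvalue_form i
  exact ⟨x, hx1, by rw [← hi, hx2]⟩

theorem lambdaMin_mul_le (hA : A.IsHermitian) (x : Fin m → ℝ) :
    NPIV.lambdaMin A * (x ⬝ᵥ x) ≤ x ⬝ᵥ (A *ᵥ x) := by
  set T := NPIV.lambdaMin A
  have hl : ∀ i, T ≤ hA.eigenvalues i := fun i => by
    simp only [T]
    rw [NPIV.lambdaMin, hA.spectrum_real_eq_range_eigenvalues]
    exact csInf_le (Set.finite_range _).bddBelow ⟨i, rfl⟩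
  set U := (hA.eigenvectorUnitary : Matrix (Fin m) (Fin m) ℝ)
  have hU : U * Uᴴ = 1 := Unitary.coe_mul_star_self _
  have hp : (A - T • (1 : Matrix (Fin m) (Fin m) ℝ)).PosSemidef := by
    have : A - T • (1 : Matrix (Fin m) (Fin m) ℝ) =
        U * diagonal (fun i => hA.eigenvalues i - T) * Uᴴ := by
      conv_lhs => enter [1]; rw [hA.eq_conj_diagonal]
      rw [← diagonal_sub, Matrix.mul_sub, Matrix.sub_mul]
      congr 1
      rw [← smul_one_eq_diagonal, Matrix.mul_smul, Matrix.mul_one, Matrix.smul_mul, hU]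
    rw [this]
    exact (PosSemidef.diagonal fun i => sub_nonneg.2 (hl i)).mul_mul_conjTranspose_same _
  have := hp.form_nonneg x
  simp only [Matrix.sub_mulVec, Matrix.smul_mulVec, one_mulVec, dotProduct_sub, dotProduct_smul,
    smul_eq_mul] at this
  linarith

theorem lambdaMin_pos (hm : 0 < m) (hA : A.PosDef) : 0 < NPIV.lambdaMin A := by
  obtain ⟨x, hx1, hx2⟩ := lambdaMin_attained hm hA.1
  have hx : x ≠ 0 := by rintro rfl; simp at hx1
  rw [hx2]
  simpa using hA.dotProduct_mulVec_pos hx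

/-- The unit minimizer of either quadratic form is a competitor for the other. -/
theorem lambdaMin_bounds (hm : 0 < m) (hA : A.PosDef) (hB : B.IsHermitian) {d : ℝ}
    (hd1 : d ≤ 1)
    (h : ∀ c e, |c ⬝ᵥ (B *ᵥ e) - c ⬝ᵥ (A *ᵥ e)| ≤ d * qnorm A c * qnorm A e) :
    (1 - d) * NPIV.lambdaMin A ≤ NPIV.lambdaMin B ∧
      NPIV.lambdaMin B ≤ (1 + d) * NPIV.lambdaMin A := by
  obtain ⟨x, hx1, hx2⟩ := lambdaMin_attained hm hA.1
  obtain ⟨y, hy1, hy2⟩ := lambdaMin_attained hm hB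
  have a1 := abs_le.1 (h x x)
  have a2 := abs_le.1 (h y y)
  have a3 := lambdaMin_mul_le hA.1 y
  have a4 := lambdaMin_mul_le hB x
  rw [hx1] at a4
  rw [hy1] at a3
  have a5 := qnorm_sq hA.posSemidef x
  have a6 := qnorm_sq hA.posSemidef y
  constructor <;> nlinarith

end LambdaMin

/-! ### Population facts of the sieve model -/

namespace NPIV

theorem HasBoundedDensityOn.ae_mem {Ω : Type*} [MeasurableSpace Ω] {μ : Measure Ω} {m : ℕ}
    {Z : Ω → Fin m → ℝ} (hZ : Measurable Z) {lo hi : Fin m → ℝ}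
    (h : HasBoundedDensityOn (μ.map Z) lo hi) : ∀ᵐ ω ∂μ, Z ω ∈ Set.Icc lo hi := by
  obtain ⟨_, f, c, C, _, _, _, hP⟩ := h
  have h1 : ∀ᵐ x ∂(μ.map Z), x ∈ Set.Icc lo hi := by
    rw [hP]
    exact (withDensity_absolutelyContinuous _ _).ae_le (ae_restrict_mem measurableSet_Icc)
  exact ae_of_ae_map hZ.aemeasurable h1

namespace Model

variable {Ω : Type*} [MeasurableSpace Ω] {d dw : ℕ} (M : Model Ω d dw)

/-- The element `b^K(·)'p` of the instrument space. -/
def instFun (K : ℕ) (p : Fin K → ℝ) (w : Fin dw → ℝ) : ℝ := ∑ k, M.b K k w * p k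

/-- Measurable and bounded on the support of the regressor. -/
def BddX (f : (Fin d → ℝ) → ℝ) : Prop := Measurable f ∧ ∃ C : ℝ, ∀ x ∈ M.suppX, |f x| ≤ C

/-- Measurable and bounded on the support of the instrument. -/
def BddW (f : (Fin dw → ℝ) → ℝ) : Prop := Measurable f ∧ ∃ C : ℝ, ∀ x ∈ M.suppW, |f x| ≤ C

/-- The vector of moments `E[b^K(W) f(X)]`. -/
def moment (K : ℕ) (f : (Fin d → ℝ) → ℝ) : Fin K → ℝ :=
  fun l => ∫ ω, M.b K l (M.W 0 ω) * f (M.X 0 ω) ∂M.μ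

variable {M} {H : Set ((Fin d → ℝ) → ℝ)}

theorem BddX.sub {f g : (Fin d → ℝ) → ℝ} (hf : M.BddX f) (hg : M.BddX g) :
    M.BddX fun x => f x - g x := by
  obtain ⟨hf, C, hC⟩ := hf
  obtain ⟨hg, D, hD⟩ := hg
  exact ⟨hf.sub hg, C + D, fun x hx => (abs_sub _ _).trans (add_le_add (hC x hx) (hD x hx))⟩

theorem IsSieve.bddX_sieveFun (hv : M.IsSieve) {J : ℕ} (hJ : J ∈ M.Js) (c : Fin J → ℝ) :
    M.BddX (M.sieveFun J c) := by
  refine ⟨Finset.measurable_sum _ fun k _ => (hv.measurable_psi J hJ k).mul_const _, ?_⟩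
  choose C hC using hv.bounded_psi J hJ
  refine ⟨∑ k, C k * |c k|, fun x hx => (Finset.abs_sum_le_sum_abs _ _).trans ?_⟩
  refine Finset.sum_le_sum fun k _ => ?_
  rw [abs_mul]
  exact mul_le_mul_of_nonneg_right (hC k x hx) (abs_nonneg _)

theorem IsSieve.bddW_instFun (hv : M.IsSieve) {J : ℕ} (hJ : J ∈ M.Js) (p : Fin (M.K J) → ℝ) :
    M.BddW (M.instFun (M.K J) p) := by
  refine ⟨Finset.measurable_sum _ fun k _ => (hv.measurable_b J hJ k).mul_const _, ?_⟩
  choose C hC using hv.bounded_b J hJ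
  refine ⟨∑ k, C k * |p k|, fun x hx => (Finset.abs_sum_le_sum_abs _ _).trans ?_⟩
  refine Finset.sum_le_sum fun k _ => ?_
  rw [abs_mul]
  exact mul_le_mul_of_nonneg_right (hC k x hx) (abs_nonneg _)

theorem DataAssumption.bddX_h0 (hd : M.DataAssumption H) : M.BddX M.h0 :=
  hd.bounded _ hd.h0_mem

theorem ae_memX (hs : M.IsSample) (hd : M.DataAssumption H) :
    ∀ᵐ ω ∂M.μ, M.X 0 ω ∈ M.suppX := hd.density_X.ae_mem (hs.measurable_X 0)

theorem ae_memW (hs : M.IsSample) (hd : M.DataAssumption H) :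
    ∀ᵐ ω ∂M.μ, M.W 0 ω ∈ M.suppW := hd.density_W.ae_mem (hs.measurable_W 0)

theorem BddX.ae_bdd (hs : M.IsSample) (hd : M.DataAssumption H) {f : (Fin d → ℝ) → ℝ}
    (hf : M.BddX f) : Measurable (fun ω => f (M.X 0 ω)) ∧
      ∃ C : ℝ, 0 ≤ C ∧ ∀ᵐ ω ∂M.μ, |f (M.X 0 ω)| ≤ C := by
  obtain ⟨hf, C, hC⟩ := hf
  refine ⟨hf.comp (hs.measurable_X 0), |C|, abs_nonneg _, ?_⟩
  filter_upwards [ae_memX hs hd] with ω h using (hC _ h).trans (le_abs_self _)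

theorem BddW.ae_bdd (hs : M.IsSample) (hd : M.DataAssumption H) {f : (Fin dw → ℝ) → ℝ}
    (hf : M.BddW f) : Measurable (fun ω => f (M.W 0 ω)) ∧
      ∃ C : ℝ, 0 ≤ C ∧ ∀ᵐ ω ∂M.μ, |f (M.W 0 ω)| ≤ C := by
  obtain ⟨hf, C, hC⟩ := hf
  refine ⟨hf.comp (hs.measurable_W 0), |C|, abs_nonneg _, ?_⟩
  filter_upwards [ae_memW hs hd] with ω h using (hC _ h).trans (le_abs_self _)

theorem _root_.MeasureTheory.integrable_of_ae_abs_le {μ : Measure Ω} [IsFiniteMeasure μ]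
    {f : Ω → ℝ} (hf : AEStronglyMeasurable f μ) {C : ℝ} (h : ∀ᵐ ω ∂μ, |f ω| ≤ C) :
    Integrable f μ := Integrable.of_bound hf C (by simpa using h)

theorem integrable_mul_of_ae_bdd {μ : Measure Ω} [IsFiniteMeasure μ] {f g : Ω → ℝ}
    (hf : AEStronglyMeasurable f μ) (hg : AEStronglyMeasurable g μ) {C D : ℝ} (hC : 0 ≤ C)
    (h : ∀ᵐ ω ∂μ, |f ω| ≤ C) (h' : ∀ᵐ ω ∂μ, |g ω| ≤ D) :
    Integrable (fun ω => f ω * g ω) μ := by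
  refine integrable_of_ae_abs_le (hf.mul hg : AEStronglyMeasurable (fun ω => f ω * g ω) μ) (C := C * D) ?_
  filter_upwards [h, h'] with ω h1 h2
  rw [abs_mul]
  exact mul_le_mul h1 h2 (abs_nonneg _) hC

theorem integral_sub_sq {μ : Measure Ω} {f g : Ω → ℝ} (hf : Integrable (fun ω => f ω * f ω) μ)
    (hgf : Integrable (fun ω => g ω * f ω) μ) (hg : Integrable (fun ω => g ω * g ω) μ) :
    ∫ ω, (f ω - g ω) ^ 2 ∂μ =
      ∫ ω, f ω * f ω ∂μ - 2 * ∫ ω, g ω * f ω ∂μ + ∫ ω, g ω * g ω ∂μ := by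
  have h1 := integral_sub hf (hgf.const_mul 2)
  have h2 := integral_add (hf.sub (hgf.const_mul 2)) hg
  simp only [Pi.sub_apply] at h2
  rw [integral_const_mul] at h1
  rw [← h1, ← h2]
  congr 1; ext ω; ring

section Basic

variable (hs : M.IsSample) (hd : M.DataAssumption H)
include hs hd

theorem integrable_X {f : (Fin d → ℝ) → ℝ} (hf : M.BddX f) :
    Integrable (fun ω => f (M.X 0 ω)) M.μ := by
  have := hs.prob
  obtain ⟨h1, C, _, h2⟩ := hf.ae_bdd hs hd
  exact integrable_of_ae_abs_le h1.aestronglyMeasurable h2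

theorem integrable_XX {f g : (Fin d → ℝ) → ℝ} (hf : M.BddX f) (hg : M.BddX g) :
    Integrable (fun ω => f (M.X 0 ω) * g (M.X 0 ω)) M.μ := by
  have := hs.prob
  obtain ⟨h1, C, h0, h2⟩ := hf.ae_bdd hs hd
  obtain ⟨h3, D, _, h4⟩ := hg.ae_bdd hs hd
  exact integrable_mul_of_ae_bdd h1.aestronglyMeasurable h3.aestronglyMeasurable h0 h2 h4

theorem integrable_WX {f : (Fin dw → ℝ) → ℝ} {g : (Fin d → ℝ) → ℝ} (hf : M.BddW f)
    (hg : M.BddX g) : Integrable (fun ω => f (M.W 0 ω) * g (M.X 0 ω)) M.μ := by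
  have := hs.prob
  obtain ⟨h1, C, h0, h2⟩ := hf.ae_bdd hs hd
  obtain ⟨h3, D, _, h4⟩ := hg.ae_bdd hs hd
  exact integrable_mul_of_ae_bdd h1.aestronglyMeasurable h3.aestronglyMeasurable h0 h2 h4

theorem integrable_WW {f g : (Fin dw → ℝ) → ℝ} (hf : M.BddW f) (hg : M.BddW g) :
    Integrable (fun ω => f (M.W 0 ω) * g (M.W 0 ω)) M.μ := by
  have := hs.prob
  obtain ⟨h1, C, h0, h2⟩ := hf.ae_bdd hs hd
  obtain ⟨h3, D, _, h4⟩ := hg.ae_bdd hs hd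
  exact integrable_mul_of_ae_bdd h1.aestronglyMeasurable h3.aestronglyMeasurable h0 h2 h4

/-! #### The conditional expectation operator -/

theorem T_bdd {f : (Fin d → ℝ) → ℝ} (hf : M.BddX f) :
    ∃ C : ℝ, 0 ≤ C ∧ ∀ᵐ ω ∂M.μ, |M.T f ω| ≤ C := by
  have := hs.prob
  obtain ⟨_, C, h0, h2⟩ := hf.ae_bdd hs hd
  exact ⟨C, h0, ae_bdd_abs_condExp_of_ae_bdd_abs h2⟩

theorem integral_mul_T {f : (Fin d → ℝ) → ℝ} (hf : M.BddX f) {g : Ω → ℝ}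
    (hg : StronglyMeasurable[M.sigmaW] g) {C : ℝ} (hC : 0 ≤ C) (hgC : ∀ᵐ ω ∂M.μ, |g ω| ≤ C) :
    ∫ ω, g ω * M.T f ω ∂M.μ = ∫ ω, g ω * f (M.X 0 ω) ∂M.μ := by
  have := hs.prob
  have hle : M.sigmaW ≤ ‹MeasurableSpace Ω› := (hs.measurable_W 0).comap_le
  obtain ⟨h1, D, _, h2⟩ := hf.ae_bdd hs hd
  have hi : Integrable (g * fun ω => f (M.X 0 ω)) M.μ :=
    integrable_mul_of_ae_bdd (hg.mono hle).aestronglyMeasurable h1.aestronglyMeasurable hC hgC h2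
  have h := condExp_mul_of_stronglyMeasurable_left hg hi (integrable_X hs hd hf)
  calc _ = ∫ ω, (M.μ[g * fun ω => f (M.X 0 ω)|M.sigmaW]) ω ∂M.μ :=
        integral_congr_ae (h.symm)
    _ = _ := integral_condExp hle

theorem integrable_T_mul {f g : (Fin d → ℝ) → ℝ} (hf : M.BddX f) (hg : M.BddX g) :
    Integrable (fun ω => M.T f ω * M.T g ω) M.μ := by
  have := hs.prob
  obtain ⟨C, hC, h1⟩ := T_bdd hs hd hf
  obtain ⟨D, _, h2⟩ := T_bdd hs hd hg
  exact integrable_mul_of_ae_bdd integrable_condExp.1 integrable_condExp.1 hC h1 h2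

/-- The difference of the squared norms is E(f − Tf)², since Tf is orthogonal to f − Tf. This is
what gives τ ≥ 1. -/
theorem normW_T_le {f : (Fin d → ℝ) → ℝ} (hf : M.BddX f) : M.normW (M.T f) ≤ M.normX f := by
  have := hs.prob
  refine Real.sqrt_le_sqrt ?_
  obtain ⟨C, hC, h1⟩ := T_bdd hs hd hf
  obtain ⟨hm, D, _, h2⟩ := hf.ae_bdd hs hd
  have e := integral_mul_T hs hd hf (stronglyMeasurable_condExp (f := fun ω => f (M.X 0 ω))
    (m := M.sigmaW) (μ := M.μ)) hC h1
  have i1 := integrable_T_mul hs hd hf hf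
  have i2 := integrable_XX hs hd hf hf
  have i3 : Integrable (fun ω => M.T f ω * f (M.X 0 ω)) M.μ :=
    integrable_mul_of_ae_bdd integrable_condExp.1 hm.aestronglyMeasurable hC h1 h2
  have hnn : 0 ≤ ∫ ω, (f (M.X 0 ω) - M.T f ω) ^ 2 ∂M.μ := integral_nonneg fun ω => sq_nonneg _
  have hex := integral_sub_sq i2 i3 i1
  change ∫ ω, M.T f ω * M.T f ω ∂M.μ = ∫ ω, M.T f ω * f (M.X 0 ω) ∂M.μ at e
  simp only [sq] at *
  linarith

end Basic

section Gram

variable (hv : M.IsSieve) {J : ℕ} (hJ : J ∈ M.Js)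
include hv hJ

theorem bddW_b (k : Fin (M.K J)) : M.BddW (M.b (M.K J) k) :=
  ⟨hv.measurable_b J hJ k, hv.bounded_b J hJ k⟩

theorem bddX_psi (k : Fin J) : M.BddX (M.psi J k) :=
  ⟨hv.measurable_psi J hJ k, hv.bounded_psi J hJ k⟩

theorem stronglyMeasurable_instFun (p : Fin (M.K J) → ℝ) :
    StronglyMeasurable[M.sigmaW] fun ω => M.instFun (M.K J) p (M.W 0 ω) :=
  ((hv.bddW_instFun hJ p).1.comp (comap_measurable (M.W 0))).stronglyMeasurable

variable (hs : M.IsSample) (hd : M.DataAssumption H)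
include hs hd

theorem form_Gpsi (c e : Fin J → ℝ) :
    c ⬝ᵥ (M.Gpsi J *ᵥ e) = ∫ ω, M.sieveFun J c (M.X 0 ω) * M.sieveFun J e (M.X 0 ω) ∂M.μ := by
  have hi : ∀ k l, Integrable (fun ω => M.psi J k (M.X 0 ω) * M.psi J l (M.X 0 ω)) M.μ :=
    fun k l => integrable_XX hs hd (bddX_psi hv hJ k) (bddX_psi hv hJ l)
  have : (fun ω => M.sieveFun J c (M.X 0 ω) * M.sieveFun J e (M.X 0 ω)) = fun ω =>
      ∑ k, ∑ l, c k * (M.psi J k (M.X 0 ω) * M.psi J l (M.X 0 ω) * e l) := by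
    ext ω
    simp only [sieveFun, Finset.sum_mul_sum]
    exact Finset.sum_congr rfl fun k _ => Finset.sum_congr rfl fun l _ => by ring
  rw [this, integral_finsetSum _ fun k _ => integrable_finsetSum _ fun l _ =>
    ((hi k l).mul_const _).const_mul _]
  simp only [dotProduct, mulVec, Gpsi, of_apply]
  refine Finset.sum_congr rfl fun k _ => ?_
  rw [integral_finsetSum _ fun l _ => ((hi k l).mul_const _).const_mul _, Finset.mul_sum]
  refine Finset.sum_congr rfl fun l _ => ?_
  rw [integral_const_mul, integral_mul_const]

theorem form_Gb (p q : Fin (M.K J) → ℝ) :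
    p ⬝ᵥ (M.Gb (M.K J) *ᵥ q) =
      ∫ ω, M.instFun (M.K J) p (M.W 0 ω) * M.instFun (M.K J) q (M.W 0 ω) ∂M.μ := by
  have hi : ∀ k l, Integrable (fun ω => M.b (M.K J) k (M.W 0 ω) * M.b (M.K J) l (M.W 0 ω)) M.μ :=
    fun k l => integrable_WW hs hd (bddW_b hv hJ k) (bddW_b hv hJ l)
  have : (fun ω => M.instFun (M.K J) p (M.W 0 ω) * M.instFun (M.K J) q (M.W 0 ω)) = fun ω =>
      ∑ k, ∑ l, p k * (M.b (M.K J) k (M.W 0 ω) * M.b (M.K J) l (M.W 0 ω) * q l) := by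
    ext ω
    simp only [instFun, Finset.sum_mul_sum]
    exact Finset.sum_congr rfl fun k _ => Finset.sum_congr rfl fun l _ => by ring
  rw [this, integral_finsetSum _ fun k _ => integrable_finsetSum _ fun l _ =>
    ((hi k l).mul_const _).const_mul _]
  simp only [dotProduct, mulVec, Gb, of_apply]
  refine Finset.sum_congr rfl fun k _ => ?_
  rw [integral_finsetSum _ fun l _ => ((hi k l).mul_const _).const_mul _, Finset.mul_sum]
  refine Finset.sum_congr rfl fun l _ => ?_
  rw [integral_const_mul, integral_mul_const]

theorem dotProduct_moment (p : Fin (M.K J) → ℝ) {f : (Fin d → ℝ) → ℝ} (hf : M.BddX f) :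
    p ⬝ᵥ M.moment (M.K J) f = ∫ ω, M.instFun (M.K J) p (M.W 0 ω) * f (M.X 0 ω) ∂M.μ := by
  simp only [instFun, Finset.sum_mul, moment, dotProduct]
  rw [integral_finsetSum]
  · refine Finset.sum_congr rfl fun k _ => ?_
    rw [← integral_const_mul]
    congr 1; ext ω; ring
  · intro k _
    have := (integrable_WX hs hd (bddW_b hv hJ k) hf).const_mul (p k)
    refine this.congr (Eventually.of_forall fun ω => ?_)
    change p k * (M.b (M.K J) k (M.W 0 ω) * f (M.X 0 ω)) = _
    ring

theorem S_mulVec (c : Fin J → ℝ) : M.S J *ᵥ c = M.moment (M.K J) (M.sieveFun J c) := by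
  ext l
  have hi : ∀ k, Integrable (fun ω => M.b (M.K J) l (M.W 0 ω) * M.psi J k (M.X 0 ω)) M.μ :=
    fun k => integrable_WX hs hd (bddW_b hv hJ l) (bddX_psi hv hJ k)
  simp only [mulVec, dotProduct, S, of_apply, moment, sieveFun, Finset.mul_sum]
  have : (fun ω => ∑ k, M.b (M.K J) l (M.W 0 ω) * (M.psi J k (M.X 0 ω) * c k)) = fun ω =>
      ∑ k, M.b (M.K J) l (M.W 0 ω) * M.psi J k (M.X 0 ω) * c k := by
    ext ω; exact Finset.sum_congr rfl fun k _ => by ring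
  rw [this, integral_finsetSum _ fun k _ => (hi k).mul_const _]
  exact Finset.sum_congr rfl fun k _ => (integral_mul_const _ _).symm

theorem qnorm_Gpsi (c : Fin J → ℝ) : qnorm (M.Gpsi J) c = M.normX (M.sieveFun J c) := by
  rw [qnorm, form_Gpsi hv hJ hs hd, normX]
  simp only [sq]

theorem integral_instFun_mul_T (p : Fin (M.K J) → ℝ) {f : (Fin d → ℝ) → ℝ} (hf : M.BddX f) :
    ∫ ω, M.instFun (M.K J) p (M.W 0 ω) * M.T f ω ∂M.μ = p ⬝ᵥ M.moment (M.K J) f := by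
  obtain ⟨_, C, hC, h1⟩ := (hv.bddW_instFun hJ p).ae_bdd hs hd
  rw [dotProduct_moment hv hJ hs hd p hf]
  exact integral_mul_T hs hd hf (stronglyMeasurable_instFun hv hJ p) hC h1

theorem projB_T {f : (Fin d → ℝ) → ℝ} (hf : M.BddX f) (ω : Ω) :
    M.projB (M.K J) (M.T f) ω =
      M.instFun (M.K J) ((M.Gb (M.K J))⁻¹ *ᵥ M.moment (M.K J) f) (M.W 0 ω) := by
  have : (fun l => ∫ ω', M.b (M.K J) l (M.W 0 ω') * M.T f ω' ∂M.μ) = M.moment (M.K J) f := by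
    ext l
    have := integral_instFun_mul_T hv hJ hs hd (Pi.single l 1) hf
    have e : ∀ w, M.instFun (M.K J) (Pi.single l 1) w = M.b (M.K J) l w := fun w => by
      simp [instFun, Pi.single_apply]
    simpa only [e, single_one_dotProduct] using this
  simp only [projB, instFun, this]

/-- Pythagoras for the projection of `T f` onto the instrument space. -/
theorem normW_T_sq {f : (Fin d → ℝ) → ℝ} (hf : M.BddX f) :
    M.normW (M.T f) ^ 2 =
      qnorm (M.Gb (M.K J)) ((M.Gb (M.K J))⁻¹ *ᵥ M.moment (M.K J) f) ^ 2 +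
      M.normW (fun ω => M.projB (M.K J) (M.T f) ω - M.T f ω) ^ 2 := by
  have := hs.prob
  have hG := hv.posDef_b J hJ
  set π := (M.Gb (M.K J))⁻¹ *ᵥ M.moment (M.K J) f
  have hGπ : M.Gb (M.K J) *ᵥ π = M.moment (M.K J) f := by
    rw [mulVec_mulVec, mul_nonsing_inv _ ((isUnit_iff_isUnit_det _).1 hG.isUnit), one_mulVec]
  have hπ := hv.bddW_instFun hJ π
  obtain ⟨hm, C, hC, h1⟩ := hπ.ae_bdd hs hd
  obtain ⟨D, _, h2⟩ := T_bdd hs hd hf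
  have i1 := integrable_WW hs hd hπ hπ
  have i2 := integrable_T_mul hs hd hf hf
  have i3 : Integrable (fun ω => M.instFun (M.K J) π (M.W 0 ω) * M.T f ω) M.μ :=
    integrable_mul_of_ae_bdd hm.aestronglyMeasurable integrable_condExp.1 hC h1 h2
  have e1 := form_Gb hv hJ hs hd π π
  have e2 := integral_instFun_mul_T hv hJ hs hd π hf
  rw [hGπ] at e1
  rw [qnorm_sq hG.posSemidef, hGπ]
  simp only [normW]
  rw [Real.sq_sqrt (integral_nonneg fun ω => sq_nonneg _),
    Real.sq_sqrt (integral_nonneg fun ω => sq_nonneg _)]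
  have hex : ∫ ω, (M.projB (M.K J) (M.T f) ω - M.T f ω) ^ 2 ∂M.μ =
      ∫ ω, M.instFun (M.K J) π (M.W 0 ω) * M.instFun (M.K J) π (M.W 0 ω) ∂M.μ -
      2 * ∫ ω, M.instFun (M.K J) π (M.W 0 ω) * M.T f ω ∂M.μ + ∫ ω, M.T f ω * M.T f ω ∂M.μ := by
    simp only [projB_T hv hJ hs hd hf]
    rw [integral_sub_sq i1 (i3.congr (Eventually.of_forall fun ω => mul_comm _ _)) i2]
    simp only [mul_comm (M.T f _)]
  rw [hex, e2, ← e1]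
  simp only [sq]
  ring

theorem qnorm_proj_le {f : (Fin d → ℝ) → ℝ} (hf : M.BddX f) :
    qnorm (M.Gb (M.K J)) ((M.Gb (M.K J))⁻¹ *ᵥ M.moment (M.K J) f) ≤ M.normW (M.T f) := by
  have h := normW_T_sq hv hJ hs hd hf
  have h0 : 0 ≤ M.normW (M.T f) := Real.sqrt_nonneg _
  refine abs_le_of_sq_le_sq' ?_ h0 |>.2
  nlinarith [sq_nonneg (M.normW (fun ω => M.projB (M.K J) (M.T f) ω - M.T f ω))]

theorem normW_T_le_add {f : (Fin d → ℝ) → ℝ} (hf : M.BddX f) :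
    M.normW (M.T f) ≤ qnorm (M.Gb (M.K J)) ((M.Gb (M.K J))⁻¹ *ᵥ M.moment (M.K J) f) +
      M.normW (fun ω => M.projB (M.K J) (M.T f) ω - M.T f ω) := by
  have h := normW_T_sq hv hJ hs hd hf
  have h1 : 0 ≤ M.normW (fun ω => M.projB (M.K J) (M.T f) ω - M.T f ω) := Real.sqrt_nonneg _
  have h2 := qnorm_nonneg (M.Gb (M.K J)) ((M.Gb (M.K J))⁻¹ *ᵥ M.moment (M.K J) f)
  refine abs_le_of_sq_le_sq' ?_ (by positivity) |>.2
  nlinarith [mul_nonneg h1 h2]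

end Gram

end Model

end NPIV

/-! ### Dual norms of Gram matrices -/

section DualNorm

/-- A real supremum over an unbounded range is 0 by default, so the suprema ζ bound their members
only once boundedness is known. -/
theorem bddAbove_range_sqrt_form {κ : Type*} [Fintype κ] {X : Type*} (B : Matrix κ κ ℝ) {y : X → κ → ℝ}
    (hy : ∀ k, ∃ C : ℝ, ∀ x, |y x k| ≤ C) :
    BddAbove (Set.range fun x => √(y x ⬝ᵥ (B *ᵥ y x))) := by
  choose C hC using hy
  refine ⟨√(∑ k, C k * ∑ l, |B k l| * C l), ?_⟩
  rintro _ ⟨x, rfl⟩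
  refine Real.sqrt_le_sqrt ?_
  simp only [dotProduct, mulVec]
  refine Finset.sum_le_sum fun k _ => (le_abs_self _).trans ?_
  rw [abs_mul]
  have h0 : 0 ≤ C k := (abs_nonneg _).trans (hC k x)
  refine mul_le_mul (hC k x) ((Finset.abs_sum_le_sum_abs _ _).trans ?_) (abs_nonneg _) h0
  refine Finset.sum_le_sum fun l _ => ?_
  rw [abs_mul]
  exact mul_le_mul_of_nonneg_left (hC l x) (abs_nonneg _)

variable {κ ι : Type*} [Fintype κ] [DecidableEq κ] {G : Matrix κ κ ℝ}

theorem Matrix.PosDef.mulVec_inv_mulVec (hG : G.PosDef) (v : κ → ℝ) : G *ᵥ (G⁻¹ *ᵥ v) = v := by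
  rw [mulVec_mulVec, mul_nonsing_inv _ ((isUnit_iff_isUnit_det _).1 hG.isUnit), one_mulVec]

theorem Matrix.PosDef.inv_mulVec_mulVec (hG : G.PosDef) (v : κ → ℝ) : G⁻¹ *ᵥ (G *ᵥ v) = v := by
  rw [mulVec_mulVec, nonsing_inv_mul _ ((isUnit_iff_isUnit_det _).1 hG.isUnit), one_mulVec]

theorem sqrt_inv_form_eq (hG : G.PosDef) (y : κ → ℝ) :
    √(y ⬝ᵥ (G⁻¹ *ᵥ y)) = qnorm G (G⁻¹ *ᵥ y) := by
  rw [qnorm, hG.mulVec_inv_mulVec, dotProduct_comm]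

theorem abs_dotProduct_le_dual (hG : G.PosDef) (y c : κ → ℝ) :
    |y ⬝ᵥ c| ≤ √(y ⬝ᵥ (G⁻¹ *ᵥ y)) * qnorm G c := by
  have := abs_form_le_qnorm_mul_qnorm hG.posSemidef c (G⁻¹ *ᵥ y)
  rw [hG.mulVec_inv_mulVec, dotProduct_comm, mul_comm] at this
  rwa [sqrt_inv_form_eq hG]

/-- `A A' = G⁻¹` when `A' G A = 1`. -/
theorem sum_sq_eq_inv_form {A : Matrix κ κ ℝ} (hA : Aᵀ * G * A = 1) (y : κ → ℝ) :
    (Aᵀ *ᵥ y) ⬝ᵥ (Aᵀ *ᵥ y) = y ⬝ᵥ (G⁻¹ *ᵥ y) := by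
  have h1 : A * (Aᵀ * G) = 1 := mul_eq_one_comm.1 hA
  have h2 : G⁻¹ = A * Aᵀ := inv_eq_left_inv (by rw [Matrix.mul_assoc, h1])
  rw [h2, dotProduct_mulVec, ← mulVec_transpose, transpose_transpose, mulVec_mulVec, dotProduct_comm]

theorem qnorm_mulVec_of_conj {A : Matrix κ κ ℝ} (hA : Aᵀ * G * A = 1) (x : κ → ℝ) :
    qnorm G (A *ᵥ x) = √(x ⬝ᵥ x) := by
  have : (A *ᵥ x) ⬝ᵥ (G *ᵥ (A *ᵥ x)) = x ⬝ᵥ ((Aᵀ * G * A) *ᵥ x) := by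
    rw [← mulVec_mulVec, ← mulVec_mulVec, dotProduct_mulVec x, ← mulVec_transpose,
      transpose_transpose]
  rw [qnorm, this, hA, one_mulVec]

end DualNorm

section LambdaMinNorm

variable {m : ℕ} {A : Matrix (Fin m) (Fin m) ℝ}

theorem abs_apply_le_qnorm_div (hm : 0 < m) (hA : A.PosDef) (c : Fin m → ℝ) (k : Fin m) :
    |c k| ≤ qnorm A c / √(NPIV.lambdaMin A) := by
  have he := lambdaMin_pos hm hA
  rw [le_div_iff₀ (Real.sqrt_pos.2 he)]
  refine abs_le_of_sq_le_sq' ?_ (qnorm_nonneg _ _) |>.2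
  rw [mul_pow, sq_abs, Real.sq_sqrt he.le, qnorm_sq hA.posSemidef]
  have h1 := lambdaMin_mul_le hA.1 c
  have h2 : c k ^ 2 ≤ c ⬝ᵥ c := by
    simp only [dotProduct, ← sq]
    exact Finset.single_le_sum (f := fun k => c k ^ 2) (fun _ _ => sq_nonneg _) (Finset.mem_univ k)
  nlinarith

/-- With z = A⁻¹y, the squared norm of z is y'z, at most the ℓ¹ norm of y times the largest entry of
z; that entry is at most the norm of z over √λ_min. One factor cancels. -/
theorem sqrt_inv_form_le (hm : 0 < m) (hA : A.PosDef) (y : Fin m → ℝ) :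
    √(y ⬝ᵥ (A⁻¹ *ᵥ y)) ≤ (∑ k, |y k|) / √(NPIV.lambdaMin A) := by
  have he := Real.sqrt_pos.2 (lambdaMin_pos hm hA)
  set z := A⁻¹ *ᵥ y
  have hz : y ⬝ᵥ z = qnorm A z ^ 2 := by
    rw [qnorm_sq hA.posSemidef, hA.mulVec_inv_mulVec, dotProduct_comm]
  rw [hz, Real.sqrt_sq (qnorm_nonneg _ _)]
  have h1 : y ⬝ᵥ z ≤ (∑ k, |y k|) * (qnorm A z / √(NPIV.lambdaMin A)) := by
    rw [Finset.sum_mul]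
    refine Finset.sum_le_sum fun k _ => (le_abs_self _).trans ?_
    rw [abs_mul]
    exact mul_le_mul_of_nonneg_left (abs_apply_le_qnorm_div hm hA z k) (abs_nonneg _)
  rw [hz] at h1
  rcases (qnorm_nonneg A z).eq_or_lt with h0 | h0
  · rw [← h0]
    exact div_nonneg (Finset.sum_nonneg fun _ _ => abs_nonneg _) he.le
  · refine le_of_mul_le_mul_right ?_ h0
    calc _ = qnorm A z ^ 2 := by ring
      _ ≤ _ := h1
      _ = _ := by ring

end LambdaMinNorm

/-! ### Two-stage least squares as a linear map -/

section TwoStage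

variable {κ : Type*} [Fintype κ] [DecidableEq κ] {m : ℕ} {G : Matrix κ κ ℝ}
  {S : Matrix κ (Fin m) ℝ} {H : Matrix (Fin m) (Fin m) ℝ}

theorem posDef_normal (hG : G.PosDef) (hS : ∀ c, S *ᵥ c = 0 → c = 0) :
    (Sᵀ * G⁻¹ * S).PosDef := by
  refine PosDef.of_dotProduct_mulVec_pos ?_ fun c hc => ?_
  · rw [IsHermitian, conjTranspose_eq_transpose_of_trivial, transpose_mul, transpose_mul,
      transpose_transpose]
    have : (G⁻¹)ᵀ = G⁻¹ := by
      rw [← conjTranspose_eq_transpose_of_trivial]; exact hG.inv.1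
    rw [this, Matrix.mul_assoc]
  · have h := hG.inv.dotProduct_mulVec_pos (x := S *ᵥ c) fun h => hc (hS c h)
    simp only [star_trivial] at h ⊢
    rw [Matrix.mul_assoc, ← mulVec_mulVec, ← mulVec_mulVec, dotProduct_mulVec c,
      ← mulVec_transpose, transpose_transpose]
    exact h

/-- The two-stage least squares coefficients `[S'G⁻¹S]⁻¹S'G⁻¹v`. -/
def tslsCoef (G : Matrix κ κ ℝ) (S : Matrix κ (Fin m) ℝ) (v : κ → ℝ) : Fin m → ℝ :=
  (Sᵀ * G⁻¹ * S)⁻¹ *ᵥ ((Sᵀ * G⁻¹) *ᵥ v)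

theorem tslsCoef_add (v v' : κ → ℝ) : tslsCoef G S (v + v') = tslsCoef G S v + tslsCoef G S v' := by
  simp only [tslsCoef, mulVec_add]

theorem tslsCoef_mulVec (hG : G.PosDef) (hS : ∀ c, S *ᵥ c = 0 → c = 0) (c : Fin m → ℝ) :
    tslsCoef G S (S *ᵥ c) = c := by
  rw [tslsCoef, mulVec_mulVec c (Sᵀ * G⁻¹) S, (posDef_normal hG hS).inv_mulVec_mulVec]

/-- The normal equations in saddle point form: the weighted residual G⁻¹(v − Sc) is the multiplier.
In this form sample and population can be compared without inverting a perturbed matrix. -/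
theorem tslsCoef_system (hG : G.PosDef) (hS : ∀ c, S *ᵥ c = 0 → c = 0) (v : κ → ℝ) :
    G *ᵥ (G⁻¹ *ᵥ (v - S *ᵥ tslsCoef G S v)) + S *ᵥ tslsCoef G S v = v ∧
      Sᵀ *ᵥ (G⁻¹ *ᵥ (v - S *ᵥ tslsCoef G S v)) = 0 := by
  refine ⟨by rw [hG.mulVec_inv_mulVec, sub_add_cancel], ?_⟩
  rw [mulVec_mulVec, mulVec_sub, mulVec_mulVec, tslsCoef,
    (posDef_normal hG hS).mulVec_inv_mulVec, sub_self]

/-- The rows of the two-stage least squares matrix, with a bound on their norms. -/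
theorem exists_tslsCoef_row (hm : 0 < m) (hG : G.PosDef) (hH : H.PosDef)
    (hS0 : ∀ c, S *ᵥ c = 0 → c = 0) {s : ℝ} (hs : 0 < s)
    (hS : ∀ c, s * qnorm H c ≤ qnorm G (G⁻¹ *ᵥ (S *ᵥ c))) (k : Fin m) :
    ∃ r : κ → ℝ, (∀ v, tslsCoef G S v k = r ⬝ᵥ v) ∧
      qnorm G r ≤ (s * √(NPIV.lambdaMin H))⁻¹ := by
  have hN := posDef_normal hG hS0
  set N := Sᵀ * G⁻¹ * S
  have he := Real.sqrt_pos.2 (lambdaMin_pos hm hH)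
  set c := N⁻¹ *ᵥ Pi.single k 1
  have hr : ∀ v, (G⁻¹ *ᵥ (S *ᵥ c)) ⬝ᵥ v = tslsCoef G S v k := fun v => by
    have h1 : tslsCoef G S v k = (Pi.single k 1) ⬝ᵥ (N⁻¹ *ᵥ ((Sᵀ * G⁻¹) *ᵥ v)) := by
      rw [single_one_dotProduct]; rfl
    rw [h1, dotProduct_mulVec_symm hN.inv.1, dotProduct_comm (_ *ᵥ v), ← mulVec_mulVec,
      dotProduct_mulVec c, ← mulVec_transpose, transpose_transpose,
      dotProduct_mulVec_symm hG.inv.1, dotProduct_comm]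
  refine ⟨G⁻¹ *ᵥ (S *ᵥ c), fun v => (hr v).symm, ?_⟩
  -- The squared norm Q² of the row is the k-th entry of c, hence at most |c|/√λ_min, which by `hS`
  -- is at most Q/(s√λ_min). One factor Q cancels.
  have h1 : qnorm G (G⁻¹ *ᵥ (S *ᵥ c)) ^ 2 = c k := by
    rw [qnorm_sq hG.posSemidef, hG.mulVec_inv_mulVec, hr, tslsCoef_mulVec hG hS0]
  have h2 := (le_abs_self _).trans (abs_apply_le_qnorm_div hm hH c k)
  have h3 := hS c
  set Q := qnorm G (G⁻¹ *ᵥ (S *ᵥ c))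
  have hQ0 : 0 ≤ Q := qnorm_nonneg _ _
  rcases hQ0.eq_or_lt with h0 | h0
  · rw [← h0]; positivity
  rw [le_inv_comm₀ h0 (by positivity), ← one_div, le_div_iff₀ h0]
  rw [le_div_iff₀ he, ← h1] at h2
  refine le_of_mul_le_mul_right ?_ h0
  calc s * √(NPIV.lambdaMin H) * Q * Q = s * (Q ^ 2 * √(NPIV.lambdaMin H)) := by ring
    _ ≤ s * qnorm H c := mul_le_mul_of_nonneg_left h2 hs.le
    _ ≤ 1 * Q := by rw [one_mul]; exact h3

end TwoStage

/-! ### Sup-norm bounds on the sieve spaces -/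

namespace NPIV.Model

variable {Ω : Type*} [MeasurableSpace Ω] {d dw : ℕ} {M : Model Ω d dw}
  {H : Set ((Fin d → ℝ) → ℝ)}

theorem le_supNorm {f : (Fin d → ℝ) → ℝ} (hf : M.BddX f) {x : Fin d → ℝ} (hx : x ∈ M.suppX) :
    |f x| ≤ M.supNorm f := by
  obtain ⟨_, C, hC⟩ := hf
  exact le_ciSup (f := fun x : M.suppX => |f x|) ⟨C, by rintro _ ⟨y, rfl⟩; exact hC y y.2⟩ ⟨x, hx⟩

theorem supNorm_le {f : (Fin d → ℝ) → ℝ} {C : ℝ} (hC : 0 ≤ C) (h : ∀ x ∈ M.suppX, |f x| ≤ C) :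
    M.supNorm f ≤ C := Real.iSup_le (fun x => h x x.2) hC

theorem supNorm_nonneg (f : (Fin d → ℝ) → ℝ) : 0 ≤ M.supNorm f :=
  Real.iSup_nonneg fun _ => abs_nonneg _

theorem xi_nonneg {J : ℕ} : 0 ≤ M.xi J :=
  Real.iSup_nonneg fun _ => Finset.sum_nonneg fun _ _ => abs_nonneg _

theorem K_pos (hv : M.IsSieve) {J : ℕ} (hJ : J ∈ M.Js) : 0 < M.K J := by
  obtain ⟨CK, _, h⟩ := hv.rule
  exact (hv.pos J hJ).trans (h J).1

section Sieve

variable (hv : M.IsSieve) {J : ℕ} (hJ : J ∈ M.Js)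
include hv hJ

theorem abs_sieveFun_le_zetaPsi (c : Fin J → ℝ) {x : Fin d → ℝ} (hx : x ∈ M.suppX) :
    |M.sieveFun J c x| ≤ M.zetaPsi J * qnorm (M.Gpsi J) c := by
  refine (abs_dotProduct_le_dual (hv.posDef_psi J hJ) (fun k => M.psi J k x) c).trans ?_
  refine mul_le_mul_of_nonneg_right ?_ (qnorm_nonneg _ _)
  refine le_ciSup (f := fun x : M.suppX => √((fun k => M.psi J k x) ⬝ᵥ
    ((M.Gpsi J)⁻¹ *ᵥ fun k => M.psi J k x))) ?_ ⟨x, hx⟩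
  exact bddAbove_range_sqrt_form _ fun k => by
    obtain ⟨C, hC⟩ := hv.bounded_psi J hJ k
    exact ⟨C, fun x => hC x x.2⟩

theorem sqrt_inv_form_psi_le {x : Fin d → ℝ} (hx : x ∈ M.suppX) :
    √((fun k => M.psi J k x) ⬝ᵥ ((M.Gpsi J)⁻¹ *ᵥ fun k => M.psi J k x)) ≤ M.zetaPsi J := by
  refine le_ciSup (f := fun x : M.suppX => √((fun k => M.psi J k x) ⬝ᵥ
    ((M.Gpsi J)⁻¹ *ᵥ fun k => M.psi J k x))) ?_ ⟨x, hx⟩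
  exact bddAbove_range_sqrt_form _ fun k => by
    obtain ⟨C, hC⟩ := hv.bounded_psi J hJ k
    exact ⟨C, fun x => hC x x.2⟩

theorem sqrt_inv_form_b_le {w : Fin dw → ℝ} (hw : w ∈ M.suppW) :
    √((fun k => M.b (M.K J) k w) ⬝ᵥ ((M.Gb (M.K J))⁻¹ *ᵥ fun k => M.b (M.K J) k w)) ≤
      M.zetaB (M.K J) := by
  refine le_ciSup (f := fun x : M.suppW => √((fun k => M.b (M.K J) k x) ⬝ᵥ
    ((M.Gb (M.K J))⁻¹ *ᵥ fun k => M.b (M.K J) k x))) ?_ ⟨w, hw⟩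
  exact bddAbove_range_sqrt_form _ fun k => by
    obtain ⟨C, hC⟩ := hv.bounded_b J hJ k
    exact ⟨C, fun x => hC x x.2⟩

theorem abs_instFun_le_zetaB (p : Fin (M.K J) → ℝ) {w : Fin dw → ℝ} (hw : w ∈ M.suppW) :
    |M.instFun (M.K J) p w| ≤ M.zetaB (M.K J) * qnorm (M.Gb (M.K J)) p := by
  refine (abs_dotProduct_le_dual (hv.posDef_b J hJ) (fun k => M.b (M.K J) k w) p).trans ?_
  exact mul_le_mul_of_nonneg_right (sqrt_inv_form_b_le hv hJ hw) (qnorm_nonneg _ _)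

theorem sum_abs_psi_le_xi {x : Fin d → ℝ} (hx : x ∈ M.suppX) :
    ∑ k, |M.psi J k x| ≤ M.xi J := by
  refine le_ciSup (f := fun x : M.suppX => ∑ k, |M.psi J k x|) ?_ ⟨x, hx⟩
  choose C hC using hv.bounded_psi J hJ
  exact ⟨∑ k, C k, by rintro _ ⟨y, rfl⟩; exact Finset.sum_le_sum fun k _ => hC k y y.2⟩

theorem abs_sieveFun_le_xi {c : Fin J → ℝ} {m : ℝ} (hm : 0 ≤ m) (hc : ∀ k, |c k| ≤ m)
    {x : Fin d → ℝ} (hx : x ∈ M.suppX) : |M.sieveFun J c x| ≤ M.xi J * m := by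
  calc _ ≤ ∑ k, |M.psi J k x| * m := by
        refine (Finset.abs_sum_le_sum_abs _ _).trans (Finset.sum_le_sum fun k _ => ?_)
        rw [abs_mul]
        exact mul_le_mul_of_nonneg_left (hc k) (abs_nonneg _)
    _ = (∑ k, |M.psi J k x|) * m := by rw [Finset.sum_mul]
    _ ≤ _ := mul_le_mul_of_nonneg_right (sum_abs_psi_le_xi hv hJ hx) hm

theorem e_pos : 0 < M.e J := lambdaMin_pos (hv.pos J hJ) (hv.posDef_psi J hJ)

/-- This lets remainders measured through ζ_ψ be absorbed into V_sup, which is built from ξ/√e. -/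
theorem zetaPsi_le_xi_div : M.zetaPsi J ≤ M.xi J / √(M.e J) := by
  refine Real.iSup_le (fun x => ?_) (div_nonneg xi_nonneg (Real.sqrt_nonneg _))
  refine (sqrt_inv_form_le (hv.pos J hJ) (hv.posDef_psi J hJ) _).trans ?_
  exact div_le_div_of_nonneg_right (sum_abs_psi_le_xi hv hJ x.2) (Real.sqrt_nonneg _)

theorem S_injective {c : Fin J → ℝ} (hc : M.S J *ᵥ c = 0) : c = 0 := by
  have h1 := LinearMap.finrank_range_add_finrank_ker (M.S J).mulVecLin
  have h2 := hv.rank_S J hJ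
  rw [Matrix.rank] at h2
  rw [h2] at h1
  simp only [Module.finrank_fintype_fun_eq_card, Fintype.card_fin, Nat.add_eq_left] at h1
  have h3 := Submodule.finrank_eq_zero.1 h1
  exact (LinearMap.ker_eq_bot'.1 h3) c hc

end Sieve

end NPIV.Model

/-! ### Ill-posedness and approximation in the population -/

section Identification

variable {κ : Type*} [Fintype κ] [DecidableEq κ] {m : ℕ} {G : Matrix κ κ ℝ}
  {S : Matrix κ (Fin m) ℝ}

theorem qnorm_normal_eq (hG : G.PosDef) (c : Fin m → ℝ) :
    qnorm (Sᵀ * G⁻¹ * S) c = qnorm G (G⁻¹ *ᵥ (S *ᵥ c)) := by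
  rw [qnorm, qnorm, hG.mulVec_inv_mulVec, Matrix.mul_assoc, ← mulVec_mulVec, ← mulVec_mulVec,
    dotProduct_mulVec c, ← mulVec_transpose, transpose_transpose, dotProduct_comm]

/-- A qualitative bound from full column rank, by which the supremum defining τ is finite. The
quantitative s = (1 − γ)/τ comes later. -/
theorem exists_mul_qnorm_le (hm : 0 < m) (hG : G.PosDef) (hS : ∀ c, S *ᵥ c = 0 → c = 0)
    (H : Matrix (Fin m) (Fin m) ℝ) :
    ∃ s : ℝ, 0 < s ∧ ∀ c, s * qnorm H c ≤ qnorm G (G⁻¹ *ᵥ (S *ᵥ c)) := by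
  have hN := posDef_normal hG hS
  have he := Real.sqrt_pos.2 (lambdaMin_pos hm hN)
  set e := √(NPIV.lambdaMin (Sᵀ * G⁻¹ * S))
  set Λ := ∑ k, ∑ l, |H k l|
  have hΛ : 0 ≤ Λ := Finset.sum_nonneg fun _ _ => Finset.sum_nonneg fun _ _ => abs_nonneg _
  refine ⟨e / (√Λ + 1), by positivity, fun c => ?_⟩
  rw [← qnorm_normal_eq hG]
  set q := qnorm (Sᵀ * G⁻¹ * S) c
  have hq : 0 ≤ q := qnorm_nonneg _ _
  have h1 : qnorm H c ≤ √Λ * (q / e) := by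
    rw [← Real.sqrt_sq (div_nonneg hq he.le), ← Real.sqrt_mul hΛ]
    refine Real.sqrt_le_sqrt ?_
    simp only [dotProduct, mulVec, Λ, Finset.sum_mul, Finset.mul_sum]
    refine Finset.sum_le_sum fun k _ => Finset.sum_le_sum fun l _ => (le_abs_self _).trans ?_
    have hk := abs_apply_le_qnorm_div hm hN c k
    have hl := abs_apply_le_qnorm_div hm hN c l
    rw [abs_mul, abs_mul]
    calc _ = |H k l| * (|c k| * |c l|) := by ring
      _ ≤ |H k l| * ((q / e) * (q / e)) := by gcongr
      _ = _ := by ring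
  rw [div_mul_eq_mul_div, div_le_iff₀ (by positivity)]
  calc e * qnorm H c ≤ e * (√Λ * (q / e)) := by gcongr
    _ = √Λ * q := by field_simp
    _ ≤ q * (√Λ + 1) := by nlinarith

end Identification

namespace NPIV.Model

variable {Ω : Type*} [MeasurableSpace Ω] {d dw : ℕ} {M : Model Ω d dw}
  {H : Set ((Fin d → ℝ) → ℝ)} {J : ℕ}

theorem normW_nonneg (g : Ω → ℝ) : 0 ≤ M.normW g := Real.sqrt_nonneg _

theorem normX_nonneg (f : (Fin d → ℝ) → ℝ) : 0 ≤ M.normX f := Real.sqrt_nonneg _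

theorem normW_congr {f g : Ω → ℝ} (h : f =ᵐ[M.μ] g) : M.normW f = M.normW g := by
  refine congrArg Real.sqrt (integral_congr_ae ?_)
  filter_upwards [h] with ω hω
  rw [hω]

theorem normW_const_mul (a : ℝ) (g : Ω → ℝ) : M.normW (fun ω => a * g ω) = |a| * M.normW g := by
  simp only [normW, mul_pow, integral_const_mul]
  rw [Real.sqrt_mul (sq_nonneg _), Real.sqrt_sq_eq_abs]

theorem sieveFun_smul (a : ℝ) (c : Fin J → ℝ) (x : Fin d → ℝ) :
    M.sieveFun J (a • c) x = a * M.sieveFun J c x := by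
  simp only [sieveFun, Finset.mul_sum, Pi.smul_apply, smul_eq_mul]
  exact Finset.sum_congr rfl fun _ _ => by ring

theorem sieveFun_sub (c c' : Fin J → ℝ) (x : Fin d → ℝ) :
    M.sieveFun J (c - c') x = M.sieveFun J c x - M.sieveFun J c' x := by
  simp only [sieveFun, Pi.sub_apply, mul_sub, Finset.sum_sub_distrib]

theorem T_sieveFun_smul (a : ℝ) (c : Fin J → ℝ) :
    M.T (M.sieveFun J (a • c)) =ᵐ[M.μ] fun ω => a * M.T (M.sieveFun J c) ω := by
  have : (fun ω => M.sieveFun J (a • c) (M.X 0 ω)) =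
      a • fun ω => M.sieveFun J c (M.X 0 ω) := by
    ext ω; exact sieveFun_smul a c _
  rw [T, this]
  exact condExp_smul a _ _

variable (M J) in
/-- The approximation error `h_0 - Π_J h_0`. -/
def approxErr (x : Fin d → ℝ) : ℝ := M.h0 x - M.projPsi J M.h0 x

section Population

variable (hv : M.IsSieve) (hJ : J ∈ M.Js)
include hv hJ

theorem sum_sq_conj_b_le {A : Matrix (Fin (M.K J)) (Fin (M.K J)) ℝ}
    (hA : Aᵀ * M.Gb (M.K J) * A = 1) {w : Fin dw → ℝ} (hw : w ∈ M.suppW) :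
    (Aᵀ *ᵥ fun k => M.b (M.K J) k w) ⬝ᵥ (Aᵀ *ᵥ fun k => M.b (M.K J) k w) ≤
      M.zetaB (M.K J) ^ 2 := by
  rw [sum_sq_eq_inv_form hA]
  exact (Real.sqrt_le_left ((Real.sqrt_nonneg _).trans (sqrt_inv_form_b_le hv hJ hw))).1
    (sqrt_inv_form_b_le hv hJ hw)

theorem sum_sq_conj_psi_le {A : Matrix (Fin J) (Fin J) ℝ}
    (hA : Aᵀ * M.Gpsi J * A = 1) {x : Fin d → ℝ} (hx : x ∈ M.suppX) :
    (Aᵀ *ᵥ fun k => M.psi J k x) ⬝ᵥ (Aᵀ *ᵥ fun k => M.psi J k x) ≤ M.zetaPsi J ^ 2 := by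
  rw [sum_sq_eq_inv_form hA]
  exact (Real.sqrt_le_left ((Real.sqrt_nonneg _).trans (sqrt_inv_form_psi_le hv hJ hx))).1
    (sqrt_inv_form_psi_le hv hJ hx)

theorem bddX_approxErr (hd : M.DataAssumption H) : M.BddX (M.approxErr J) :=
  hd.bddX_h0.sub (hv.bddX_sieveFun hJ _)

theorem abs_approxErr_le (hd : M.DataAssumption H) {x : Fin d → ℝ} (hx : x ∈ M.suppX) : |M.approxErr J x| ≤ M.bias J :=
  le_supNorm (bddX_approxErr hv hJ hd) hx

variable (hs : M.IsSample) (hd : M.DataAssumption H)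
include hs hd

theorem normX_sieveFun_pos {c : Fin J → ℝ} (hc : c ≠ 0) : 0 < M.normX (M.sieveFun J c) := by
  rw [← qnorm_Gpsi hv hJ hs hd]
  exact qnorm_pos (hv.posDef_psi J hJ) hc

theorem exists_mul_normX_le_normW :
    ∃ s : ℝ, 0 < s ∧ ∀ c, s * M.normX (M.sieveFun J c) ≤ M.normW (M.T (M.sieveFun J c)) := by
  obtain ⟨s, h0, h⟩ := exists_mul_qnorm_le (hv.pos J hJ) (hv.posDef_b J hJ)
    (fun c => S_injective hv hJ (c := c)) (M.Gpsi J)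
  refine ⟨s, h0, fun c => ?_⟩
  have h1 := h c
  rw [qnorm_Gpsi hv hJ hs hd, S_mulVec hv hJ hs hd] at h1
  exact h1.trans (qnorm_proj_le hv hJ hs hd (hv.bddX_sieveFun hJ c))

theorem normW_T_sieveFun_pos {c : Fin J → ℝ} (hc : c ≠ 0) :
    0 < M.normW (M.T (M.sieveFun J c)) := by
  obtain ⟨s, h0, h⟩ := exists_mul_normX_le_normW hv hJ hs hd
  exact (mul_pos h0 (normX_sieveFun_pos hv hJ hs hd hc)).trans_le (h c)

theorem bddAbove_tau : BddAbove (Set.range fun c : {c : Fin J → ℝ // c ≠ 0} =>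
    M.normX (M.sieveFun J c) / M.normW (M.T (M.sieveFun J c))) := by
  obtain ⟨s, h0, h⟩ := exists_mul_normX_le_normW hv hJ hs hd
  refine ⟨s⁻¹, ?_⟩
  rintro _ ⟨c, rfl⟩
  have hp := normW_T_sieveFun_pos hv hJ hs hd c.2
  rw [div_le_iff₀ hp, inv_mul_eq_div, le_div_iff₀ h0, mul_comm]
  exact h c

theorem normX_div_normW_le_tau {c : Fin J → ℝ} (hc : c ≠ 0) :
    M.normX (M.sieveFun J c) / M.normW (M.T (M.sieveFun J c)) ≤ M.tau J :=
  le_ciSup (f := fun c : {c : Fin J → ℝ // c ≠ 0} =>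
    M.normX (M.sieveFun J c) / M.normW (M.T (M.sieveFun J c)))
    (bddAbove_tau hv hJ hs hd) ⟨c, hc⟩

theorem one_le_tau : 1 ≤ M.tau J := by
  set c : Fin J → ℝ := Pi.single ⟨0, hv.pos J hJ⟩ 1
  have hc : c ≠ 0 := fun h => by
    have := congrFun h ⟨0, hv.pos J hJ⟩
    simp [c] at this
  refine le_trans ?_ (normX_div_normW_le_tau hv hJ hs hd hc)
  rw [one_le_div (normW_T_sieveFun_pos hv hJ hs hd hc)]
  exact normW_T_le hs hd (hv.bddX_sieveFun hJ c)

theorem normX_le_tau_mul (c : Fin J → ℝ) :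
    M.normX (M.sieveFun J c) ≤ M.tau J * M.normW (M.T (M.sieveFun J c)) := by
  by_cases hc : c = 0
  · have h0 : M.normX (M.sieveFun J c) = 0 := by
      rw [← qnorm_Gpsi hv hJ hs hd, hc]; simp [qnorm]
    rw [h0]
    exact mul_nonneg (zero_le_one.trans (one_le_tau hv hJ hs hd)) (normW_nonneg _)
  · rw [← div_le_iff₀ (normW_T_sieveFun_pos hv hJ hs hd hc)]
    exact normX_div_normW_le_tau hv hJ hs hd hc

/-- The error of the projection onto the instrument space. -/
theorem normW_projB_sub_le_normX {f : (Fin d → ℝ) → ℝ} (hf : M.BddX f) :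
    M.normW (fun ω => M.projB (M.K J) (M.T f) ω - M.T f ω) ≤ M.normX f := by
  refine le_trans ?_ (normW_T_le hs hd hf)
  have h := normW_T_sq hv hJ hs hd hf
  refine abs_le_of_sq_le_sq' ?_ (normW_nonneg _) |>.2
  nlinarith [sq_nonneg (qnorm (M.Gb (M.K J)) ((M.Gb (M.K J))⁻¹ *ᵥ M.moment (M.K J) f))]

/-- Homogeneity carries the bound from the unit sphere, where the supremum is taken, to all c; T is
linear only almost surely, which the norm does not see. -/
theorem normW_projB_sub_le (c : Fin J → ℝ) :
    M.normW (fun ω => M.projB (M.K J) (M.T (M.sieveFun J c)) ω - M.T (M.sieveFun J c) ω) ≤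
      M.instrumentError J * M.normX (M.sieveFun J c) := by
  by_cases hc : c = 0
  · have h0 : M.normX (M.sieveFun J c) = 0 := by
      rw [← qnorm_Gpsi hv hJ hs hd, hc]; simp [qnorm]
    rw [h0, mul_zero, ← h0]
    exact normW_projB_sub_le_normX hv hJ hs hd (hv.bddX_sieveFun hJ c)
  have hp := normX_sieveFun_pos hv hJ hs hd hc
  set a := (M.normX (M.sieveFun J c))⁻¹
  have ha : 0 < a := inv_pos.2 hp
  have hq : ∀ e : Fin J → ℝ, qnorm (M.Gpsi J) (a • e) = a * qnorm (M.Gpsi J) e := fun e => by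
    rw [qnorm, qnorm, mulVec_smul, dotProduct_smul, smul_dotProduct, smul_eq_mul, smul_eq_mul,
      ← mul_assoc, Real.sqrt_mul (mul_self_nonneg a), Real.sqrt_mul_self ha.le]
  have h1 : M.normX (M.sieveFun J (a • c)) = 1 := by
    rw [← qnorm_Gpsi hv hJ hs hd, hq, qnorm_Gpsi hv hJ hs hd]
    exact inv_mul_cancel₀ hp.ne'
  have hb : BddAbove (Set.range fun c : {c : Fin J → ℝ // M.normX (M.sieveFun J c) = 1} =>
      M.normW (fun ω =>
        M.projB (M.K J) (M.T (M.sieveFun J c)) ω - M.T (M.sieveFun J c) ω)) := by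
    refine ⟨1, ?_⟩
    rintro _ ⟨e, rfl⟩
    exact (normW_projB_sub_le_normX hv hJ hs hd (hv.bddX_sieveFun hJ e)).trans e.2.le
  have h2 := le_ciSup hb ⟨a • c, h1⟩
  have h3 : (fun ω => M.projB (M.K J) (M.T (M.sieveFun J (a • c))) ω -
      M.T (M.sieveFun J (a • c)) ω) =ᵐ[M.μ] fun ω => a *
      (M.projB (M.K J) (M.T (M.sieveFun J c)) ω - M.T (M.sieveFun J c) ω) := by
    filter_upwards [T_sieveFun_smul (M := M) a c] with ω hω
    rw [hω, projB_T hv hJ hs hd (hv.bddX_sieveFun hJ _), projB_T hv hJ hs hd (hv.bddX_sieveFun hJ _),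
      ← S_mulVec hv hJ hs hd, ← S_mulVec hv hJ hs hd, mulVec_smul, mulVec_smul, mul_sub]
    congr 1
    simp only [instFun, Finset.mul_sum, Pi.smul_apply, smul_eq_mul]
    exact Finset.sum_congr rfl fun _ _ => by ring
  change M.normW _ ≤ M.instrumentError J at h2
  rw [normW_congr h3, normW_const_mul, abs_of_pos ha, inv_mul_eq_div, div_le_iff₀ hp] at h2
  exact h2

theorem qnorm_proj_sieveFun_le (c : Fin J → ℝ) :
    qnorm (M.Gb (M.K J)) ((M.Gb (M.K J))⁻¹ *ᵥ (M.S J *ᵥ c)) ≤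
      M.normW (M.T (M.sieveFun J c)) := by
  rw [S_mulVec hv hJ hs hd]
  exact qnorm_proj_le hv hJ hs hd (hv.bddX_sieveFun hJ c)

/-- The projection onto B_K loses at most (γ/τ)‖h‖ ≤ γ‖Th‖ of Th: the instrument error is measured
against exactly the worst ill-posedness. -/
theorem mul_normW_le_qnorm_proj {γ : ℝ} (hγ0 : 0 ≤ γ)
    (hγ : M.instrumentError J ≤ γ * (M.tau J)⁻¹) (c : Fin J → ℝ) :
    (1 - γ) * M.normW (M.T (M.sieveFun J c)) ≤
      qnorm (M.Gb (M.K J)) ((M.Gb (M.K J))⁻¹ *ᵥ (M.S J *ᵥ c)) := by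
  have h1 := normW_T_le_add hv hJ hs hd (hv.bddX_sieveFun hJ c)
  have h2 := normW_projB_sub_le hv hJ hs hd c
  have h3 := normX_le_tau_mul hv hJ hs hd c
  have ht : 0 < M.tau J := zero_lt_one.trans_le (one_le_tau hv hJ hs hd)
  rw [S_mulVec hv hJ hs hd]
  have h4 : M.instrumentError J * M.normX (M.sieveFun J c) ≤
      γ * M.normW (M.T (M.sieveFun J c)) :=
    calc _ ≤ γ * (M.tau J)⁻¹ * M.normX (M.sieveFun J c) :=
          mul_le_mul_of_nonneg_right hγ (normX_nonneg _)
      _ ≤ γ * (M.tau J)⁻¹ * (M.tau J * M.normW (M.T (M.sieveFun J c))) :=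
          mul_le_mul_of_nonneg_left h3 (by positivity)
      _ = _ := by field_simp
  linarith

theorem mul_qnorm_le_qnorm_proj {γ : ℝ} (hγ0 : 0 ≤ γ) (hγ1 : γ ≤ 1)
    (hγ : M.instrumentError J ≤ γ * (M.tau J)⁻¹) (c : Fin J → ℝ) :
    (1 - γ) / M.tau J * qnorm (M.Gpsi J) c ≤
      qnorm (M.Gb (M.K J)) ((M.Gb (M.K J))⁻¹ *ᵥ (M.S J *ᵥ c)) := by
  refine le_trans ?_ (mul_normW_le_qnorm_proj hv hJ hs hd hγ0 hγ c)
  have ht : 0 < M.tau J := zero_lt_one.trans_le (one_le_tau hv hJ hs hd)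
  rw [qnorm_Gpsi hv hJ hs hd, div_mul_eq_mul_div, div_le_iff₀ ht, mul_assoc]
  refine mul_le_mul_of_nonneg_left ?_ (by linarith)
  rw [mul_comm]
  exact normX_le_tau_mul hv hJ hs hd c

/-- The dimension of the instrument space is at most `ζ_b²`. -/
theorem card_le_zetaB_sq : (M.K J : ℝ) ≤ M.zetaB (M.K J) ^ 2 := by
  have := hs.prob
  obtain ⟨A, hA, -⟩ := exists_conj_eq_one (hv.posDef_b J hJ)
  have e1 : ∀ k, ∫ ω, M.instFun (M.K J) (A *ᵥ Pi.single k 1) (M.W 0 ω) *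
      M.instFun (M.K J) (A *ᵥ Pi.single k 1) (M.W 0 ω) ∂M.μ = 1 := fun k => by
    rw [← form_Gb hv hJ hs hd, ← qnorm_sq (hv.posDef_b J hJ).posSemidef, qnorm_mulVec_of_conj hA,
      Real.sq_sqrt (dotProduct_self_nonneg' _)]
    simp
  have hi := fun k => integrable_WW hs hd (hv.bddW_instFun hJ (A *ᵥ Pi.single k 1))
    (hv.bddW_instFun hJ (A *ᵥ Pi.single k 1))
  have e2 : ∀ k w, M.instFun (M.K J) (A *ᵥ Pi.single k 1) w =
      (Aᵀ *ᵥ fun k => M.b (M.K J) k w) k := fun k w => by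
    simp [instFun, mulVec, dotProduct, Pi.single_apply, mul_comm]
  -- The K functions are orthonormal, and the sum of their squares is at most ζ_b² at almost every
  -- W.
  calc (M.K J : ℝ) = ∑ k, ∫ ω, M.instFun (M.K J) (A *ᵥ Pi.single k 1) (M.W 0 ω) *
      M.instFun (M.K J) (A *ᵥ Pi.single k 1) (M.W 0 ω) ∂M.μ := by
        simp only [e1]; simp
    _ = ∫ ω, ∑ k, M.instFun (M.K J) (A *ᵥ Pi.single k 1) (M.W 0 ω) *
      M.instFun (M.K J) (A *ᵥ Pi.single k 1) (M.W 0 ω) ∂M.μ :=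
        (integral_finsetSum _ fun k _ => hi k).symm
    _ ≤ ∫ _, M.zetaB (M.K J) ^ 2 ∂M.μ := by
        refine integral_mono_ae (integrable_finsetSum _ fun k _ => hi k) (integrable_const _) ?_
        filter_upwards [ae_memW hs hd] with ω hω
        simp only [e2]
        exact sum_sq_conj_b_le hv hJ hA hω
    _ = _ := by simp

theorem one_le_zetaB : 1 ≤ M.zetaB (M.K J) := by
  have h1 := card_le_zetaB_sq hv hJ hs hd
  have h2 : (1 : ℝ) ≤ M.K J := by exact_mod_cast K_pos hv hJ
  have h3 : 0 ≤ M.zetaB (M.K J) := Real.iSup_nonneg fun _ => Real.sqrt_nonneg _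
  nlinarith

/-! #### The approximation error -/

theorem normX_approxErr_le : M.normX (M.approxErr J) ≤ M.bias J := by
  have := hs.prob
  refine Real.sqrt_le_iff.2 ⟨supNorm_nonneg _, ?_⟩
  have hi := integrable_XX hs hd (bddX_approxErr hv hJ hd) (bddX_approxErr hv hJ hd)
  calc _ ≤ ∫ _, M.bias J ^ 2 ∂M.μ := by
        refine integral_mono_ae (by simpa only [← sq] using hi) (integrable_const _) ?_
        filter_upwards [ae_memX hs hd] with ω hω
        exact sq_le_sq' (by linarith [abs_le.1 (abs_approxErr_le hv hJ hd hω)])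
          (abs_le.1 (abs_approxErr_le hv hJ hd hω)).2
    _ = _ := by simp

theorem abs_dotProduct_moment_le (p : Fin (M.K J) → ℝ) {f : (Fin d → ℝ) → ℝ} (hf : M.BddX f) :
    |p ⬝ᵥ M.moment (M.K J) f| ≤ M.normW (M.T f) * qnorm (M.Gb (M.K J)) p := by
  rw [dotProduct_comm]
  refine (abs_dotProduct_le_dual (hv.posDef_b J hJ) _ _).trans ?_
  rw [sqrt_inv_form_eq (hv.posDef_b J hJ)]
  exact mul_le_mul_of_nonneg_right (qnorm_proj_le hv hJ hs hd hf) (qnorm_nonneg _ _)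

/-- Q_J fixes the sieve space, so Q_J h_0 − Π_J h_0 = Q_J(h_0 − Π_J h_0). -/
theorem proj2SLS_sub_projPsi (x : Fin d → ℝ) :
    M.proj2SLS J M.h0 x - M.projPsi J M.h0 x =
      M.sieveFun J (tslsCoef (M.Gb (M.K J)) (M.S J) (M.moment (M.K J) (M.approxErr J))) x := by
  set c := (M.Gpsi J)⁻¹ *ᵥ fun l => ∫ ω, M.psi J l (M.X 0 ω) * M.h0 (M.X 0 ω) ∂M.μ
  have e1 : M.moment (M.K J) (M.approxErr J) = M.moment (M.K J) M.h0 - M.S J *ᵥ c := by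
    rw [S_mulVec hv hJ hs hd]
    ext l
    simp only [moment, Pi.sub_apply]
    rw [← integral_sub (integrable_WX hs hd (bddW_b hv hJ l) hd.bddX_h0)
      (integrable_WX hs hd (bddW_b hv hJ l) (hv.bddX_sieveFun hJ c))]
    refine integral_congr_ae (Eventually.of_forall fun ω => ?_)
    change M.b _ _ _ * (M.h0 _ - M.sieveFun J c _) = _
    ring
  have e2 : tslsCoef (M.Gb (M.K J)) (M.S J) (M.moment (M.K J) (M.approxErr J)) =
      tslsCoef (M.Gb (M.K J)) (M.S J) (M.moment (M.K J) M.h0) - c := by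
    have h := tslsCoef_mulVec (hv.posDef_b J hJ) (fun c => S_injective hv hJ (c := c)) c
    have h2 := tslsCoef_add (G := M.Gb (M.K J)) (S := M.S J) (M.moment (M.K J) (M.approxErr J))
      (M.S J *ᵥ c)
    rw [h, e1, sub_add_cancel] at h2
    rw [e1, h2, add_sub_cancel_right]
  rw [e2, sieveFun_sub]
  rfl

end Population

end NPIV.Model

/-! ### Sample moments and deterministic bounds for the estimators -/

theorem ginv_eq_inv {ginv : (m : ℕ) → Matrix (Fin m) (Fin m) ℝ → Matrix (Fin m) (Fin m) ℝ}
    (hginv : NPIV.IsGeneralizedInverse ginv) {m : ℕ} {A : Matrix (Fin m) (Fin m) ℝ}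
    (hA : A.PosDef) : ginv m A = A⁻¹ := by
  have hu := (isUnit_iff_isUnit_det _).1 hA.isUnit
  have h : A⁻¹ * (A * ginv m A * A) * A⁻¹ = A⁻¹ * A * A⁻¹ := by rw [hginv m A]
  rwa [← Matrix.mul_assoc, ← Matrix.mul_assoc, nonsing_inv_mul _ hu, Matrix.one_mul,
    Matrix.mul_assoc, mul_nonsing_inv _ hu, Matrix.mul_one, Matrix.one_mul] at h

theorem Matrix.PosDef.smul_inv {m : ℕ} {A : Matrix (Fin m) (Fin m) ℝ} (hA : A.PosDef) {a : ℝ}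
    (ha : a ≠ 0) : (a • A)⁻¹ = a⁻¹ • A⁻¹ := by
  refine inv_eq_left_inv ?_
  rw [Matrix.smul_mul, Matrix.mul_smul, smul_smul, inv_mul_cancel₀ ha, one_smul,
    nonsing_inv_mul _ ((isUnit_iff_isUnit_det _).1 hA.isUnit)]

theorem dotProduct_smul_gram_mulVec {n κ ι : Type*} [Fintype n] [Fintype κ] [Fintype ι] (a : ℝ)
    (A : Matrix n κ ℝ) (C : Matrix n ι ℝ) (p : κ → ℝ) (q : ι → ℝ) :
    p ⬝ᵥ ((a • (Aᵀ * C)) *ᵥ q) = a * ∑ i, (A *ᵥ p) i * (C *ᵥ q) i := by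
  rw [smul_mulVec, dotProduct_smul, ← mulVec_mulVec, dotProduct_mulVec, ← mulVec_transpose,
    transpose_transpose]
  rfl

theorem Matrix.isHermitian_smul_gram {n κ : Type*} [Fintype n] (a : ℝ) (A : Matrix n κ ℝ) :
    (a • (Aᵀ * A)).IsHermitian := by
  rw [IsHermitian, conjTranspose_eq_transpose_of_trivial, transpose_smul, transpose_mul,
    transpose_transpose]

theorem Matrix.posSemidef_smul_gram {n κ : Type*} [Fintype n] [Fintype κ] {a : ℝ} (ha : 0 ≤ a)
    (A : Matrix n κ ℝ) : (a • (Aᵀ * A)).PosSemidef := by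
  refine PosSemidef.of_dotProduct_mulVec_nonneg (isHermitian_smul_gram a A) fun x => ?_
  rw [star_trivial, dotProduct_smul_gram_mulVec]
  exact mul_nonneg ha (Finset.sum_nonneg fun i _ => mul_self_nonneg _)

/-- Applied with a, b the measures of ill-posedness τ, τ̂ and c, e the square root factors of V, V̂.
The few factors 1 ± x compound to at most 1 ± 10x, hence the choice x = η/10. -/
theorem mul_bounds_of_ratio_bounds {x a b c e : ℝ} (hx0 : 0 ≤ x) (hx : x ≤ 1 / 10) (ha : 0 ≤ a)
    (hb : 0 ≤ b) (hc : 0 ≤ c) (he : 0 ≤ e) (h1 : (1 - x) * a ≤ (1 + x) * b)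
    (h2 : (1 - x) ^ 2 * b ≤ (1 + x) * a) (h3 : c ≤ (1 + x) * e) (h4 : (1 - x) * e ≤ c) :
    (1 - 10 * x) * (a * c) ≤ b * e ∧ b * e ≤ (1 + 10 * x) * (a * c) := by
  have hac : 0 ≤ a * c := mul_nonneg ha hc
  constructor
  · have k1 : (1 - x) * (a * c) ≤ (1 + x) ^ 2 * (b * e) :=
      calc _ = (1 - x) * a * c := by ring
        _ ≤ (1 + x) * b * ((1 + x) * e) := by gcongr
        _ = _ := by ring
    have k2 : (1 - 10 * x) * (1 + x) ^ 2 ≤ 1 - x := by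
      nlinarith [mul_nonneg hx0 hx0, mul_nonneg hx0 (mul_nonneg hx0 hx0)]
    refine le_of_mul_le_mul_right ?_ (by positivity : 0 < (1 + x) ^ 2)
    calc _ = (1 - 10 * x) * (1 + x) ^ 2 * (a * c) := by ring
      _ ≤ (1 - x) * (a * c) := mul_le_mul_of_nonneg_right k2 hac
      _ ≤ (1 + x) ^ 2 * (b * e) := k1
      _ = _ := by ring
  · have k1 : (1 - x) ^ 3 * (b * e) ≤ (1 + x) * (a * c) :=
      calc _ = (1 - x) ^ 2 * b * ((1 - x) * e) := by ring
        _ ≤ (1 + x) * a * c :=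
          mul_le_mul h2 h4 (mul_nonneg (by linarith) he) (mul_nonneg (by linarith) ha)
        _ = _ := by ring
    have k0 : 1 - 3 * x ≤ (1 - x) ^ 3 := by
      nlinarith [mul_nonneg (mul_nonneg hx0 hx0) (by linarith : 0 ≤ 3 - x)]
    have k2 : 1 + x ≤ (1 + 10 * x) * (1 - x) ^ 3 :=
      le_trans (by nlinarith) (mul_le_mul_of_nonneg_left k0 (by linarith : 0 ≤ 1 + 10 * x))
    refine le_of_mul_le_mul_right ?_ (pow_pos (by linarith : 0 < 1 - x) 3)
    calc _ = (1 - x) ^ 3 * (b * e) := by ring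
      _ ≤ (1 + x) * (a * c) := k1
      _ ≤ (1 + 10 * x) * (1 - x) ^ 3 * (a * c) := mul_le_mul_of_nonneg_right k2 hac
      _ = _ := by ring

namespace NPIV.Model

variable {Ω : Type*} [MeasurableSpace Ω] {d dw : ℕ} (M : Model Ω d dw)

/-- `B'B/n`. -/
def GbHat (n J : ℕ) (ω : Ω) : Matrix (Fin (M.K J)) (Fin (M.K J)) ℝ :=
  (n : ℝ)⁻¹ • ((M.B n (M.K J) ω)ᵀ * M.B n (M.K J) ω)

/-- `B'Ψ/n`. -/
def SHat (n J : ℕ) (ω : Ω) : Matrix (Fin (M.K J)) (Fin J) ℝ :=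
  (n : ℝ)⁻¹ • ((M.B n (M.K J) ω)ᵀ * M.Psi n J ω)

/-- `Ψ'Ψ/n`. -/
def GpsiHat (n J : ℕ) (ω : Ω) : Matrix (Fin J) (Fin J) ℝ :=
  (n : ℝ)⁻¹ • ((M.Psi n J ω)ᵀ * M.Psi n J ω)

/-- `(1/n) ∑_i b^K(W_i) y_i`. -/
def sampleMoment (n K : ℕ) (ω : Ω) (y : ℕ → ℝ) : Fin K → ℝ :=
  fun l => (n : ℝ)⁻¹ * ∑ i ∈ Finset.range n, M.b K l (M.W i ω) * y i

/-- The sample moments deviate from the population moments by at most `t`, relative to the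
population norms. -/
structure GramClose (n J : ℕ) (t : ℝ) (ω : Ω) : Prop where
  gb : ∀ p q, |p ⬝ᵥ (M.GbHat n J ω *ᵥ q) - p ⬝ᵥ (M.Gb (M.K J) *ᵥ q)| ≤
    t * qnorm (M.Gb (M.K J)) p * qnorm (M.Gb (M.K J)) q
  s : ∀ p c, |p ⬝ᵥ (M.SHat n J ω *ᵥ c) - p ⬝ᵥ (M.S J *ᵥ c)| ≤
    t * qnorm (M.Gb (M.K J)) p * qnorm (M.Gpsi J) c
  gpsi : ∀ c e, |c ⬝ᵥ (M.GpsiHat n J ω *ᵥ e) - c ⬝ᵥ (M.Gpsi J *ᵥ e)| ≤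
    t * qnorm (M.Gpsi J) c * qnorm (M.Gpsi J) e
  err : ∀ q, |q ⬝ᵥ (M.sampleMoment n (M.K J) ω (fun i => M.approxErr J (M.X i ω)) -
    M.moment (M.K J) (M.approxErr J))| ≤ t * M.bias J * qnorm (M.Gb (M.K J)) q

variable {M} {H : Set ((Fin d → ℝ) → ℝ)} {J n : ℕ} {ω : Ω}

theorem form_GbHat (p q : Fin (M.K J) → ℝ) :
    p ⬝ᵥ (M.GbHat n J ω *ᵥ q) = (n : ℝ)⁻¹ * ∑ i ∈ Finset.range n,
      M.instFun (M.K J) p (M.W i ω) * M.instFun (M.K J) q (M.W i ω) := by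
  rw [GbHat, dotProduct_smul_gram_mulVec, Finset.sum_range]
  rfl

theorem form_SHat (p : Fin (M.K J) → ℝ) (c : Fin J → ℝ) :
    p ⬝ᵥ (M.SHat n J ω *ᵥ c) = (n : ℝ)⁻¹ * ∑ i ∈ Finset.range n,
      M.instFun (M.K J) p (M.W i ω) * M.sieveFun J c (M.X i ω) := by
  rw [SHat, dotProduct_smul_gram_mulVec, Finset.sum_range]
  rfl

theorem form_GpsiHat (c e : Fin J → ℝ) :
    c ⬝ᵥ (M.GpsiHat n J ω *ᵥ e) = (n : ℝ)⁻¹ * ∑ i ∈ Finset.range n,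
      M.sieveFun J c (M.X i ω) * M.sieveFun J e (M.X i ω) := by
  rw [GpsiHat, dotProduct_smul_gram_mulVec, Finset.sum_range]
  rfl

theorem dotProduct_sampleMoment {K : ℕ} (p : Fin K → ℝ) (y : ℕ → ℝ) :
    p ⬝ᵥ M.sampleMoment n K ω y =
      (n : ℝ)⁻¹ * ∑ i ∈ Finset.range n, M.instFun K p (M.W i ω) * y i := by
  simp only [dotProduct, sampleMoment, instFun, Finset.sum_mul, Finset.mul_sum]
  rw [Finset.sum_comm]
  exact Finset.sum_congr rfl fun i _ => Finset.sum_congr rfl fun k _ => by ring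

theorem SHat_mulVec (c : Fin J → ℝ) :
    M.SHat n J ω *ᵥ c = M.sampleMoment n (M.K J) ω fun i => M.sieveFun J c (M.X i ω) := by
  ext l
  have h1 := form_SHat (M := M) (n := n) (ω := ω) (Pi.single l 1) c
  have h2 := dotProduct_sampleMoment (M := M) (n := n) (ω := ω) (Pi.single l 1)
    fun i => M.sieveFun J c (M.X i ω)
  rw [single_one_dotProduct] at h1 h2
  rw [h1, h2]

theorem sampleMoment_add {K : ℕ} (y z : ℕ → ℝ) :
    M.sampleMoment n K ω (fun i => y i + z i) =
      M.sampleMoment n K ω y + M.sampleMoment n K ω z := by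
  ext l
  simp only [sampleMoment, Pi.add_apply, mul_add, Finset.sum_add_distrib]

section Estimator

variable {ginv : (m : ℕ) → Matrix (Fin m) (Fin m) ℝ → Matrix (Fin m) (Fin m) ℝ}
  (hginv : NPIV.IsGeneralizedInverse ginv) (hG : (M.GbHat n J ω).PosDef)

section
include hginv hG

theorem cHat_eq_tslsCoef (hn : 0 < n) (hS : ∀ c, M.SHat n J ω *ᵥ c = 0 → c = 0) :
    M.cHat ginv n J ω = tslsCoef (M.GbHat n J ω) (M.SHat n J ω)
      (M.sampleMoment n (M.K J) ω fun i => M.Y i ω) := by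
  have hn0 : (0 : ℝ) < n := by exact_mod_cast hn
  have hN := posDef_normal hG hS
  set P := M.Psi n J ω
  set B := M.B n (M.K J) ω
  have eG : Bᵀ * B = (n : ℝ) • M.GbHat n J ω := by
    rw [GbHat, smul_smul, mul_inv_cancel₀ hn0.ne', one_smul]
  have eS : Bᵀ * P = (n : ℝ) • M.SHat n J ω := by
    rw [SHat, smul_smul, mul_inv_cancel₀ hn0.ne', one_smul]
  have eSt : Pᵀ * B = (n : ℝ) • (M.SHat n J ω)ᵀ := by
    rw [← transpose_smul, ← eS, transpose_mul, transpose_transpose]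
  have eY : Bᵀ *ᵥ (fun i : Fin n => M.Y i ω) =
      (n : ℝ) • M.sampleMoment n (M.K J) ω fun i => M.Y i ω := by
    ext l
    simp only [Pi.smul_apply, smul_eq_mul, sampleMoment]
    rw [mul_inv_cancel_left₀ hn0.ne', Finset.sum_range]
    rfl
  have eI : ginv (M.K J) (Bᵀ * B) = (n : ℝ)⁻¹ • (M.GbHat n J ω)⁻¹ := by
    rw [ginv_eq_inv hginv (by rw [eG]; exact hG.smul hn0), eG,
      hG.smul_inv hn0.ne']
  have eA : Pᵀ * B * ginv (M.K J) (Bᵀ * B) = (M.SHat n J ω)ᵀ * (M.GbHat n J ω)⁻¹ := by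
    rw [eI, eSt, Matrix.smul_mul, Matrix.mul_smul, smul_smul, mul_inv_cancel₀ hn0.ne', one_smul]
  have eN : Pᵀ * B * ginv (M.K J) (Bᵀ * B) * Bᵀ * P =
      (n : ℝ) • ((M.SHat n J ω)ᵀ * (M.GbHat n J ω)⁻¹ * M.SHat n J ω) := by
    rw [Matrix.mul_assoc _ Bᵀ P, eA, eS, Matrix.mul_smul]
  change ginv J (Pᵀ * B * ginv (M.K J) (Bᵀ * B) * Bᵀ * P) *ᵥ
    ((Pᵀ * B * ginv (M.K J) (Bᵀ * B) * Bᵀ) *ᵥ fun i : Fin n => M.Y i ω) = _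
  rw [eN, ginv_eq_inv hginv (hN.smul hn0), ← mulVec_mulVec, eA, eY, mulVec_smul,
    hN.smul_inv hn0.ne', mulVec_smul, smul_mulVec, smul_smul,
    mul_inv_cancel₀ hn0.ne', one_smul]
  rfl

/-- The coefficients of the estimator relative to those of the projection `Π_J h_0`. -/
theorem exists_hHat_system (hn : 0 < n) (hS : ∀ c, M.SHat n J ω *ᵥ c = 0 → c = 0) :
    ∃ (ch : Fin J → ℝ) (p : Fin (M.K J) → ℝ),
      (∀ x, M.hHat ginv n J ω x = M.projPsi J M.h0 x + M.sieveFun J ch x) ∧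
      M.GbHat n J ω *ᵥ p + M.SHat n J ω *ᵥ ch =
        M.sampleMoment n (M.K J) ω (fun i => M.approxErr J (M.X i ω)) +
          M.sampleMoment n (M.K J) ω (fun i => M.u i ω) ∧
      (M.SHat n J ω)ᵀ *ᵥ p = 0 := by
  set c := (M.Gpsi J)⁻¹ *ᵥ fun l => ∫ ω, M.psi J l (M.X 0 ω) * M.h0 (M.X 0 ω) ∂M.μ
  set v := M.sampleMoment n (M.K J) ω (fun i => M.approxErr J (M.X i ω)) +
    M.sampleMoment n (M.K J) ω (fun i => M.u i ω)
  have e1 : (M.sampleMoment n (M.K J) ω fun i => M.Y i ω) = v + M.SHat n J ω *ᵥ c := by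
    simp only [v]
    rw [SHat_mulVec, ← sampleMoment_add, ← sampleMoment_add]
    congr 1
    ext i
    change _ = M.h0 _ - M.sieveFun J c _ + (M.Y _ _ - M.h0 _) + M.sieveFun J c _
    ring
  have h := tslsCoef_system hG hS v
  refine ⟨tslsCoef (M.GbHat n J ω) (M.SHat n J ω) v, _, fun x => ?_, h.1, h.2⟩
  rw [hHat, cHat_eq_tslsCoef hginv hG hn hS, e1, tslsCoef_add, tslsCoef_mulVec hG hS]
  simp only [projPsi, sieveFun, Pi.add_apply, mul_add, Finset.sum_add_distrib]
  rw [add_comm]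

theorem tauHat_eq : M.tauHat ginv n J ω = ⨆ c : {c : Fin J → ℝ // c ≠ 0},
    qnorm (M.GpsiHat n J ω) c /
      qnorm (M.GbHat n J ω) ((M.GbHat n J ω)⁻¹ *ᵥ (M.SHat n J ω *ᵥ c)) := by
  refine iSup_congr fun c => ?_
  have h1 : (n : ℝ)⁻¹ * ∑ i : Fin n, M.sieveFun J c (M.X i ω) ^ 2 =
      c.1 ⬝ᵥ (M.GpsiHat n J ω *ᵥ c) := by
    rw [form_GpsiHat, Finset.sum_range]
    simp only [sq]
  have h2 : ∀ w, M.condExpHat ginv n (M.K J) ω (M.sieveFun J c) w =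
      M.instFun (M.K J) ((M.GbHat n J ω)⁻¹ *ᵥ (M.SHat n J ω *ᵥ c)) w := fun w => by
    have e : (fun l => (n : ℝ)⁻¹ * ∑ i : Fin n, M.b (M.K J) l (M.W i ω) *
        M.sieveFun J c (M.X i ω)) = M.SHat n J ω *ᵥ c := by
      rw [SHat_mulVec]
      ext l
      rw [sampleMoment, Finset.sum_range]
    rw [condExpHat, e, show (n : ℝ)⁻¹ • ((M.B n (M.K J) ω)ᵀ * M.B n (M.K J) ω) = M.GbHat n J ω
      from rfl, ginv_eq_inv hginv hG]
    rfl
  have h3 : (n : ℝ)⁻¹ * ∑ i : Fin n,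
      M.condExpHat ginv n (M.K J) ω (M.sieveFun J c) (M.W i ω) ^ 2 =
      ((M.GbHat n J ω)⁻¹ *ᵥ (M.SHat n J ω *ᵥ c)) ⬝ᵥ
        (M.GbHat n J ω *ᵥ ((M.GbHat n J ω)⁻¹ *ᵥ (M.SHat n J ω *ᵥ c))) := by
    rw [form_GbHat, Finset.sum_range]
    simp only [h2, sq]
  have h4 : (M.GpsiHat n J ω).PosSemidef := posSemidef_smul_gram (by positivity) _
  rw [h1, h3, Real.sqrt_div (h4.form_nonneg _)]
  rfl

end

variable (hv : M.IsSieve) (hJ : J ∈ M.Js) {s t : ℝ} (ht0 : 0 ≤ t) (hs0 : 0 < s) (hs1 : s ≤ 1)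
  (hst : t ≤ s / 2)
  (hsS : ∀ c, s * qnorm (M.Gpsi J) c ≤
    qnorm (M.Gb (M.K J)) ((M.Gb (M.K J))⁻¹ *ᵥ (M.S J *ᵥ c)))
  (h : M.GramClose n J t ω)

include hv hJ h in
theorem GramClose.posDef_GbHat (ht : t < 1) : (M.GbHat n J ω).PosDef :=
  posDef_of_form_close (hv.posDef_b J hJ) (isHermitian_smul_gram _ _) ht h.gb

include hv hJ h hs0 hst hsS in
theorem GramClose.SHat_injective {c : Fin J → ℝ} (hc : M.SHat n J ω *ᵥ c = 0) : c = 0 :=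
  eq_zero_of_mulVec_eq_zero (hv.posDef_b J hJ) (hv.posDef_psi J hJ) hs0 (by linarith) hsS h.s hc

include hv hJ h hs0 hst hsS ht0 hs1 in
/-- Deterministic error bound for the estimator. -/
theorem GramClose.abs_hHat_sub_le (hginv : NPIV.IsGeneralizedInverse ginv) (hs : M.IsSample)
    (hd : M.DataAssumption H) (hn : 0 < n) {V U a : ℝ} (hV : 0 ≤ V) (hU : 0 ≤ U) (ha : 0 ≤ a)
    (hVr : M.normW (M.T (M.approxErr J)) ≤ V)
    (hVu : ∀ q, |q ⬝ᵥ M.sampleMoment n (M.K J) ω (fun i => M.u i ω)| ≤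
      U * qnorm (M.Gb (M.K J)) q)
    (hcu : ∀ k, |tslsCoef (M.Gb (M.K J)) (M.S J)
      (M.sampleMoment n (M.K J) ω fun i => M.u i ω) k| ≤ a)
    {x : Fin d → ℝ} (hx : x ∈ M.suppX) :
    |M.hHat ginv n J ω x - M.h0 x| ≤
      M.zetaPsi J * (12 * t * (V + U + t * M.bias J) / s ^ 2 + t * M.bias J / s) +
      M.supNorm (fun x => M.proj2SLS J M.h0 x - M.projPsi J M.h0 x) + M.xi J * a + M.bias J := by
  have hGh := h.posDef_GbHat hv hJ (by linarith)
  have hSh := fun c => h.SHat_injective hv hJ hs0 hst hsS (c := c)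
  obtain ⟨ch, p, e1, e2, e3⟩ := exists_hHat_system hginv hGh hn hSh
  set vu := M.sampleMoment n (M.K J) ω fun i => M.u i ω
  set vr := M.moment (M.K J) (M.approxErr J)
  set vrh := M.sampleMoment n (M.K J) ω fun i => M.approxErr J (M.X i ω)
  -- The comparison system has population matrices but keeps the sample moment of the residuals. The
  -- right-hand sides therefore differ only in the moment of the approximation error.
  have hpop := tslsCoef_system (hv.posDef_b J hJ) (fun c => S_injective hv hJ (c := c)) (vr + vu)
  have hb : 0 ≤ M.bias J := supNorm_nonneg _
  have hbound := saddle_perturbation (hv.posDef_b J hJ) hs0 hs1 ht0 hst hsS h.gb h.s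
    (add_nonneg hV hU) (mul_nonneg ht0 hb) e2 e3 hpop.1 hpop.2
    (fun q => by
      rw [dotProduct_add, add_mul]
      refine (abs_add_le _ _).trans (add_le_add ?_ (hVu q))
      exact (abs_dotProduct_moment_le hv hJ hs hd q (bddX_approxErr hv hJ hd)).trans
        (mul_le_mul_of_nonneg_right hVr (qnorm_nonneg _ _)))
    (fun q => by rw [add_sub_add_right_eq_sub]; exact h.err q)
  set c := tslsCoef (M.Gb (M.K J)) (M.S J) (vr + vu)
  have hc : c = tslsCoef (M.Gb (M.K J)) (M.S J) vr + tslsCoef (M.Gb (M.K J)) (M.S J) vu :=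
    tslsCoef_add _ _
  have hz : 0 ≤ M.zetaPsi J := Real.iSup_nonneg fun _ => Real.sqrt_nonneg _
  have b1 : |M.sieveFun J (ch - c) x| ≤
      M.zetaPsi J * (12 * t * (V + U + t * M.bias J) / s ^ 2 + t * M.bias J / s) :=
    (abs_sieveFun_le_zetaPsi hv hJ _ hx).trans (mul_le_mul_of_nonneg_left hbound hz)
  have b2 : |M.proj2SLS J M.h0 x - M.projPsi J M.h0 x| ≤
      M.supNorm (fun x => M.proj2SLS J M.h0 x - M.projPsi J M.h0 x) :=
    le_supNorm ((hv.bddX_sieveFun hJ _).sub (hv.bddX_sieveFun hJ _)) hx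
  have b3 := abs_sieveFun_le_xi hv hJ ha hcu hx
  have b4 := abs_approxErr_le hv hJ hd hx
  -- The four sources of error: perturbation of the system, two-stage least squares bias, residuals,
  -- approximation.
  have e : M.hHat ginv n J ω x - M.h0 x = M.sieveFun J (ch - c) x +
      (M.proj2SLS J M.h0 x - M.projPsi J M.h0 x) +
      M.sieveFun J (tslsCoef (M.Gb (M.K J)) (M.S J) vu) x + -M.approxErr J x := by
    rw [e1, proj2SLS_sub_projPsi hv hJ hs hd, sieveFun_sub, hc, approxErr]
    simp only [sieveFun, Pi.add_apply, mul_add, Finset.sum_add_distrib, vr]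
    ring
  rw [e]
  refine (abs_add_le _ _).trans (add_le_add ((abs_add_le _ _).trans (add_le_add
    ((abs_add_le _ _).trans (add_le_add b1 b2)) b3)) ?_)
  rwa [abs_neg]

include hv hJ h hs0 hst hsS ht0 hs1 in
-- The denominator of τ̂ estimates ‖Π_K Th‖ rather than ‖Th‖. Since the former is smaller, only the
-- upper bound pays the factor 1/(1 − γ).
theorem GramClose.tauHat_bounds (hginv : NPIV.IsGeneralizedInverse ginv) (hs : M.IsSample)
    (hd : M.DataAssumption H) {γ : ℝ} (hγ0 : 0 ≤ γ) (hγ1 : γ < 1)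
    (hγ : M.instrumentError J ≤ γ * (M.tau J)⁻¹) :
    (1 - t) / (1 + t / s) * M.tau J ≤ M.tauHat ginv n J ω ∧
      M.tauHat ginv n J ω ≤ (1 + t) / (1 - t / s) / (1 - γ) * M.tau J := by
  have hGh := h.posDef_GbHat hv hJ (by linarith)
  rw [tauHat_eq hginv hGh]
  have hne : Nonempty {c : Fin J → ℝ // c ≠ 0} :=
    ⟨⟨Pi.single ⟨0, hv.pos J hJ⟩ 1, fun h => by
      have := congrFun h ⟨0, hv.pos J hJ⟩
      simp at this⟩⟩
  have hts : t / s ≤ 1 / 2 := by rw [div_le_iff₀ hs0]; linarith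
  have hts0 : 0 ≤ t / s := by positivity
  have hA : 0 ≤ (1 - t) / (1 + t / s) := div_nonneg (by linarith) (by linarith)
  have hB : 0 ≤ (1 + t) / (1 - t / s) := div_nonneg (by linarith) (by linarith)
  have hr : ∀ c : {c : Fin J → ℝ // c ≠ 0}, _ := fun c =>
    qnorm_ratio_bounds (hv.posDef_b J hJ) hGh (hv.posDef_psi J hJ)
    (posSemidef_smul_gram (by positivity) _ : (M.GpsiHat n J ω).PosSemidef) hs0 hs1 ht0 hst hsS
    h.gb h.s h.gpsi c.2
  have hup : ∀ c : {c : Fin J → ℝ // c ≠ 0}, qnorm (M.GpsiHat n J ω) c /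
      qnorm (M.GbHat n J ω) ((M.GbHat n J ω)⁻¹ *ᵥ (M.SHat n J ω *ᵥ c)) ≤
      (1 + t) / (1 - t / s) / (1 - γ) * M.tau J := fun c => by
    refine (hr c).2.trans ?_
    rw [div_mul_eq_mul_div _ (1 - γ), mul_div_assoc]
    refine mul_le_mul_of_nonneg_left ?_ hB
    have hW := normW_T_sieveFun_pos hv hJ hs hd c.2
    have h1 := mul_normW_le_qnorm_proj hv hJ hs hd hγ0 hγ c.1
    have h2 := normX_le_tau_mul hv hJ hs hd c.1
    have hp : 0 < (1 - γ) * M.normW (M.T (M.sieveFun J c)) := mul_pos (by linarith) hW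
    rw [qnorm_Gpsi hv hJ hs hd, div_le_div_iff₀ (hp.trans_le h1) (by linarith)]
    have ht : 0 ≤ M.tau J := zero_le_one.trans (one_le_tau hv hJ hs hd)
    nlinarith
  refine ⟨?_, ciSup_le hup⟩
  rw [tau, Real.mul_iSup_of_nonneg hA]
  · refine ciSup_mono ⟨_, by rintro _ ⟨c, rfl⟩; exact hup c⟩ fun c => le_trans ?_ (hr c).1
    refine mul_le_mul_of_nonneg_left ?_ hA
    rw [qnorm_Gpsi hv hJ hs hd]
    refine div_le_div_of_nonneg_left (normX_nonneg _) ?_ (qnorm_proj_sieveFun_le hv hJ hs hd c.1)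
    exact (mul_pos hs0 (qnorm_pos (hv.posDef_psi J hJ) c.2)).trans_le (hsS c.1)

include hv hJ h hs0 hst hsS ht0 hs1 in
theorem GramClose.VsupHat_bounds (hginv : NPIV.IsGeneralizedInverse ginv) (hs : M.IsSample)
    (hd : M.DataAssumption H) (hn : 0 < n) {γ η : ℝ} (hη0 : 0 ≤ η) (hη1 : η ≤ 1) (hγ0 : 0 ≤ γ)
    (hγ1 : γ ≤ η / 10) (hγ : M.instrumentError J ≤ γ * (M.tau J)⁻¹) (htη : t / s ≤ η / 10) :
    (1 - η) * M.Vsup n J ≤ M.VsupHat ginv n J ω ∧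
      M.VsupHat ginv n J ω ≤ (1 + η) * M.Vsup n J := by
  have htau := h.tauHat_bounds hv hJ ht0 hs0 hs1 hst hsS hginv hs hd hγ0 (by linarith) hγ
  have hn0 : (0 : ℝ) < n := by exact_mod_cast hn
  have he := e_pos hv hJ
  have hτ : 0 ≤ M.tau J := zero_le_one.trans (one_le_tau hv hJ hs hd)
  set x := η / 10
  have hts : t ≤ t / s := by rw [le_div_iff₀ hs0]; nlinarith
  have hts0 : 0 ≤ t / s := by positivity
  have hx : x ≤ 1 / 10 := by simp only [x]; linarith
  have hη : η = 10 * x := by simp only [x]; ring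
  have hx0 : 0 ≤ x := hts0.trans htη
  have he' := lambdaMin_bounds (hv.pos J hJ) (hv.posDef_psi J hJ)
    (isHermitian_smul_gram _ _ : (M.GpsiHat n J ω).IsHermitian) (by linarith) h.gpsi
  change (1 - t) * M.e J ≤ M.eHat n J ω ∧ M.eHat n J ω ≤ (1 + t) * M.e J at he'
  have hL : 0 ≤ Real.log n := Real.log_natCast_nonneg n
  have heh : 0 < M.eHat n J ω := lt_of_lt_of_le (mul_pos (by linarith) he) he'.1
  set R := √(Real.log n / (n * M.e J))
  set Rh := √(Real.log n / (n * M.eHat n J ω))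
  have hR0 : 0 ≤ R := Real.sqrt_nonneg _
  have hRh0 : 0 ≤ Rh := Real.sqrt_nonneg _
  have hR : Real.log n / (n * M.eHat n J ω) * M.eHat n J ω = Real.log n / (n * M.e J) * M.e J := by
    field_simp
  have hRs : R ^ 2 = Real.log n / (n * M.e J) := Real.sq_sqrt (by positivity)
  have hRhs : Rh ^ 2 = Real.log n / (n * M.eHat n J ω) := Real.sq_sqrt (by positivity)
  rw [← hRs, ← hRhs] at hR
  have l1 : R ≤ (1 + x) * Rh := by
    refine abs_le_of_sq_le_sq' ?_ (by positivity) |>.2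
    have : R ^ 2 * M.e J ≤ (1 + x) * Rh ^ 2 * M.e J := by
      rw [← hR]
      calc Rh ^ 2 * M.eHat n J ω ≤ Rh ^ 2 * ((1 + x) * M.e J) := by
            refine mul_le_mul_of_nonneg_left (he'.2.trans ?_) (sq_nonneg _)
            exact mul_le_mul_of_nonneg_right (by linarith) he.le
        _ = _ := by ring
    have := le_of_mul_le_mul_right this he
    nlinarith [sq_nonneg Rh, mul_nonneg hx0 (sq_nonneg Rh)]
  have l2 : (1 - x) * Rh ≤ R := by
    refine abs_le_of_sq_le_sq' ?_ hR0 |>.2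
    have : (1 - x) * Rh ^ 2 * M.e J ≤ R ^ 2 * M.e J := by
      rw [← hR]
      calc _ = Rh ^ 2 * ((1 - x) * M.e J) := by ring
        _ ≤ _ := by
            refine mul_le_mul_of_nonneg_left (le_trans ?_ he'.1) (sq_nonneg _)
            exact mul_le_mul_of_nonneg_right (by linarith) he.le
    have := le_of_mul_le_mul_right this he
    nlinarith [sq_nonneg Rh, mul_nonneg hx0 (sq_nonneg Rh)]
  set τh := M.tauHat ginv n J ω
  have hτh : 0 ≤ τh := le_trans (by
    refine mul_nonneg (div_nonneg ?_ ?_) hτ <;> linarith) htau.1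
  have t1 : (1 - x) * M.tau J ≤ (1 + x) * τh := by
    have h1 := htau.1
    rw [div_mul_eq_mul_div, div_le_iff₀ (by linarith)] at h1
    calc _ ≤ (1 - t) * M.tau J := mul_le_mul_of_nonneg_right (by linarith) hτ
      _ ≤ τh * (1 + t / s) := h1
      _ ≤ τh * (1 + x) := mul_le_mul_of_nonneg_left (by linarith) hτh
      _ = _ := mul_comm _ _
  have t2 : (1 - x) ^ 2 * τh ≤ (1 + x) * M.tau J := by
    have h1 := htau.2
    rw [div_div, div_mul_eq_mul_div, le_div_iff₀ (mul_pos (by linarith) (by linarith))] at h1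
    have h2 : (1 - x) ^ 2 ≤ (1 - t / s) * (1 - γ) := by
      rw [sq]
      exact mul_le_mul (by linarith) (by linarith) (by linarith) (by linarith)
    calc _ ≤ (1 - t / s) * (1 - γ) * τh := mul_le_mul_of_nonneg_right h2 hτh
      _ = τh * ((1 - t / s) * (1 - γ)) := mul_comm _ _
      _ ≤ (1 + t) * M.tau J := h1
      _ ≤ _ := mul_le_mul_of_nonneg_right (by linarith) hτ
  have hξ : 0 ≤ M.xi J := xi_nonneg
  obtain ⟨m1, m2⟩ := mul_bounds_of_ratio_bounds hx0 hx hτ hτh hR0 hRh0 t1 t2 l1 l2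
  rw [← hη] at m1 m2
  constructor
  · calc _ = (1 - η) * (M.tau J * R) * M.xi J := by simp only [Vsup, R]; ring
      _ ≤ τh * Rh * M.xi J := mul_le_mul_of_nonneg_right m1 hξ
      _ = _ := by simp only [VsupHat, τh, Rh]; ring
  · calc _ = τh * Rh * M.xi J := by simp only [VsupHat, τh, Rh]; ring
      _ ≤ (1 + η) * (M.tau J * R) * M.xi J := mul_le_mul_of_nonneg_right m2 hξ
      _ = _ := by simp only [Vsup, R]; ring

end Estimator

end NPIV.Model

/-! ### Concentration of the sample moments for one sieve dimension -/

namespace NPIV.Model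

variable {Ω : Type*} [MeasurableSpace Ω] {d dw : ℕ} {M : Model Ω d dw}
  {H : Set ((Fin d → ℝ) → ℝ)} {J : ℕ}

theorem IsSample.identDistrib_XW (hs : M.IsSample) (i : ℕ) :
    IdentDistrib (fun ω => (M.X i ω, M.W i ω)) (fun ω => (M.X 0 ω, M.W 0 ω)) M.μ M.μ :=
  (hs.ident i).comp measurable_snd

theorem IsSample.iIndepFun_XW (hs : M.IsSample) :
    iIndepFun (fun i ω => (M.X i ω, M.W i ω)) M.μ :=
  hs.indep.comp (fun _ => Prod.snd) fun _ => measurable_snd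

theorem ae_forall_memX (hs : M.IsSample) (hd : M.DataAssumption H) :
    ∀ᵐ ω ∂M.μ, ∀ i, M.X i ω ∈ M.suppX := by
  refine ae_all_iff.2 fun i => ?_
  have h : IdentDistrib (M.X i) (M.X 0) M.μ M.μ := (hs.identDistrib_XW i).comp measurable_fst
  exact h.symm.ae_snd (p := fun x => x ∈ M.suppX) measurableSet_Icc (ae_memX hs hd)

variable (M) in
/-- The standardized regressors, instruments and approximation error at one observation. -/
def stdVec (J : ℕ) (Ab : Matrix (Fin (M.K J)) (Fin (M.K J)) ℝ) (Ap : Matrix (Fin J) (Fin J) ℝ)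
    (v : (Fin d → ℝ) × (Fin dw → ℝ)) : Fin (M.K J) ⊕ Fin J ⊕ Unit → ℝ :=
  Sum.elim (Abᵀ *ᵥ fun k => M.b (M.K J) k v.2)
    (Sum.elim (Apᵀ *ᵥ fun k => M.psi J k v.1) fun _ => M.approxErr J v.1 / M.bias J)

theorem dotProduct_transpose_mulVec_comm {κ : Type*} [Fintype κ] (A : Matrix κ κ ℝ) (b a : κ → ℝ) :
    (Aᵀ *ᵥ b) ⬝ᵥ a = b ⬝ᵥ (A *ᵥ a) := by
  rw [dotProduct_mulVec, ← mulVec_transpose]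

theorem stdVec_dotProduct (Ab : Matrix (Fin (M.K J)) (Fin (M.K J)) ℝ)
    (Ap : Matrix (Fin J) (Fin J) ℝ) (v : (Fin d → ℝ) × (Fin dw → ℝ)) (a : Fin (M.K J) → ℝ)
    (c : Fin J → ℝ) (r : Unit → ℝ) :
    M.stdVec J Ab Ap v ⬝ᵥ Sum.elim a (Sum.elim c r) =
      M.instFun (M.K J) (Ab *ᵥ a) v.2 + M.sieveFun J (Ap *ᵥ c) v.1 +
        M.approxErr J v.1 / M.bias J * r () := by
  have h1 := dotProduct_transpose_mulVec_comm Ab (fun k => M.b (M.K J) k v.2) a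
  have h2 := dotProduct_transpose_mulVec_comm Ap (fun k => M.psi J k v.1) c
  simp only [dotProduct] at h1 h2
  simp only [stdVec, dotProduct, Fintype.sum_sum_type, Sum.elim_inl, Sum.elim_inr,
    Finset.univ_unique, Finset.sum_singleton, h1, h2, instFun, sieveFun, add_assoc]

theorem sum_elim_dotProduct_self (a : Fin (M.K J) → ℝ) (c : Fin J → ℝ) (r : Unit → ℝ) :
    Sum.elim a (Sum.elim c r) ⬝ᵥ Sum.elim a (Sum.elim c r) = a ⬝ᵥ a + (c ⬝ᵥ c + r () * r ()) := by
  simp [dotProduct, Fintype.sum_sum_type]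

section Concentration

variable (hv : M.IsSieve) (hJ : J ∈ M.Js)
include hv hJ

theorem abs_approxErr_div_le (hd : M.DataAssumption H) {x : Fin d → ℝ} (hx : x ∈ M.suppX) :
    |M.approxErr J x / M.bias J| ≤ 1 := by
  have hb : 0 ≤ M.bias J := supNorm_nonneg _
  rw [abs_div, abs_of_nonneg hb]
  exact div_le_one_of_le₀ (abs_approxErr_le hv hJ hd hx) (supNorm_nonneg _)

/-- Zero bias does no harm: the approximation error then vanishes on the support, as does the
quotient by 0 by convention. -/
theorem bias_mul_approxErr_div (hd : M.DataAssumption H) {x : Fin d → ℝ} (hx : x ∈ M.suppX) :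
    M.bias J * (M.approxErr J x / M.bias J) = M.approxErr J x := by
  rcases eq_or_ne (M.bias J) 0 with h | h
  · have h1 := abs_approxErr_le hv hJ hd hx
    rw [h] at h1
    rw [h, zero_mul, eq_comm]
    exact abs_nonpos_iff.1 h1
  · field_simp

theorem measurable_stdVec (hd : M.DataAssumption H) (Ab : Matrix (Fin (M.K J)) (Fin (M.K J)) ℝ)
    (Ap : Matrix (Fin J) (Fin J) ℝ) : Measurable (M.stdVec J Ab Ap) := by
  refine measurable_pi_lambda _ fun k => ?_
  rcases k with k | k | k
  · simp only [stdVec, Sum.elim_inl, mulVec, dotProduct]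
    exact Finset.measurable_sum _ fun l _ =>
      ((hv.measurable_b J hJ l).comp measurable_snd).const_mul _
  · simp only [stdVec, Sum.elim_inl, Sum.elim_inr, mulVec, dotProduct]
    exact Finset.measurable_sum _ fun l _ =>
      ((hv.measurable_psi J hJ l).comp measurable_fst).const_mul _
  · simp only [stdVec, Sum.elim_inr]
    exact ((bddX_approxErr hv hJ hd).1.comp measurable_fst).div_const _

variable (hs : M.IsSample) (hd : M.DataAssumption H)
include hs hd

/-- Standardized instruments, regressors and approximation error are stacked into one vector of
dimension K + J + 1, so a single Gram bound yields all four estimates. The three blocks give L = 3ζ²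
and m = 3, whence 4Lm = 36ζ² and the range t ≤ 6. -/
theorem measure_not_gramClose_le {n : ℕ} (hn : 0 < n) {ζ t : ℝ} (hζ : M.zeta J ≤ ζ) (ht : 0 < t)
    (ht6 : t ≤ 6) : M.μ {ω | ¬ M.GramClose n J t ω} ≤
      ENNReal.ofReal (2 * (M.K J + J + 1) * Real.exp (-(n * t ^ 2 / (36 * ζ ^ 2)))) := by
  have := hs.prob
  obtain ⟨Ab, hAb, hAbu⟩ := exists_conj_eq_one (hv.posDef_b J hJ)
  obtain ⟨Ap, hAp, hApu⟩ := exists_conj_eq_one (hv.posDef_psi J hJ)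
  have hms := measurable_stdVec hv hJ hd Ab Ap
  set z : ℕ → Ω → Fin (M.K J) ⊕ Fin J ⊕ Unit → ℝ := fun i ω => M.stdVec J Ab Ap (M.X i ω, M.W i ω)
  have hm : ∀ i, Measurable (z i) := fun i =>
    hms.comp ((hs.measurable_X i).prodMk (hs.measurable_W i))
  have hind : iIndepFun z M.μ := hs.iIndepFun_XW.comp (fun _ => M.stdVec J Ab Ap) fun _ => hms
  have hid : ∀ i, IdentDistrib (z i) (z 0) M.μ M.μ := fun i => (hs.identDistrib_XW i).comp hms
  have hb1 := one_le_zetaB hv hJ hs hd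
  have hζ1 : 1 ≤ ζ := hb1.trans ((le_max_left _ _).trans hζ)
  have hp0 : 0 ≤ M.zetaPsi J := Real.iSup_nonneg fun _ => Real.sqrt_nonneg _
  have hL : ∀ᵐ ω ∂M.μ, z 0 ω ⬝ᵥ z 0 ω ≤ 3 * ζ ^ 2 := by
    filter_upwards [ae_memX hs hd, ae_memW hs hd] with ω hX hW
    have e : z 0 ω ⬝ᵥ z 0 ω = _ := sum_elim_dotProduct_self _ _ _
    rw [e]
    have b1 := sum_sq_conj_b_le hv hJ hAb hW
    have b2 := sum_sq_conj_psi_le hv hJ hAp hX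
    have b3 := abs_approxErr_div_le hv hJ hd hX
    have b4 : M.zetaB (M.K J) ^ 2 ≤ ζ ^ 2 :=
      pow_le_pow_left₀ (by linarith) ((le_max_left _ _).trans hζ) 2
    have b5 : M.zetaPsi J ^ 2 ≤ ζ ^ 2 := pow_le_pow_left₀ hp0 ((le_max_right _ _).trans hζ) 2
    have b6 : (M.approxErr J (M.X 0 ω) / M.bias J) * (M.approxErr J (M.X 0 ω) / M.bias J) ≤ 1 := by
      nlinarith [abs_le.1 b3]
    nlinarith
  have hr : M.BddX fun x => M.approxErr J x / M.bias J :=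
    ⟨(bddX_approxErr hv hJ hd).1.div_const _, 1, fun x hx => abs_approxErr_div_le hv hJ hd hx⟩
  have hmom : ∀ x, ∫ ω, (z 0 ω ⬝ᵥ x) ^ 2 ∂M.μ ≤ 3 * (x ⬝ᵥ x) := fun x => by
    obtain ⟨a, c, r, rfl⟩ : ∃ a c r, x = Sum.elim a (Sum.elim c r) :=
      ⟨x ∘ Sum.inl, x ∘ Sum.inr ∘ Sum.inl, x ∘ Sum.inr ∘ Sum.inr, by
        ext k; rcases k with k | k | k <;> rfl⟩
    have i1 := integrable_WW hs hd (hv.bddW_instFun hJ (Ab *ᵥ a)) (hv.bddW_instFun hJ (Ab *ᵥ a))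
    have i2 := integrable_XX hs hd (hv.bddX_sieveFun hJ (Ap *ᵥ c)) (hv.bddX_sieveFun hJ (Ap *ᵥ c))
    have i3 := (integrable_XX hs hd hr hr).mul_const (r () * r ())
    have e1 := form_Gb hv hJ hs hd (Ab *ᵥ a) (Ab *ᵥ a)
    have e2 := form_Gpsi hv hJ hs hd (Ap *ᵥ c) (Ap *ᵥ c)
    rw [← qnorm_sq (hv.posDef_b J hJ).posSemidef, qnorm_mulVec_of_conj hAb,
      Real.sq_sqrt (dotProduct_self_nonneg' _)] at e1
    rw [← qnorm_sq (hv.posDef_psi J hJ).posSemidef, qnorm_mulVec_of_conj hAp,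
      Real.sq_sqrt (dotProduct_self_nonneg' _)] at e2
    have e3 : ∫ ω, M.approxErr J (M.X 0 ω) / M.bias J * (M.approxErr J (M.X 0 ω) / M.bias J) *
        (r () * r ()) ∂M.μ ≤ r () * r () := by
      calc _ ≤ ∫ _, r () * r () ∂M.μ := by
            refine integral_mono_ae i3 (integrable_const _) ?_
            filter_upwards [ae_memX hs hd] with ω hX
            have b3 := abs_le.1 (abs_approxErr_div_le hv hJ hd hX)
            refine mul_le_of_le_one_left (mul_self_nonneg _) ?_
            nlinarith
        _ = _ := by simp
    rw [sum_elim_dotProduct_self, e1, e2]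
    calc _ ≤ ∫ ω, 3 * (M.instFun (M.K J) (Ab *ᵥ a) (M.W 0 ω) * M.instFun (M.K J) (Ab *ᵥ a) (M.W 0 ω)
          + (M.sieveFun J (Ap *ᵥ c) (M.X 0 ω) * M.sieveFun J (Ap *ᵥ c) (M.X 0 ω) +
          M.approxErr J (M.X 0 ω) / M.bias J * (M.approxErr J (M.X 0 ω) / M.bias J) *
            (r () * r ()))) ∂M.μ := by
          refine integral_mono_of_nonneg (Eventually.of_forall fun ω => sq_nonneg _)
            ((i1.add (i2.add i3)).const_mul 3) (Eventually.of_forall fun ω => ?_)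
          simp only [z]
          rw [stdVec_dotProduct]
          set α := M.instFun (M.K J) (Ab *ᵥ a) (M.W 0 ω)
          set β := M.sieveFun J (Ap *ᵥ c) (M.X 0 ω)
          set γ := M.approxErr J (M.X 0 ω) / M.bias J
          nlinarith [sq_nonneg (α - β), sq_nonneg (α - γ * r ()), sq_nonneg (β - γ * r ())]
      _ = 3 * (∫ ω, M.instFun (M.K J) (Ab *ᵥ a) (M.W 0 ω) * M.instFun (M.K J) (Ab *ᵥ a) (M.W 0 ω) ∂M.μ
          + (∫ ω, M.sieveFun J (Ap *ᵥ c) (M.X 0 ω) * M.sieveFun J (Ap *ᵥ c) (M.X 0 ω) ∂M.μ +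
          ∫ ω, M.approxErr J (M.X 0 ω) / M.bias J * (M.approxErr J (M.X 0 ω) / M.bias J) *
            (r () * r ()) ∂M.μ)) := by
          rw [integral_const_mul, ← integral_add i2 i3]
          congr 1
          exact integral_add i1 (i2.add i3)
      _ ≤ _ := by linarith
  have hmain := measure_gram_bilin_gt_le hm hind hid hL (by positivity) (by norm_num : (0 : ℝ) < 3)
    hmom hn ht (by linarith)
  set bad := {ω | ∃ x y, t * √(x ⬝ᵥ x) * √(y ⬝ᵥ y) < |(n : ℝ)⁻¹ * ∑ i ∈ Finset.range n,
    (z i ω ⬝ᵥ x) * (z i ω ⬝ᵥ y) - ∫ ω, (z 0 ω ⬝ᵥ x) * (z 0 ω ⬝ᵥ y) ∂M.μ|}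
  have hnull : M.μ {ω | ¬ ∀ i, M.X i ω ∈ M.suppX} = 0 := ae_forall_memX hs hd
  -- Each estimate is the bilinear bound for test vectors supported on a single block. Points
  -- outside the support are excluded because undoing the division by the bias needs the bound on
  -- the approximation error.
  have hsub : {ω | ¬ M.GramClose n J t ω} ⊆ bad ∪ {ω | ¬ ∀ i, M.X i ω ∈ M.suppX} := by
    intro ω hω
    by_contra hcon
    simp only [Set.mem_union, not_or, bad, Set.mem_ofPred_eq, not_exists, not_lt, not_not] at hcon
    obtain ⟨hc, hX⟩ := hcon
    apply hω
    have nb : ∀ p, ∃ a, p = Ab *ᵥ a ∧ qnorm (M.Gb (M.K J)) p = √(a ⬝ᵥ a) := fun p => by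
      refine ⟨Ab⁻¹ *ᵥ p, ?_⟩
      have e : p = Ab *ᵥ (Ab⁻¹ *ᵥ p) := by
        rw [mulVec_mulVec, mul_nonsing_inv _ ((isUnit_iff_isUnit_det _).1 hAbu), one_mulVec]
      exact ⟨e, by rw [← qnorm_mulVec_of_conj hAb, ← e]⟩
    have np : ∀ p, ∃ a, p = Ap *ᵥ a ∧ qnorm (M.Gpsi J) p = √(a ⬝ᵥ a) := fun p => by
      refine ⟨Ap⁻¹ *ᵥ p, ?_⟩
      have e : p = Ap *ᵥ (Ap⁻¹ *ᵥ p) := by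
        rw [mulVec_mulVec, mul_nonsing_inv _ ((isUnit_iff_isUnit_det _).1 hApu), one_mulVec]
      exact ⟨e, by rw [← qnorm_mulVec_of_conj hAp, ← e]⟩
    have z1 : ∀ i ω a, z i ω ⬝ᵥ Sum.elim a (Sum.elim 0 0) = M.instFun (M.K J) (Ab *ᵥ a) (M.W i ω) :=
      fun i ω a => by
        simp only [z]
        rw [stdVec_dotProduct]
        simp [sieveFun]
    have z2 : ∀ i ω c, z i ω ⬝ᵥ Sum.elim 0 (Sum.elim c 0) = M.sieveFun J (Ap *ᵥ c) (M.X i ω) :=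
      fun i ω c => by simp [z, stdVec_dotProduct, instFun]
    have z3 : ∀ i ω, z i ω ⬝ᵥ Sum.elim 0 (Sum.elim 0 1) =
        M.approxErr J (M.X i ω) / M.bias J :=
      fun i ω => by simp [z, stdVec_dotProduct, instFun, sieveFun]
    constructor
    · intro p q
      obtain ⟨a, rfl, ha⟩ := nb p
      obtain ⟨a', rfl, ha'⟩ := nb q
      have := hc (Sum.elim a (Sum.elim 0 0)) (Sum.elim a' (Sum.elim 0 0))
      simp only [z1, sum_elim_dotProduct_self] at this
      rw [ha, ha', form_GbHat, form_Gb hv hJ hs hd]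
      simpa using this
    · intro p c
      obtain ⟨a, rfl, ha⟩ := nb p
      obtain ⟨a', rfl, ha'⟩ := np c
      have := hc (Sum.elim a (Sum.elim 0 0)) (Sum.elim 0 (Sum.elim a' 0))
      simp only [z1, z2, sum_elim_dotProduct_self] at this
      rw [ha, ha', form_SHat, S_mulVec hv hJ hs hd,
        dotProduct_moment hv hJ hs hd _ (hv.bddX_sieveFun hJ _)]
      simpa using this
    · intro p q
      obtain ⟨a, rfl, ha⟩ := np p
      obtain ⟨a', rfl, ha'⟩ := np q
      have := hc (Sum.elim 0 (Sum.elim a 0)) (Sum.elim 0 (Sum.elim a' 0))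
      simp only [z2, sum_elim_dotProduct_self] at this
      rw [ha, ha', form_GpsiHat, form_Gpsi hv hJ hs hd]
      simpa using this
    · intro q
      obtain ⟨a, rfl, ha⟩ := nb q
      have := hc (Sum.elim a (Sum.elim 0 0)) (Sum.elim 0 (Sum.elim 0 1))
      simp only [z1, z3, sum_elim_dotProduct_self] at this
      have hb0 : 0 ≤ M.bias J := supNorm_nonneg _
      rw [ha, dotProduct_sub, dotProduct_sampleMoment,
        dotProduct_moment hv hJ hs hd _ (bddX_approxErr hv hJ hd)]
      have e1 : (n : ℝ)⁻¹ * ∑ i ∈ Finset.range n,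
          M.instFun (M.K J) (Ab *ᵥ a) (M.W i ω) * M.approxErr J (M.X i ω) =
          M.bias J * ((n : ℝ)⁻¹ * ∑ i ∈ Finset.range n, M.instFun (M.K J) (Ab *ᵥ a) (M.W i ω) *
            (M.approxErr J (M.X i ω) / M.bias J)) := by
        simp only [Finset.mul_sum]
        refine Finset.sum_congr rfl fun i _ => ?_
        nth_rw 1 [← bias_mul_approxErr_div hv hJ hd (hX i)]
        ring
      have e2 : ∫ ω, M.instFun (M.K J) (Ab *ᵥ a) (M.W 0 ω) * M.approxErr J (M.X 0 ω) ∂M.μ =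
          M.bias J * ∫ ω, M.instFun (M.K J) (Ab *ᵥ a) (M.W 0 ω) *
            (M.approxErr J (M.X 0 ω) / M.bias J) ∂M.μ := by
        rw [← integral_const_mul]
        refine integral_congr_ae ?_
        filter_upwards [ae_memX hs hd] with ω hω
        nth_rw 1 [← bias_mul_approxErr_div hv hJ hd hω]
        ring
      rw [e1, e2, ← mul_sub, abs_mul, abs_of_nonneg hb0]
      calc _ ≤ M.bias J * (t * √(a ⬝ᵥ a)) := mul_le_mul_of_nonneg_left (by simpa using this) hb0
        _ = _ := by ring
  refine (measure_mono hsub).trans ((measure_union_le _ _).trans ?_)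
  rw [hnull, add_zero]
  refine hmain.trans (ENNReal.ofReal_le_ofReal (le_of_eq ?_))
  simp only [Fintype.card_sum, Fintype.card_fin, Fintype.card_unit]
  push_cast
  congr 2
  · ring
  · congr 1; ring

end Concentration

end NPIV.Model

/-! ### Uniformity over the index set -/

namespace NPIV

namespace Model

theorem tendsto_Jmin : Tendsto Jmin atTop atTop :=
  tendsto_nat_floor_atTop.comp (Real.tendsto_log_atTop.comp
    (Real.tendsto_log_atTop.comp tendsto_natCast_atTop_atTop))

variable {Ω : Type*} [MeasurableSpace Ω] {d dw : ℕ} {M : Model Ω d dw}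
  {H : Set ((Fin d → ℝ) → ℝ)} {Jbar : ℕ → ℕ}

/-- Since J_min → ∞, a property of all large sieve dimensions holds on the whole index set for large
n. -/
theorem eventually_forall_indexSet {p : ℕ → Prop} (hp : ∀ᶠ J in atTop ⊓ 𝓟 M.Js, p J) :
    ∀ᶠ n in atTop, ∀ j ∈ M.indexSet n (Jbar n), p j := by
  rw [eventually_inf_principal, eventually_atTop] at hp
  obtain ⟨J1, h1⟩ := hp
  filter_upwards [tendsto_Jmin.eventually_ge_atTop J1] with n hn j hj
  exact h1 j (hn.trans hj.2.1) hj.1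

/-- Raising Jbar^{2+ε} ≤ Cn to the power 2/(2+ε) gives κ = ε/(2+ε). This κ is the slack that keeps
the stochastic constant strictly below √2. -/
theorem SieveAssumption.exists_sq_le {δ : ℝ} (hg : M.SieveAssumption δ Jbar) :
    ∃ κ C : ℝ, 0 < κ ∧ κ ≤ 1 ∧ 0 < C ∧
      ∀ᶠ n : ℕ in atTop, (Jbar n : ℝ) ^ 2 ≤ C * (n : ℝ) ^ (1 - κ) := by
  obtain ⟨ε, hε, h⟩ := hg.dim
  obtain ⟨C, hC, h⟩ := h.exists_pos
  rw [IsBigOWith] at h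
  refine ⟨ε / (2 + ε), C ^ (2 / (2 + ε)), by positivity, by rw [div_le_one] <;> linarith,
    by positivity, ?_⟩
  filter_upwards [h, eventually_gt_atTop 0] with n hn h0
  have hn0 : (0 : ℝ) < n := by exact_mod_cast h0
  rw [norm_one, mul_one, Real.norm_of_nonneg (by positivity), div_le_iff₀ hn0] at hn
  have e : 1 - ε / (2 + ε) = 2 / (2 + ε) := by field_simp; ring
  rw [e, ← Real.mul_rpow hC.le hn0.le]
  calc (Jbar n : ℝ) ^ 2 = ((Jbar n : ℝ) ^ (2 + ε)) ^ (2 / (2 + ε)) := by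
        rw [← Real.rpow_mul (by positivity), mul_div_cancel₀ _ (by positivity), Real.rpow_two]
    _ ≤ _ := Real.rpow_le_rpow (by positivity) hn (by positivity)

open Classical in
variable (M) in
/-- The index set as a finite set. -/
def indexFinset (n top : ℕ) : Finset ℕ := (Finset.range (top + 1)).filter (· ∈ M.indexSet n top)

theorem mem_indexFinset {n top j : ℕ} : j ∈ M.indexFinset n top ↔ j ∈ M.indexSet n top := by
  simp only [indexFinset, Finset.mem_filter, Finset.mem_range, and_iff_right_iff_imp]
  exact fun h => Nat.lt_succ_of_le h.2.2

theorem card_indexFinset_le {n top : ℕ} (hv : M.IsSieve) : (M.indexFinset n top).card ≤ top := by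
  classical
  have : M.indexFinset n top ⊆ Finset.Icc 1 top := fun j hj => by
    have hj := mem_indexFinset.1 hj
    exact Finset.mem_Icc.2 ⟨hv.pos j hj.1, hj.2.2⟩
  simpa using Finset.card_le_card this

section Uniform

variable (hv : M.IsSieve) (hs : M.IsSample) (hd : M.DataAssumption H)
  (hmono : M.MonotoneAssumption Jbar) (hJb : ∀ n, Jbar n ∈ M.Js)
  (hJm : ∀ᶠ n in atTop, Jmin n ≤ Jbar n)

include hmono hJb hJm in
theorem eventually_zeta_tau_le : ∀ᶠ n in atTop, ∀ j ∈ M.indexSet n (Jbar n),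
    M.zeta j ≤ M.zeta (Jbar n) ∧ M.tau j ≤ M.tau (Jbar n) := by
  filter_upwards [hmono.zetaB, hmono.zetaPsi, hmono.tau, hJm] with n h1 h2 h3 h4 j hj
  have hm : Jbar n ∈ M.indexSet n (Jbar n) := ⟨hJb n, h4, le_rfl⟩
  exact ⟨max_le_max (h1 hj hm hj.2.2) (h2 hj hm hj.2.2), h3 hj hm hj.2.2⟩

theorem one_le_zeta {J : ℕ} (hv : M.IsSieve) (hJ : J ∈ M.Js) (hs : M.IsSample)
    (hd : M.DataAssumption H) : 1 ≤ M.zeta J :=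
  (one_le_zetaB hv hJ hs hd).trans (le_max_left _ _)

variable (M Jbar) in
/-- The rate of convergence of the sample moments. -/
def gramRate (n : ℕ) : ℝ := 9 * M.zeta (Jbar n) * √(Real.log n / n)

theorem SieveAssumption.tendsto_gramRate {δ : ℝ} (hg : M.SieveAssumption δ Jbar) :
    Tendsto (fun n => M.tau (Jbar n) * M.zeta (Jbar n) * M.gramRate Jbar n) atTop (𝓝 0) := by
  have := hg.tau_zeta.const_mul 9
  rw [mul_zero] at this
  refine this.congr fun n => ?_
  rw [gramRate]
  ring

include hv hs hd hmono hJb hJm in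
-- A union bound over at most Jbar dimensions, each failing with probability of order Jbar·n^{−2};
-- the total is O(1/n) as Jbar² = O(n).
theorem tendsto_measure_not_gramClose {δ : ℝ} (hg : M.SieveAssumption δ Jbar) :
    Tendsto (fun n => M.μ {ω | ¬ ∀ j ∈ M.indexSet n (Jbar n),
      M.GramClose n j (M.gramRate Jbar n) ω}) atTop (𝓝 0) := by
  have := hs.prob
  obtain ⟨κ, C, hκ, hκ1, hC, hcard⟩ := hg.exists_sq_le
  obtain ⟨CK, hCK, hK⟩ := hv.rule
  have hlim : Tendsto (fun n : ℕ => ENNReal.ofReal (2 * (CK + 2) * C * ((n : ℝ) ^ (1 : ℝ))⁻¹))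
      atTop (𝓝 0) := by
    rw [← ENNReal.ofReal_zero]
    refine ENNReal.tendsto_ofReal ?_
    have h := (tendsto_inv_atTop_zero.comp
      (tendsto_natCast_atTop_atTop (R := ℝ))).const_mul (2 * (CK + 2) * C)
    rw [mul_zero] at h
    refine h.congr fun n => ?_
    simp
  refine tendsto_of_tendsto_of_tendsto_of_le_of_le' tendsto_const_nhds hlim
    (Eventually.of_forall fun _ => zero_le) ?_
  filter_upwards [hcard, eventually_zeta_tau_le hmono hJb hJm,
    hg.tendsto_gramRate.eventually (gt_mem_nhds (by norm_num : (0 : ℝ) < 6)),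
    eventually_gt_atTop 1] with n h1 h2 h3 hn
  have hn0 : (0 : ℝ) < n := by exact_mod_cast (zero_lt_one.trans hn)
  have hn1 : (1 : ℝ) < n := by exact_mod_cast hn
  have hlog := Real.log_pos hn1
  have hz := one_le_zeta hv (hJb n) hs hd
  have hτ := one_le_tau hv (hJb n) hs hd
  set ζ := M.zeta (Jbar n)
  set t := M.gramRate Jbar n
  have ht : 0 < t := by simp only [t, gramRate]; positivity
  have ht6 : t ≤ 6 := by
    refine le_trans ?_ h3.le
    exact le_mul_of_one_le_left ht.le (one_le_mul_of_one_le_of_one_le hτ hz)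
  have hexp : Real.exp (-(n * t ^ 2 / (36 * ζ ^ 2))) ≤ ((n : ℝ) ^ 2)⁻¹ := by
    -- The constant 9 in `gramRate` makes the exponent 81/36 = 9/4, which exceeds 2.
    have e : n * t ^ 2 / (36 * ζ ^ 2) = 9 / 4 * Real.log n := by
      simp only [t, gramRate]
      rw [mul_pow, mul_pow, Real.sq_sqrt (by positivity)]
      field_simp
      ring
    rw [e, Real.exp_neg]
    refine inv_anti₀ (by positivity) ?_
    calc (n : ℝ) ^ 2 = Real.exp (2 * Real.log n) := by
          rw [mul_comm, Real.exp_mul, Real.exp_log hn0, Real.rpow_two]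
      _ ≤ _ := Real.exp_le_exp.2 (by linarith)
  have hsub : {ω | ¬ ∀ j ∈ M.indexSet n (Jbar n), M.GramClose n j t ω} ⊆
      ⋃ j ∈ M.indexFinset n (Jbar n), {ω | ¬ M.GramClose n j t ω} := by
    intro ω hω
    simp only [Set.mem_ofPred_eq, not_forall] at hω
    obtain ⟨j, hj, h⟩ := hω
    simp only [Set.mem_iUnion]
    exact ⟨j, mem_indexFinset.2 hj, h⟩
  refine (measure_mono hsub).trans ((measure_biUnion_finset_le _ _).trans ?_)
  have hterm : ∀ j ∈ M.indexFinset n (Jbar n), M.μ {ω | ¬ M.GramClose n j t ω} ≤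
      ENNReal.ofReal (2 * (CK + 2) * Jbar n * ((n : ℝ) ^ 2)⁻¹) := fun j hj => by
    have hj := mem_indexFinset.1 hj
    refine (measure_not_gramClose_le hv hj.1 hs hd (zero_lt_one.trans hn) (h2 j hj).1 ht ht6).trans
      (ENNReal.ofReal_le_ofReal ?_)
    have hjb : (j : ℝ) ≤ Jbar n := by exact_mod_cast hj.2.2
    have hb1 : (1 : ℝ) ≤ Jbar n := by exact_mod_cast hv.pos _ (hJb n)
    have hk := (hK j).2
    refine mul_le_mul ?_ hexp (Real.exp_pos _).le (by positivity)
    nlinarith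
  refine (Finset.sum_le_card_nsmul _ _ _ hterm).trans ?_
  rw [nsmul_eq_mul, ← ENNReal.ofReal_natCast, ← ENNReal.ofReal_mul (by positivity)]
  refine ENNReal.ofReal_le_ofReal ?_
  have hc : ((M.indexFinset n (Jbar n)).card : ℝ) ≤ Jbar n := by
    exact_mod_cast card_indexFinset_le hv
  have hpow : (n : ℝ) ^ (1 - κ) ≤ n := by
    calc (n : ℝ) ^ (1 - κ) ≤ (n : ℝ) ^ (1 : ℝ) := Real.rpow_le_rpow_of_exponent_le hn1.le (by linarith)
      _ = n := Real.rpow_one _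
  calc ((M.indexFinset n (Jbar n)).card : ℝ) * (2 * (CK + 2) * Jbar n * ((n : ℝ) ^ 2)⁻¹)
      ≤ Jbar n * (2 * (CK + 2) * Jbar n * ((n : ℝ) ^ 2)⁻¹) :=
        mul_le_mul_of_nonneg_right hc (by positivity)
    _ = 2 * (CK + 2) * ((n : ℝ) ^ 2)⁻¹ * (Jbar n : ℝ) ^ 2 := by ring
    _ ≤ 2 * (CK + 2) * ((n : ℝ) ^ 2)⁻¹ * (C * n) :=
        mul_le_mul_of_nonneg_left (h1.trans (mul_le_mul_of_nonneg_left hpow hC.le)) (by positivity)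
    _ = _ := by rw [Real.rpow_one]; field_simp

end Uniform

end Model

end NPIV

/-! ### Uniform control of the residual moments -/

theorem integral_mul_condExp_of_bdd {Ω : Type*} {m m0 : MeasurableSpace Ω} {μ : Measure Ω}
    [IsFiniteMeasure μ] (hm : m ≤ m0) {g f : Ω → ℝ} (hg : StronglyMeasurable[m] g) {C : ℝ}
    (hgC : ∀ᵐ ω ∂μ, |g ω| ≤ C) (hf : Integrable f μ) :
    Integrable (fun ω => g ω * f ω) μ ∧ Integrable (fun ω => g ω * (μ[f|m]) ω) μ ∧
      ∫ ω, g ω * (μ[f|m]) ω ∂μ = ∫ ω, g ω * f ω ∂μ := by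
  have h1 : Integrable (g * f) μ :=
    hf.bdd_mul (hg.mono hm).aestronglyMeasurable (c := C) (by simpa using hgC)
  have h2 : Integrable (g * μ[f|m]) μ :=
    integrable_condExp.bdd_mul (hg.mono hm).aestronglyMeasurable (c := C) (by simpa using hgC)
  refine ⟨h1, h2, ?_⟩
  have h := condExp_mul_of_stronglyMeasurable_left hg h1 hf
  calc _ = ∫ ω, (μ[g * f|m]) ω ∂μ := integral_congr_ae h.symm
    _ = _ := integral_condExp hm

namespace NPIV.Model

variable {Ω : Type*} [MeasurableSpace Ω] {d dw : ℕ} {M : Model Ω d dw}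
  {H : Set ((Fin d → ℝ) → ℝ)} {Jbar : ℕ → ℕ} {J : ℕ}

variable (M) in
/-- Instrument and residual. -/
def instRes (i : ℕ) (ω : Ω) : (Fin dw → ℝ) × ℝ := (M.W i ω, M.u i ω)

section Residual

variable (hs : M.IsSample)
include hs

theorem IsSample.measurable_u (i : ℕ) : Measurable (M.u i) :=
  (hs.measurable_Y i).sub (hs.measurable_h0.comp (hs.measurable_X i))

theorem IsSample.measurable_instRes (i : ℕ) : Measurable (M.instRes i) :=
  (hs.measurable_W i).prodMk (hs.measurable_u i)

theorem IsSample.measurable_toInstRes : Measurable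
    fun v : ℝ × (Fin d → ℝ) × (Fin dw → ℝ) => (v.2.2, v.1 - M.h0 v.2.1) :=
  (measurable_snd.comp measurable_snd).prodMk
    (measurable_fst.sub (hs.measurable_h0.comp (measurable_fst.comp measurable_snd)))

theorem IsSample.iIndepFun_instRes : iIndepFun M.instRes M.μ :=
  hs.indep.comp (fun _ v => (v.2.2, v.1 - M.h0 v.2.1)) fun _ => hs.measurable_toInstRes

theorem IsSample.identDistrib_instRes (i : ℕ) :
    IdentDistrib (M.instRes i) (M.instRes 0) M.μ M.μ :=
  (hs.ident i).comp hs.measurable_toInstRes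

theorem ResidualAssumption.integrable_u_sq {σ δ : ℝ} (hδ : 0 < δ)
    (hr : M.ResidualAssumption σ δ) : Integrable (fun ω => M.u 0 ω ^ 2) M.μ := by
  have := hs.prob
  refine (hr.moment.add (integrable_const (1 : ℝ))).mono'
    ((hs.measurable_u 0).pow_const 2).aestronglyMeasurable (Eventually.of_forall fun ω => ?_)
  rw [Real.norm_of_nonneg (sq_nonneg _), ← sq_abs, ← Real.rpow_two]
  simp only [Pi.add_apply]
  rcases le_total 1 |M.u 0 ω| with h | h
  · have := Real.rpow_le_rpow_of_exponent_le h (by linarith : (2 : ℝ) ≤ 2 + δ)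
    linarith
  · have h1 := Real.rpow_le_one (abs_nonneg _) h (by norm_num : (0 : ℝ) ≤ 2)
    have h2 : 0 ≤ |M.u 0 ω| ^ (2 + δ) := Real.rpow_nonneg (abs_nonneg _) _
    linarith

variable (hv : M.IsSieve) (hJ : J ∈ M.Js) (hd : M.DataAssumption H)
include hv hJ hd

theorem integral_instFun_mul_u (p : Fin (M.K J) → ℝ) :
    ∫ ω, M.instFun (M.K J) p (M.W 0 ω) * M.u 0 ω ∂M.μ = 0 := by
  have := hs.prob
  obtain ⟨_, C, _, h1⟩ := (hv.bddW_instFun hJ p).ae_bdd hs hd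
  rw [← (integral_mul_condExp_of_bdd (hs.measurable_W 0).comap_le
    (stronglyMeasurable_instFun hv hJ p) h1 hs.integrable_u).2.2]
  rw [integral_congr_ae (g := fun _ => 0), integral_zero]
  filter_upwards [hs.condExp_u] with ω hω
  rw [hω, Pi.zero_apply, mul_zero]

theorem integral_instFun_sq_mul_u_sq_le {σ δ : ℝ} (hδ : 0 < δ) (hr : M.ResidualAssumption σ δ)
    (p : Fin (M.K J) → ℝ) (hp : qnorm (M.Gb (M.K J)) p ≤ 1) :
    ∫ ω, M.instFun (M.K J) p (M.W 0 ω) ^ 2 * M.u 0 ω ^ 2 ∂M.μ ≤ σ ^ 2 := by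
  have := hs.prob
  obtain ⟨_, C, hC, h1⟩ := (hv.bddW_instFun hJ p).ae_bdd hs hd
  have h2 : ∀ᵐ ω ∂M.μ, |M.instFun (M.K J) p (M.W 0 ω) ^ 2| ≤ C ^ 2 := by
    filter_upwards [h1] with ω hω
    rw [abs_pow]
    exact pow_le_pow_left₀ (abs_nonneg _) hω 2
  have hsm : StronglyMeasurable[M.sigmaW] fun ω => M.instFun (M.K J) p (M.W 0 ω) ^ 2 :=
    (stronglyMeasurable_instFun hv hJ p).pow 2
  obtain ⟨_, i2, e⟩ := integral_mul_condExp_of_bdd (hs.measurable_W 0).comap_le hsm h2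
    (hr.integrable_u_sq hs hδ)
  have i3 := integrable_WW hs hd (hv.bddW_instFun hJ p) (hv.bddW_instFun hJ p)
  have e3 := form_Gb hv hJ hs hd p p
  rw [← qnorm_sq (hv.posDef_b J hJ).posSemidef] at e3
  rw [← e]
  calc _ ≤ ∫ ω, σ ^ 2 * (M.instFun (M.K J) p (M.W 0 ω) * M.instFun (M.K J) p (M.W 0 ω)) ∂M.μ := by
        refine integral_mono_ae i2 (i3.const_mul _) ?_
        filter_upwards [hr.condVar] with ω hω
        rw [mul_comm (σ ^ 2), ← sq]
        exact mul_le_mul_of_nonneg_left hω (sq_nonneg _)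
    _ = σ ^ 2 * qnorm (M.Gb (M.K J)) p ^ 2 := by rw [integral_const_mul, ← e3]
    _ ≤ σ ^ 2 * 1 := mul_le_mul_of_nonneg_left
        (pow_le_one₀ (qnorm_nonneg _ _) hp) (sq_nonneg _)
    _ = σ ^ 2 := mul_one _

end Residual

/-- Finitely many directions that control the dual norm of a vector and its two-stage least
squares coefficients. -/
theorem exists_test_directions (hs : M.IsSample) (hv : M.IsSieve) (hJ : J ∈ M.Js)
    (hd : M.DataAssumption H) {γ η : ℝ} (hγ0 : 0 ≤ γ) (hγ1 : γ < 1) (hη : 0 ≤ η)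
    (hγη : 1 ≤ (1 + η) * (1 - γ)) (hγ : M.instrumentError J ≤ γ * (M.tau J)⁻¹) :
    ∃ p : Fin J ⊕ Fin (M.K J) → Fin (M.K J) → ℝ,
      (∀ k, qnorm (M.Gb (M.K J)) (p k) ≤ 1) ∧
      ∀ v a, 0 ≤ a → (∀ k, |p k ⬝ᵥ v| ≤ a) →
        (∀ k, |tslsCoef (M.Gb (M.K J)) (M.S J) v k| ≤ (1 + η) * M.tau J / √(M.e J) * a) ∧
        ∀ q, |q ⬝ᵥ v| ≤ √(M.K J) * a * qnorm (M.Gb (M.K J)) q := by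
  have hτ := zero_lt_one.trans_le (one_le_tau hv hJ hs hd)
  have he := Real.sqrt_pos.2 (e_pos hv hJ)
  have hη1 : 0 < 1 + η := by linarith
  have h1γ : 0 < 1 - γ := by linarith
  obtain ⟨A, hA, hAu⟩ := exists_conj_eq_one (hv.posDef_b J hJ)
  choose r hr1 hr2 using exists_tslsCoef_row (hv.pos J hJ) (hv.posDef_b J hJ) (hv.posDef_psi J hJ)
    (fun c => S_injective hv hJ (c := c)) (div_pos h1γ hτ)
    (mul_qnorm_le_qnorm_proj hv hJ hs hd hγ0 hγ1.le hγ)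
  have hscale : ∀ (a : ℝ) (p : Fin (M.K J) → ℝ), 0 ≤ a →
      qnorm (M.Gb (M.K J)) (a • p) = a * qnorm (M.Gb (M.K J)) p := fun a p ha => by
    rw [qnorm, qnorm, mulVec_smul, dotProduct_smul, smul_dotProduct, smul_eq_mul, smul_eq_mul,
      ← mul_assoc, Real.sqrt_mul (mul_self_nonneg a), Real.sqrt_mul_self ha]
  set B := (1 + η) * M.tau J / √(M.e J)
  have hB : 0 < B := by positivity
  -- The J rows of the two-stage least squares matrix, shrunk by the bound B on their norms (here
  -- 1/(1 − γ) ≤ 1 + η enters), followed by the K orthonormal directions. The latter control the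
  -- dual norm at the price of √K.
  refine ⟨Sum.elim (fun k => B⁻¹ • r k) fun k => A *ᵥ Pi.single k 1, ?_, fun v a ha h => ⟨?_, ?_⟩⟩
  · rintro (k | k)
    · rw [Sum.elim_inl, hscale _ _ (inv_nonneg.2 hB.le), inv_mul_eq_div, div_le_one hB]
      refine (hr2 k).trans ?_
      change ((1 - γ) / M.tau J * √(M.e J))⁻¹ ≤ B
      rw [inv_le_iff_one_le_mul₀ (by positivity)]
      simp only [B]
      field_simp
      linarith
    · rw [Sum.elim_inr, qnorm_mulVec_of_conj hA]
      simp
  · intro k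
    have := h (Sum.inl k)
    rw [Sum.elim_inl, smul_dotProduct, smul_eq_mul, abs_mul, abs_of_pos (inv_pos.2 hB),
      inv_mul_eq_div, div_le_iff₀ hB, ← hr1] at this
    linarith
  · intro q
    set w := Aᵀ *ᵥ v
    have hw : ∀ k, |w k| ≤ a := fun k => by
      have := h (Sum.inr k)
      rwa [Sum.elim_inr, dotProduct_comm, ← dotProduct_transpose_mulVec_comm,
        dotProduct_single_one] at this
    have hq : q = A *ᵥ (A⁻¹ *ᵥ q) := by
      rw [mulVec_mulVec, mul_nonsing_inv _ ((isUnit_iff_isUnit_det _).1 hAu), one_mulVec]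
    set y := A⁻¹ *ᵥ q
    have e1 : q ⬝ᵥ v = w ⬝ᵥ y := by
      rw [hq, dotProduct_comm, ← dotProduct_transpose_mulVec_comm]
    have e2 : qnorm (M.Gb (M.K J)) q = √(y ⬝ᵥ y) := by rw [hq, qnorm_mulVec_of_conj hA]
    rw [e1, e2, ← Real.sqrt_sq ha, ← Real.sqrt_mul (Nat.cast_nonneg _),
      ← Real.sqrt_mul (mul_nonneg (Nat.cast_nonneg _) (sq_nonneg _))]
    refine Real.abs_le_sqrt ((dotProduct_sq_le w y).trans ?_)
    refine mul_le_mul_of_nonneg_right ?_ (dotProduct_self_nonneg' _)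
    calc w ⬝ᵥ w ≤ ∑ _k : Fin (M.K J), a ^ 2 := by
          refine Finset.sum_le_sum fun k _ => ?_
          rw [← sq]
          exact sq_le_sq' (abs_le.1 (hw k)).1 (abs_le.1 (hw k)).2
      _ = _ := by simp

section Uniform

variable (hv : M.IsSieve) (hs : M.IsSample) (hd : M.DataAssumption H)
  (hmono : M.MonotoneAssumption Jbar) (hJb : ∀ n, Jbar n ∈ M.Js)
  (hJm : ∀ᶠ n in atTop, Jmin n ≤ Jbar n)

include hv hs hd hmono hJb hJm in
-- The test directions over all dimensions number at most (1 + C_K)Jbar² = O(n^{1−κ}), and each has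
-- variance at most σ², so the uniform bound for weighted residual sums applies to all of them
-- together.
theorem tendsto_measure_residual {σ δ : ℝ} (hσ : 0 < σ) (hδ : 0 < δ)
    (hg : M.SieveAssumption δ Jbar) (hr : M.ResidualAssumption σ δ) {κ C : ℝ} (hκ : 0 < κ)
    (hκ1 : κ ≤ 1) (hC : ∀ᶠ n : ℕ in atTop, (Jbar n : ℝ) ^ 2 ≤ C * (n : ℝ) ^ (1 - κ))
    {η γ : ℝ} (hη : 0 < η) (hη1 : η ≤ 1 / 20) (hηκ : η ≤ κ / 40) (hγ0 : 0 ≤ γ) (hγ1 : γ < 1)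
    (hγη : 1 ≤ (1 + η) * (1 - γ))
    (hγ : ∀ᶠ n in atTop, ∀ j ∈ M.indexSet n (Jbar n), M.instrumentError j ≤ γ * (M.tau j)⁻¹) :
    Tendsto (fun n => M.μ {ω | ¬ ∀ j ∈ M.indexSet n (Jbar n),
      (∀ k, |tslsCoef (M.Gb (M.K j)) (M.S j) (M.sampleMoment n (M.K j) ω fun i => M.u i ω) k| ≤
        (1 + η) * M.tau j / √(M.e j) * (√2 * (1 - 4 * η) * σ * √(Real.log n / n))) ∧
      ∀ q, |q ⬝ᵥ M.sampleMoment n (M.K j) ω fun i => M.u i ω| ≤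
        √(M.K j) * (√2 * (1 - 4 * η) * σ * √(Real.log n / n)) * qnorm (M.Gb (M.K j)) q})
      atTop (𝓝 0) := by
  classical
  have := hs.prob
  obtain ⟨CK, hCK, hK⟩ := hv.rule
  have hex : ∀ j, ∃ p : Fin j ⊕ Fin (M.K j) → Fin (M.K j) → ℝ,
      j ∈ M.Js → M.instrumentError j ≤ γ * (M.tau j)⁻¹ →
      (∀ k, qnorm (M.Gb (M.K j)) (p k) ≤ 1) ∧
      ∀ v a, 0 ≤ a → (∀ k, |p k ⬝ᵥ v| ≤ a) →
        (∀ k, |tslsCoef (M.Gb (M.K j)) (M.S j) v k| ≤ (1 + η) * M.tau j / √(M.e j) * a) ∧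
        ∀ q, |q ⬝ᵥ v| ≤ √(M.K j) * a * qnorm (M.Gb (M.K j)) q := fun j => by
    by_cases hj : j ∈ M.Js ∧ M.instrumentError j ≤ γ * (M.tau j)⁻¹
    · obtain ⟨p, hp⟩ := exists_test_directions hs hv hj.1 hd hγ0 hγ1 hη.le hγη hj.2
      exact ⟨p, fun _ _ => hp⟩
    · exact ⟨0, fun h1 h2 => (hj ⟨h1, h2⟩).elim⟩
  choose p hp using hex
  set F : ℕ → Finset (Σ j : ℕ, Fin j ⊕ Fin (M.K j)) := fun n =>
    (M.indexFinset n (Jbar n)).sigma fun _ => Finset.univ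
  set q : (Σ j : ℕ, Fin j ⊕ Fin (M.K j)) → (Fin dw → ℝ) → ℝ :=
    fun x => M.instFun (M.K x.1) (p x.1 x.2)
  have hF : ∀ {n f}, f ∈ F n → f.1 ∈ M.indexSet n (Jbar n) := fun {n f} hf =>
    mem_indexFinset.1 (Finset.mem_sigma.1 hf).1
  -- With ρ = 1 − 5η and excess √2η the level is √2(1 − 4η). The requirement ρ² ≥ 1 − κ/4 follows
  -- from η ≤ κ/40.
  have hmain := tendsto_measure_exists_weighted_sum_gt (V := M.instRes) (μ := M.μ) (F := F) (q := q)
    (Z := fun n => M.zeta (Jbar n)) (σ := σ) (δ := δ) (C := C * (1 + CK)) (κ := κ)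
    (ρ := 1 - 5 * η) (η := √2 * η) hs.measurable_instRes hs.iIndepFun_instRes
    hs.identDistrib_instRes hσ hδ hκ hκ1 (by linarith) (by linarith) (by nlinarith)
    (by positivity)
    (Eventually.of_forall fun n f hf => (hv.bddW_instFun (hF hf).1 _).1)
    (Eventually.of_forall fun n => zero_lt_one.trans_le (one_le_zeta hv (hJb n) hs hd))
    (by
      filter_upwards [hγ, eventually_zeta_tau_le hmono hJb hJm] with n h1 h2 f hf
      have hj := hF hf
      filter_upwards [ae_memW hs hd] with ω hW
      refine (abs_instFun_le_zetaB hv hj.1 _ hW).trans ?_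
      have hz : M.zetaB (M.K f.1) ≤ M.zeta (Jbar n) := (le_max_left _ _).trans (h2 _ hj).1
      have hz0 : 0 ≤ M.zetaB (M.K f.1) := zero_le_one.trans (one_le_zetaB hv hj.1 hs hd)
      exact (mul_le_of_le_one_right hz0 ((hp f.1 hj.1 (h1 _ hj)).1 _)).trans hz)
    (hr.integrable_u_sq hs hδ) hr.moment
    (by
      filter_upwards [hγ] with n h1 f hf
      have hj := hF hf
      exact integral_instFun_sq_mul_u_sq_le hs hv hj.1 hd hδ hr _ ((hp f.1 hj.1 (h1 _ hj)).1 _))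
    (Eventually.of_forall fun n f hf => integral_instFun_mul_u hs hv (hF hf).1 hd _)
    hg.moment
    (by
      filter_upwards [hC] with n h1
      have hc : ((M.indexFinset n (Jbar n)).card : ℝ) ≤ Jbar n := by
        exact_mod_cast card_indexFinset_le hv
      calc ((F n).card : ℝ) = ∑ j ∈ M.indexFinset n (Jbar n), ((j : ℝ) + M.K j) := by
            simp [F, Finset.card_sigma]
        _ ≤ ∑ j ∈ M.indexFinset n (Jbar n), (1 + CK) * Jbar n := by
            refine Finset.sum_le_sum fun j hj => ?_
            have hjb : (j : ℝ) ≤ Jbar n := by exact_mod_cast (mem_indexFinset.1 hj).2.2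
            have := (hK j).2
            nlinarith
        _ = (M.indexFinset n (Jbar n)).card * ((1 + CK) * Jbar n) := by simp
        _ ≤ Jbar n * ((1 + CK) * Jbar n) := mul_le_mul_of_nonneg_right hc (by positivity)
        _ = (1 + CK) * (Jbar n : ℝ) ^ 2 := by ring
        _ ≤ (1 + CK) * (C * (n : ℝ) ^ (1 - κ)) := mul_le_mul_of_nonneg_left h1 (by linarith)
        _ = _ := by ring)
  refine tendsto_of_tendsto_of_tendsto_of_le_of_le' tendsto_const_nhds hmain
    (Eventually.of_forall fun _ => zero_le) ?_
  filter_upwards [hγ] with n h1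
  refine measure_mono fun ω hω => ?_
  by_contra hcon
  apply hω
  intro j hj
  refine (hp j hj.1 (h1 j hj)).2 _ _ ?_ fun k => ?_
  · have : 0 ≤ 1 - 4 * η := by linarith
    positivity
  · simp only [Set.mem_ofPred_eq, not_exists, not_and, not_lt] at hcon
    have := hcon ⟨j, k⟩ (Finset.mem_sigma.2 ⟨mem_indexFinset.2 hj, Finset.mem_univ _⟩)
    rw [dotProduct_sampleMoment]
    refine this.trans (le_of_eq ?_)
    ring

end Uniform

end NPIV.Model

/-- With s = 1/(2τ), every part of the perturbation bound carries a factor τzt, τt or τζt, all at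
most D. The bias enters multiplied by D; the residuals leave D times τzR, which is dominated by
V_sup. -/
theorem remainder_le {τ z ζ t R D b Cs σ : ℝ} (hτ : 1 ≤ τ) (hz0 : 0 ≤ z) (hz : z ≤ ζ) (hζ : 1 ≤ ζ)
    (ht : 0 ≤ t) (hR : 0 ≤ R) (hD : τ * ζ * t ≤ D) (hb : 0 ≤ b) (hCs : 0 ≤ Cs) (hσ : 0 ≤ σ) :
    z * (12 * t * (Cs * b / τ + 2 * σ * ζ * R + t * b) / (1 / (2 * τ)) ^ 2 +
      t * b / (1 / (2 * τ))) ≤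
    b * (48 * Cs * D + 48 * (D * D) + 2 * D) + 96 * σ * D * (τ * z * R) := by
  have hτ0 : 0 < τ := by linarith
  have h1 : τ * z * t ≤ D := le_trans (by gcongr) hD
  have h2 : τ * t ≤ D := by
    refine le_trans ?_ hD
    calc τ * t = τ * 1 * t := by ring
      _ ≤ τ * ζ * t := by gcongr
  have hD0 : 0 ≤ D := le_trans (by positivity) h2
  calc _ = b * (48 * Cs * (τ * z * t) + 48 * ((τ * t) * (τ * z * t)) + 2 * (τ * z * t)) +
        96 * σ * (τ * ζ * t) * (τ * z * R) := by
        field_simp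
        ring
    _ ≤ _ := by gcongr

/-! ### The event of uniform bounds -/

namespace NPIV.Model

variable {Ω : Type*} [MeasurableSpace Ω] {d dw : ℕ} {M : Model Ω d dw}
  {H : Set ((Fin d → ℝ) → ℝ)} {Jbar : ℕ → ℕ} {J : ℕ}
  {ginv : (m : ℕ) → Matrix (Fin m) (Fin m) ℝ → Matrix (Fin m) (Fin m) ℝ}

theorem Vsup_eq (n J : ℕ) :
    M.Vsup n J = M.tau J * (M.xi J / √(M.e J)) * √(Real.log n / n) := by
  rw [Vsup, ← div_div, Real.sqrt_div (div_nonneg (Real.log_natCast_nonneg n) (Nat.cast_nonneg n))]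
  ring

theorem Vsup_nonneg (hv : M.IsSieve) (hs : M.IsSample) (hd : M.DataAssumption H) (hJ : J ∈ M.Js)
    (n : ℕ) : 0 ≤ M.Vsup n J :=
  mul_nonneg (mul_nonneg (zero_le_one.trans (one_le_tau hv hJ hs hd)) xi_nonneg)
    (Real.sqrt_nonneg _)

theorem ApproxAssumption.eventually_normW_le (happrox : M.ApproxAssumption) (hv : M.IsSieve)
    (hs : M.IsSample) (hd : M.DataAssumption H) :
    ∃ C : ℝ, 0 ≤ C ∧ ∀ᶠ J in atTop ⊓ 𝓟 M.Js, M.normW (M.T (M.approxErr J)) ≤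
      C * M.bias J / M.tau J := by
  obtain ⟨C, hC, h⟩ := happrox.stable_L2.exists_pos
  rw [IsBigOWith] at h
  refine ⟨C, hC.le, ?_⟩
  filter_upwards [h, mem_inf_of_right (mem_principal_self _)] with J hJ hJs
  have hτ := zero_lt_one.trans_le (one_le_tau hv hJs hs hd)
  rw [le_div_iff₀ hτ, mul_comm]
  have h1 := (le_abs_self _).trans hJ
  rw [Real.norm_of_nonneg (normX_nonneg _)] at h1
  exact h1.trans (mul_le_mul_of_nonneg_left (normX_approxErr_le hv hJs hs hd) hC.le)

theorem ApproxAssumption.eventually_supNorm_le (happrox : M.ApproxAssumption) :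
    ∃ C : ℝ, 0 ≤ C ∧ ∀ᶠ J in atTop ⊓ 𝓟 M.Js,
      M.supNorm (fun x => M.proj2SLS J M.h0 x - M.projPsi J M.h0 x) ≤ C * M.bias J := by
  obtain ⟨C, hC, h⟩ := happrox.stable_sup.exists_pos
  rw [IsBigOWith] at h
  refine ⟨C, hC.le, ?_⟩
  filter_upwards [h] with J hJ
  have hb : 0 ≤ M.bias J := supNorm_nonneg _
  have h1 := (le_abs_self _).trans hJ
  rwa [Real.norm_of_nonneg hb] at h1

theorem ApproxAssumption.eventually_instrumentError_le (happrox : M.ApproxAssumption)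
    (hv : M.IsSieve) (hs : M.IsSample) (hd : M.DataAssumption H) {γ : ℝ} (hγ : 0 < γ) :
    ∀ᶠ J in atTop ⊓ 𝓟 M.Js, M.instrumentError J ≤ γ * (M.tau J)⁻¹ := by
  filter_upwards [happrox.instrument.def hγ, mem_inf_of_right (mem_principal_self _)] with J hJ hJs
  have hτ := zero_lt_one.trans_le (one_le_tau hv hJs hs hd)
  have h1 := (le_abs_self _).trans hJ
  rwa [Real.norm_of_nonneg (inv_nonneg.2 hτ.le)] at h1

/-- The event on which the estimators and the estimated standard deviations behave well
uniformly over the index set. -/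
def UniformBounds (M : Model Ω d dw)
    (ginv : (m : ℕ) → Matrix (Fin m) (Fin m) ℝ → Matrix (Fin m) (Fin m) ℝ) (σ C η : ℝ)
    (n top : ℕ) (ω : Ω) : Prop :=
  ∀ j ∈ M.indexSet n top,
    M.loss ginv n j ω ≤ C * M.bias j + √2 * (1 - 2 * η) * σ * M.Vsup n j ∧
    (1 - η) * M.Vsup n j ≤ M.VsupHat ginv n j ω ∧ M.VsupHat ginv n j ω ≤ (1 + η) * M.Vsup n j

/-- Closeness of the moments and the residual bound together imply the event. The constants depend
on `Jbar` but on neither `Jlow` nor the random maximum. -/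
theorem exists_tendsto_measure_not_uniformBounds (hginv : NPIV.IsGeneralizedInverse ginv)
    (hs : M.IsSample) (hv : M.IsSieve) (hd : M.DataAssumption H) {σ δ : ℝ} (hσ : 0 < σ)
    (hδ : 0 < δ) (hr : M.ResidualAssumption σ δ) (hg : M.SieveAssumption δ Jbar)
    (happrox : M.ApproxAssumption) (hmono : M.MonotoneAssumption Jbar) :
    ∃ C η : ℝ, 0 < C ∧ 0 < η ∧ η ≤ 1 / 20 ∧ ((∀ n, Jbar n ∈ M.Js) →
      (∀ᶠ n in atTop, Jmin n ≤ Jbar n) →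
      Tendsto (fun n => M.μ {ω | ¬ M.UniformBounds ginv σ C η n (Jbar n) ω}) atTop (𝓝 0)) := by
  have := hs.prob
  obtain ⟨κ, Cκ, hκ, hκ1, -, hcard⟩ := hg.exists_sq_le
  obtain ⟨Cs, hCs, hstab⟩ := happrox.eventually_normW_le hv hs hd
  obtain ⟨Ct, hCt, hsup⟩ := happrox.eventually_supNorm_le
  set η : ℝ := min (1 / 20) (κ / 40)
  have hη : 0 < η := lt_min (by norm_num) (by positivity)
  have hη1 : η ≤ 1 / 20 := min_le_left _ _
  set γ := η / 10
  have hγ0 : 0 < γ := by positivity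
  have hγη : 10 * γ = η := by simp only [γ]; ring
  refine ⟨2 + Ct, η, by positivity, hη, hη1, fun hJb hJm => ?_⟩
  have hins : ∀ᶠ n in atTop, ∀ j ∈ M.indexSet n (Jbar n), _ :=
    eventually_forall_indexSet (happrox.eventually_instrumentError_le hv hs hd hγ0)
  have hgram := tendsto_measure_not_gramClose hv hs hd hmono hJb hJm hg
  have hres := tendsto_measure_residual hv hs hd hmono hJb hJm hσ hδ hg hr hκ hκ1 hcard hη hη1
    (min_le_right _ _) hγ0.le (by linarith)
    (by simp only [γ]; linarith [mul_le_mul_of_nonneg_left hη1 hη.le]) hins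
  have hsum := hgram.add hres
  rw [add_zero] at hsum
  refine tendsto_of_tendsto_of_tendsto_of_le_of_le' tendsto_const_nhds hsum
    (Eventually.of_forall fun _ => zero_le) ?_
  -- The first bound makes the residual part of the remainder at most √2ησV, since 96D ≤ η. The
  -- second keeps its bias part below one bias.
  have hD0 : 0 < min (η / 100) (1 / (48 * Cs + 50)) := lt_min (by positivity) (by positivity)
  filter_upwards [hins, eventually_forall_indexSet (Jbar := Jbar) hstab,
    eventually_forall_indexSet (Jbar := Jbar) hsup, eventually_zeta_tau_le hmono hJb hJm,
    hg.tendsto_gramRate.eventually (gt_mem_nhds hD0), eventually_gt_atTop 0] with n a1 a2 a3 a4 a5 hn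
  refine le_trans (measure_mono fun ω hω => ?_) (measure_union_le _ _)
  by_contra hcon
  simp only [Set.mem_union, Set.mem_ofPred_eq, not_or, not_not] at hcon
  obtain ⟨hclose, hresid⟩ := hcon
  apply hω
  intro j hj
  have hJ := hj.1
  set ζ := M.zeta (Jbar n)
  set R := √(Real.log n / n)
  set t := M.gramRate Jbar n
  set D := min (η / 100) (1 / (48 * Cs + 50))
  have hζ1 : 1 ≤ ζ := one_le_zeta hv (hJb n) hs hd
  have hR : 0 ≤ R := Real.sqrt_nonneg _
  have ht : 0 ≤ t := by simp only [t, gramRate]; positivity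
  have hτ1 := one_le_tau hv hJ hs hd
  set τ := M.tau j
  have hτ0 : 0 < τ := zero_lt_one.trans_le hτ1
  have hDt : τ * ζ * t ≤ D := le_trans (by gcongr; exact (a4 j hj).2) a5.le
  have hτt : τ * t ≤ D := by
    refine le_trans ?_ hDt
    calc τ * t = τ * 1 * t := by ring
      _ ≤ τ * ζ * t := by gcongr
  have hDη : D ≤ η / 100 := min_le_left _ _
  have hDC : D * (48 * Cs + 50) ≤ 1 := by
    rw [← le_div_iff₀ (by positivity)]
    exact min_le_right _ _
  have hz0 : 0 ≤ M.zetaPsi j := Real.iSup_nonneg fun _ => Real.sqrt_nonneg _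
  have hz : M.zetaPsi j ≤ ζ := (le_max_right _ _).trans (a4 j hj).1
  have hzb : M.zetaB (M.K j) ≤ ζ := (le_max_left _ _).trans (a4 j hj).1
  have hb : 0 ≤ M.bias j := supNorm_nonneg _
  have hV0 := Vsup_nonneg hv hs hd hJ n
  have hc := hclose j hj
  set s := 1 / (2 * τ)
  have hs0 : 0 < s := by positivity
  have hs1 : s ≤ 1 := by
    simp only [s]
    rw [div_le_one (by positivity)]
    linarith
  have hts : t / s ≤ 2 * D := by
    simp only [s]
    calc t / (1 / (2 * τ)) = 2 * (τ * t) := by field_simp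
      _ ≤ 2 * D := by linarith
  have hst : t ≤ s / 2 := by
    rw [div_le_iff₀ hs0] at hts
    have : 2 * D * s ≤ 1 / 2 * s := mul_le_mul_of_nonneg_right (by linarith) hs0.le
    linarith
  have hsS : ∀ c, s * qnorm (M.Gpsi j) c ≤
      qnorm (M.Gb (M.K j)) ((M.Gb (M.K j))⁻¹ *ᵥ (M.S j *ᵥ c)) := fun c => by
    refine le_trans ?_ (mul_qnorm_le_qnorm_proj hv hJ hs hd hγ0.le (by linarith) (a1 j hj) c)
    refine mul_le_mul_of_nonneg_right ?_ (qnorm_nonneg _ _)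
    simp only [s]
    rw [div_le_div_iff₀ (by positivity) hτ0]
    have : 1 * τ ≤ (1 - γ) * 2 * τ := mul_le_mul_of_nonneg_right (by linarith) hτ0.le
    linarith
  refine ⟨?_, hc.VsupHat_bounds hv hJ ht hs0 hs1 hst hsS hginv hs hd hn hη.le (by linarith) hγ0.le
    le_rfl (a1 j hj) (by linarith)⟩
  obtain ⟨hcu, hVu⟩ := hresid j hj
  set a := (1 + η) * τ / √(M.e j) * (√2 * (1 - 4 * η) * σ * R)
  have h14 : 0 ≤ 1 - 4 * η := by linarith
  have ha : 0 ≤ a := by positivity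
  have hVu' : ∀ q, |q ⬝ᵥ M.sampleMoment n (M.K j) ω fun i => M.u i ω| ≤
      2 * σ * ζ * R * qnorm (M.Gb (M.K j)) q := fun q => by
    refine (hVu q).trans (mul_le_mul_of_nonneg_right ?_ (qnorm_nonneg _ _))
    have k1 : √(M.K j) ≤ ζ := by
      rw [Real.sqrt_le_left (by linarith)]
      exact (card_le_zetaB_sq hv hJ hs hd).trans (pow_le_pow_left₀
        (zero_le_one.trans (one_le_zetaB hv hJ hs hd)) hzb 2)
    have k2 : √2 * (1 - 4 * η) ≤ 2 := by
      have : √2 ≤ 2 := by rw [Real.sqrt_le_left (by norm_num)]; norm_num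
      exact (mul_le_of_le_one_right (Real.sqrt_nonneg 2) (by linarith)).trans this
    calc _ ≤ ζ * (2 * σ * R) := by gcongr
      _ = _ := by ring
  have hbias := supNorm_nonneg (M := M) fun x => M.proj2SLS j M.h0 x - M.projPsi j M.h0 x
  have hrem := remainder_le (σ := σ) (b := M.bias j) hτ1 hz0 hz hζ1 ht hR hDt hb hCs hσ.le
  have hζV : τ * M.zetaPsi j * R ≤ M.Vsup n j := by
    rw [Vsup_eq]
    gcongr
    exact zetaPsi_le_xi_div hv hJ
  -- Here (1 + η)(1 − 4η) ≤ 1 − 3η. The remainder adds η, leaving 1 − 2η.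
  have hxa : M.xi j * a ≤ √2 * σ * (1 - 3 * η) * M.Vsup n j := by
    calc M.xi j * a = √2 * σ * ((1 + η) * (1 - 4 * η)) * M.Vsup n j := by
          rw [Vsup_eq]; simp only [a, R]; ring
      _ ≤ _ := by gcongr; linarith [mul_self_nonneg η]
  have hD00 : 0 ≤ D := hD0.le
  have hDD : 48 * Cs * D + 48 * (D * D) + 2 * D ≤ 1 := by
    have : D * D ≤ D := mul_le_of_le_one_left hD00 (by linarith)
    linarith
  have h2 : (1 : ℝ) ≤ √2 := by rw [Real.one_le_sqrt]; norm_num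
  have hsmall : 96 * σ * D * (τ * M.zetaPsi j * R) ≤ √2 * σ * η * M.Vsup n j := by
    refine mul_le_mul ?_ hζV (by positivity) (by positivity)
    calc 96 * σ * D = σ * (96 * D) := by ring
      _ ≤ σ * η := by gcongr; linarith
      _ = 1 * σ * η := by ring
      _ ≤ √2 * σ * η := by gcongr
  have htotal : M.zetaPsi j * (12 * t * (Cs * M.bias j / τ + 2 * σ * ζ * R + t * M.bias j) / s ^ 2 +
      t * M.bias j / s) + M.supNorm (fun x => M.proj2SLS j M.h0 x - M.projPsi j M.h0 x) +
      M.xi j * a + M.bias j ≤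
      (2 + Ct) * M.bias j + √2 * (1 - 2 * η) * σ * M.Vsup n j := by
    refine (add_le_add_left (add_le_add (add_le_add hrem (a3 j hj)) hxa) _).trans ?_
    have := mul_le_mul_of_nonneg_left hDD hb
    linarith
  refine supNorm_le (by
    have : 0 ≤ 1 - 2 * η := by linarith
    positivity) fun x hx => ?_
  exact (hc.abs_hHat_sub_le hv hJ ht hs0 hs1 hst hsS hginv hs hd hn (by positivity) (by positivity) ha
    (a2 j hj) hVu' hcu hx).trans htotal

end NPIV.Model

/-! ### The oracle inequality -/

namespace NPIV.Model

variable {Ω : Type*} [MeasurableSpace Ω] {d dw : ℕ} {M : Model Ω d dw}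
  {H : Set ((Fin d → ℝ) → ℝ)} {Jbar : ℕ → ℕ}
  {ginv : (m : ℕ) → Matrix (Fin m) (Fin m) ℝ → Matrix (Fin m) (Fin m) ℝ}

theorem supNorm_hHat_sub_le (hv : M.IsSieve) (hd : M.DataAssumption H) {j l : ℕ}
    (hj : j ∈ M.Js) (hl : l ∈ M.Js) (n : ℕ) (ω : Ω) :
    M.supNorm (fun x => M.hHat ginv n j ω x - M.hHat ginv n l ω x) ≤
      M.loss ginv n j ω + M.loss ginv n l ω := by
  refine supNorm_le (add_nonneg (supNorm_nonneg _) (supNorm_nonneg _)) fun x hx => ?_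
  have h1 := le_supNorm ((hv.bddX_sieveFun hj (M.cHat ginv n j ω)).sub hd.bddX_h0) hx
  have h2 := le_supNorm ((hv.bddX_sieveFun hl (M.cHat ginv n l ω)).sub hd.bddX_h0) hx
  calc _ = |(M.hHat ginv n j ω x - M.h0 x) - (M.hHat ginv n l ω x - M.h0 x)| := by
        congr 1; ring
    _ ≤ _ := (abs_sub _ _).trans (add_le_add h1 h2)

theorem loss_le_add (hv : M.IsSieve) (hd : M.DataAssumption H) {j l : ℕ}
    (hj : j ∈ M.Js) (hl : l ∈ M.Js) (n : ℕ) (ω : Ω) :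
    M.loss ginv n j ω ≤
      M.supNorm (fun x => M.hHat ginv n j ω x - M.hHat ginv n l ω x) + M.loss ginv n l ω := by
  refine supNorm_le (add_nonneg (supNorm_nonneg _) (supNorm_nonneg _)) fun x hx => ?_
  have h1 := le_supNorm ((hv.bddX_sieveFun hj (M.cHat ginv n j ω)).sub
    (hv.bddX_sieveFun hl (M.cHat ginv n l ω))) hx
  have h2 := le_supNorm ((hv.bddX_sieveFun hl (M.cHat ginv n l ω)).sub hd.bddX_h0) hx
  calc _ = |(M.hHat ginv n j ω x - M.hHat ginv n l ω x) + (M.hHat ginv n l ω x - M.h0 x)| := by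
        congr 1; ring
    _ ≤ _ := (abs_add_le _ _).trans (add_le_add h1 h2)

theorem indexSet_mono {n a b : ℕ} (h : a ≤ b) : M.indexSet n a ⊆ M.indexSet n b :=
  fun _ hj => ⟨hj.1, hj.2.1, hj.2.2.trans h⟩

/-- The oracle inequality on the event of uniform bounds. -/
theorem UniformBounds.loss_Jhat_le (hv : M.IsSieve) (hs : M.IsSample) (hd : M.DataAssumption H)
    {σ C η Cb C0 : ℝ} (hσ : 0 < σ) (hC : 0 < C) (hη : 0 < η) (hη1 : η ≤ 1 / 20)
    (hC0 : C * (1 + Cb) * C0 ≤ √2 * σ * η) (hCb : 0 ≤ Cb) {Jlow : ℕ → ℕ} {JmaxHat : ℕ → Ω → ℕ}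
    {n : ℕ} {ω : Ω}
    (h : M.UniformBounds ginv σ C η n (Jbar n) ω) (h1 : Jlow n ≤ JmaxHat n ω)
    (h2 : JmaxHat n ω ≤ Jbar n) (hV : MonotoneOn (M.Vsup n) (M.indexSet n (Jbar n)))
    (hbias : ∀ j ∈ M.indexSet n (Jbar n), ∀ l ∈ M.indexSet n (Jbar n), j ≤ l →
      M.bias l ≤ Cb * M.bias j)
    (hne : (M.oracleSet C0 Jlow n).Nonempty) :
    M.loss ginv n (M.Jhat ginv σ JmaxHat n ω) ω ≤
      M.loss ginv n (M.J0 C0 Jlow n) ω + 3 * σ * M.Vsup n (M.J0 C0 Jlow n) ∧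
    M.loss ginv n (M.J0 C0 Jlow n) ω ≤
      C * M.bias (M.J0 C0 Jlow n) + √2 * σ * M.Vsup n (M.J0 C0 Jlow n) := by
  have hmem : M.J0 C0 Jlow n ∈ M.oracleSet C0 Jlow n := Nat.sInf_mem hne
  set j0 := M.J0 C0 Jlow n
  have hj0 : j0 ∈ M.indexSet n (JmaxHat n ω) := indexSet_mono h1 hmem.1
  have hj0' : j0 ∈ M.indexSet n (Jbar n) := indexSet_mono h2 hj0
  have hV0 := Vsup_nonneg hv hs hd hj0.1 n
  have hs2 : 0 ≤ √2 * σ := by positivity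
  obtain ⟨l0, v0, v0'⟩ := h j0 hj0'
  -- The losses use 1 − 2η of the threshold and the estimated V̂ loses at most η. The remaining η at
  -- J_0 covers the biases at J_0 and at every later l, both bounded by multiples of bias(J_0) ≤ C_0
  -- V(J_0).
  have hlep : j0 ∈ M.lepskiSet ginv σ JmaxHat n ω := by
    refine ⟨hj0, fun l hl hjl => ?_⟩
    have hl' := indexSet_mono h2 hl
    obtain ⟨l1, v1, -⟩ := h l hl'
    have hVl := Vsup_nonneg hv hs hd hl.1 n
    refine (supNorm_hHat_sub_le hv hd hj0.1 hl.1 n ω).trans ?_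
    have b1 : C * M.bias l ≤ C * (Cb * M.bias j0) :=
      mul_le_mul_of_nonneg_left (hbias j0 hj0' l hl' hjl) hC.le
    have b2 : C * (1 + Cb) * M.bias j0 ≤ √2 * σ * η * M.Vsup n j0 :=
      calc _ ≤ C * (1 + Cb) * (C0 * M.Vsup n j0) :=
            mul_le_mul_of_nonneg_left hmem.2 (by positivity)
        _ = C * (1 + Cb) * C0 * M.Vsup n j0 := by ring
        _ ≤ _ := mul_le_mul_of_nonneg_right hC0 hV0
    have b3 : 0 ≤ √2 * σ * (η * M.Vsup n l) := by positivity
    have b4 := mul_le_mul_of_nonneg_left (add_le_add v0 v1) hs2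
    linarith
  have hle : M.Jhat ginv σ JmaxHat n ω ≤ j0 := Nat.sInf_le hlep
  have hJ : M.Jhat ginv σ JmaxHat n ω ∈ M.lepskiSet ginv σ JmaxHat n ω := Nat.sInf_mem ⟨_, hlep⟩
  set jh := M.Jhat ginv σ JmaxHat n ω
  have hjh' : jh ∈ M.indexSet n (Jbar n) := indexSet_mono h2 hJ.1
  constructor
  · refine (loss_le_add hv hd hJ.1.1 hj0.1 n ω).trans ?_
    have c1 := hJ.2 j0 hj0 hle
    have c2 := (h jh hjh').2.2
    have c3 := hV hjh' hj0' hle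
    have c4 : √2 ≤ 71 / 50 := by rw [Real.sqrt_le_left (by norm_num)]; norm_num
    have c5 : M.VsupHat ginv n jh ω + M.VsupHat ginv n j0 ω ≤ 2 * (1 + η) * M.Vsup n j0 := by
      have := mul_le_mul_of_nonneg_left c3 (by linarith : 0 ≤ 1 + η)
      linarith
    -- This is what η ≤ 1/20 is for: 2√2·1.05 is just below 3.
    have c6 : √2 * (2 * (1 + η)) ≤ 3 :=
      calc √2 * (2 * (1 + η)) ≤ 71 / 50 * (2 * (1 + 1 / 20)) := by gcongr
        _ ≤ 3 := by norm_num
    have c7 : √2 * σ * (M.VsupHat ginv n jh ω + M.VsupHat ginv n j0 ω) ≤ 3 * σ * M.Vsup n j0 :=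
      calc _ ≤ √2 * σ * (2 * (1 + η) * M.Vsup n j0) := mul_le_mul_of_nonneg_left c5 hs2
        _ = √2 * (2 * (1 + η)) * (σ * M.Vsup n j0) := by ring
        _ ≤ 3 * (σ * M.Vsup n j0) := mul_le_mul_of_nonneg_right c6 (by positivity)
        _ = _ := by ring
    linarith
  · have : 0 ≤ √2 * σ * (2 * η * M.Vsup n j0) := by positivity
    linarith

end NPIV.Model

end

theorem theorem3p1 {Ω : Type*} [MeasurableSpace Ω] {d dw : ℕ} (M : NPIV.Model Ω d dw)
    (ginv : (m : ℕ) → Matrix (Fin m) (Fin m) ℝ → Matrix (Fin m) (Fin m) ℝ)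
    (hginv : NPIV.IsGeneralizedInverse ginv)
    (hsample : M.IsSample) (hsieve : M.IsSieve)
    (H : Set ((Fin d → ℝ) → ℝ)) (σ δ : ℝ) (hσ : 0 < σ) (hδ : 0 < δ) (Jbar : ℕ → ℕ)
    (hdata : M.DataAssumption H) (hres : M.ResidualAssumption σ δ)
    (hgrowth : M.SieveAssumption δ Jbar) (happrox : M.ApproxAssumption)
    (hmono : M.MonotoneAssumption Jbar) :
    ∃ Cbar : ℝ, 0 < Cbar ∧
      ∀ (Jlow : ℕ → ℕ) (JmaxHat : ℕ → Ω → ℕ),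
        M.IndexBounds Jlow Jbar →
        NPIV.WPA1 M.μ (fun n => {ω | Jlow n ≤ JmaxHat n ω ∧ JmaxHat n ω ≤ Jbar n}) →
        ∀ C0 : ℝ, 0 < C0 → C0 ≤ Cbar →
          (∀ᶠ n in atTop, (M.oracleSet C0 Jlow n).Nonempty) →
          NPIV.WPA1 M.μ (fun n => {ω |
            M.loss ginv n (M.Jhat ginv σ JmaxHat n ω) ω ≤
              M.loss ginv n (M.J0 C0 Jlow n) ω + 3 * σ * M.Vsup n (M.J0 C0 Jlow n)}) ∧
          NPIV.IsBigOInProb M.μ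
            (fun n ω => M.loss ginv n (M.Jhat ginv σ JmaxHat n ω) ω)
            (fun n => M.bias (M.J0 C0 Jlow n) +
              M.tau (M.J0 C0 Jlow n) * M.xi (M.J0 C0 Jlow n) *
                √(Real.log n / (n * M.e (M.J0 C0 Jlow n)))) := by
  obtain ⟨C, η, hC, hη, hη1, hgood⟩ := NPIV.Model.exists_tendsto_measure_not_uniformBounds hginv
    hsample hsieve hdata hσ hδ hres hgrowth happrox hmono
  obtain ⟨Cb, hbias⟩ := hmono.bias
  -- The largest C_0 for which the two biases fit into the slack √2ησV(J_0). The absolute value is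
  -- taken as the sign of the monotonicity constant is not known.
  refine ⟨√2 * σ * η / (C * (1 + |Cb|)), by positivity, ?_⟩
  intro Jlow JmaxHat hidx hJmax C0 hC0 hC0' hne
  have hC0'' : C * (1 + |Cb|) * C0 ≤ √2 * σ * η := by
    rw [le_div_iff₀ (by positivity)] at hC0'
    linarith
  have hbad := hgood hidx.mem_bar (by
    filter_upwards [hidx.min_lt_low, hidx.low_le_bar] with n h1 h2 using h1.le.trans h2)
  have hsum := hbad.add hJmax
  rw [add_zero] at hsum
  have hkey : ∀ᶠ n in atTop, ∀ ω, ω ∉ ({ω | ¬ M.UniformBounds ginv σ C η n (Jbar n) ω} ∪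
      {ω | Jlow n ≤ JmaxHat n ω ∧ JmaxHat n ω ≤ Jbar n}ᶜ : Set Ω) →
      M.loss ginv n (M.Jhat ginv σ JmaxHat n ω) ω ≤
        M.loss ginv n (M.J0 C0 Jlow n) ω + 3 * σ * M.Vsup n (M.J0 C0 Jlow n) ∧
      M.loss ginv n (M.J0 C0 Jlow n) ω ≤
        C * M.bias (M.J0 C0 Jlow n) + √2 * σ * M.Vsup n (M.J0 C0 Jlow n) := by
    filter_upwards [hne, hmono.Vsup, hbias] with n h1 h2 h3 ω hω
    simp only [Set.mem_union, Set.mem_compl_iff, Set.mem_ofPred_eq, not_or, not_not] at hω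
    refine hω.1.loss_Jhat_le hsieve hsample hdata hσ hC hη hη1 hC0'' (abs_nonneg _) hω.2.1 hω.2.2
      h2 (fun j hj l hl hjl => (h3 j hj l hl hjl).trans ?_) h1
    exact mul_le_mul_of_nonneg_right (le_abs_self _) (NPIV.Model.supNorm_nonneg _)
  constructor
  · refine tendsto_of_tendsto_of_tendsto_of_le_of_le' tendsto_const_nhds hsum
      (Eventually.of_forall fun _ => zero_le) ?_
    filter_upwards [hkey] with n hn
    refine le_trans (measure_mono fun ω hω => ?_) (measure_union_le _ _)
    by_contra hcon
    exact hω (hn ω hcon).1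
  · intro ε hε
    -- On the good event the loss at Ĵ is at most C·bias(J_0) + (√2σ + 3σ)V(J_0); the sum of both
    -- coefficients serves bias and V at once.
    refine ⟨C + (√2 * σ + 3 * σ), by positivity, ?_⟩
    filter_upwards [hkey, hne, hsum.eventually (gt_mem_nhds (ENNReal.ofReal_pos.2 hε))]
      with n hn h1 hlt
    refine le_trans (le_trans (measure_mono fun ω hω => ?_) (measure_union_le _ _)) hlt.le
    by_contra hcon
    obtain ⟨k1, k2⟩ := hn ω hcon
    have hmem : M.J0 C0 Jlow n ∈ M.oracleSet C0 Jlow n := Nat.sInf_mem h1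
    have hV := NPIV.Model.Vsup_nonneg hsieve hsample hdata hmem.1.1 n
    have hb : 0 ≤ M.bias (M.J0 C0 Jlow n) := NPIV.Model.supNorm_nonneg _
    have hl : 0 ≤ M.loss ginv n (M.Jhat ginv σ JmaxHat n ω) ω := NPIV.Model.supNorm_nonneg _
    change (C + (√2 * σ + 3 * σ)) *
      |M.bias (M.J0 C0 Jlow n) + M.Vsup n (M.J0 C0 Jlow n)| <
        |M.loss ginv n (M.Jhat ginv σ JmaxHat n ω) ω| at hω
    rw [abs_of_nonneg (add_nonneg hb hV), abs_of_nonneg hl] at hω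
    have m1 : 0 ≤ (√2 * σ + 3 * σ) * M.bias (M.J0 C0 Jlow n) := by positivity
    have m2 : 0 ≤ C * M.Vsup n (M.J0 C0 Jlow n) := by positivity
    linarith
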